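/- Let $1<p,q<\infty$, let $\mathcal I=[0,t_0]$ with $t_0>0$, $|\mathcal I|=t_0$, and let $W^{2,p}_{\mathrm D}(\mathcal I)=\{f\in W^{2,p}(\mathcal I): f(0)=f(t_0)=0\}$, normed by $\|f\|=\|f''\|_{L^p(\mathcal I)}$. Let $E_2:W^{2,p}_{\mathrm D}(\mathcal I)\to L^q(\mathcal I)$ be the embedding $f\mapsto f$. For a bounded linear operator $S:X\to Y$ between real Banach spaces and $n\ge 1$, the approximation numbers are $a_n(S)=\inf\{\|S-F\| : F\in B(X,Y),\ \operatorname{rank}F<n\}$, and the isomorphism numbers are $i_n(S)=\sup\|A\|^{-1}\|B\|^{-1}$, the supremum being taken over all Banach spaces $G$ with $\dim G\ge n$ and all $A\in B(Y,G)$, $B\in B(G,X)$ such that $ASB$ is the identity on $G$. Write $[x]^{r}_{*}=|x|^{r-2}x$. A spectral couple on $[0,T]$, $T>0$, is a pair $(f,\lambda)$ with $f\neq 0$, $\lambda>0$, $f$ and $[f'']^{p}_{*}$ twice continuously differentiable on $[0,T]$, $$([f'']^{p}_{*})''=\lambda\,[f]^{q}_{*}\ \text{ on }[0,T],\qquad f(0)=f(T)=f''(0)=f''(T)=0,$$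 $\|f''\|_{L^p([0,T])}=1$ and $f'(0)>0$. Then, for every $n\ge1$, there is exactly one $\lambda$ that belongs to a spectral couple on $\mathcal I$ whose function has exactly $n-1$ zeros in $(0,t_0)$; denote it by $\operatorname{sn}_n$. Likewise let $\lambda_1$ be the unique $\lambda$ that belongs to a spectral couple on $[0,1]$ whose function has no zero in $(0,1)$. The following hold for all $n\ge 1$. (i) If $p<q$, then $$i_n(E_2)\ \ge\ \operatorname{sn}_n^{-1/q}=\frac{|\mathcal I|^{1/q+2-1/p}}{n^2\lambda_1^{1/q}}.$$ (ii) If $p\ge q$, then $$a_n(E_2)\ \le\ \operatorname{sn}_n^{-1/q}=\frac{|\mathcal I|^{1/q+2-1/p}}{n^2\lambda_1^{1/q}}.$$ -/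

import Mathlib

open MeasureTheory Set Filter
open scoped ENNReal ContDiff

noncomputable section

namespace Biharmonic

/-! ### Lebesgue spaces on the segment `[0, T]` -/

/-- Lebesgue measure on the segment `[0, T]`. -/
abbrev segMeasure (T : ℝ) : Measure ℝ := volume.restrict (Icc 0 T)

/-- The real Lebesgue space `L^p([0, T])`. -/
abbrev LSeg (p T : ℝ) : Type := Lp ℝ (ENNReal.ofReal p) (segMeasure T)

instance factOneLe (p : ℝ) [hp : Fact (1 < p)] : Fact (1 ≤ ENNReal.ofReal p) :=
  ⟨by simpa using hp.out.le⟩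

/-! ### Weak derivatives on the open interval `(0, T)` -/

/-- `g` is a weak (distributional) derivative of `f` on `(0, T)`. -/
def IsWeakDeriv (T : ℝ) (f g : ℝ → ℝ) : Prop :=
  ∀ φ : ℝ → ℝ, ContDiff ℝ ∞ φ → HasCompactSupport φ → tsupport φ ⊆ Ioo 0 T →
    ∫ t in (0 : ℝ)..T, f t * deriv φ t = -∫ t in (0 : ℝ)..T, g t * φ t

/-- The trace condition `f 0 = f T = 0`, for the continuous representative of `f` on `[0, T]`. -/
def VanishesAtEnds (T : ℝ) (f : ℝ → ℝ) : Prop :=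
  ∃ c : ℝ → ℝ, ContinuousOn c (Icc 0 T) ∧ f =ᵐ[segMeasure T] c ∧ c 0 = 0 ∧ c T = 0

theorem LSeg.intervalIntegrable {p T : ℝ} (hp : 1 < p) (hT : 0 < T) (f : LSeg p T) :
    IntervalIntegrable f volume 0 T := by
  have h1 : Integrable f (segMeasure T) := by
    have := (Lp.memLp f).integrable (by simpa using hp.le)
    exact this
  rw [intervalIntegrable_iff_integrableOn_Icc_of_le hT.le]
  exact h1

theorem ae_interval_of_ae_seg {T : ℝ} (hT : 0 < T) {P : ℝ → Prop}
    (h : ∀ᵐ t ∂(segMeasure T), P t) : ∀ᵐ t, t ∈ Set.uIoc 0 T → P t := by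
  rw [uIoc_of_le hT.le]
  have := (ae_restrict_iff' measurableSet_Icc).1 h
  filter_upwards [this] with t ht h2
  exact ht (Ioc_subset_Icc_self h2)

theorem IsWeakDeriv.congr {T : ℝ} (hT : 0 < T) {f g f' g' : ℝ → ℝ} (h : IsWeakDeriv T f g)
    (hf : f =ᵐ[segMeasure T] f') (hg : g =ᵐ[segMeasure T] g') : IsWeakDeriv T f' g' := by
  intro φ h1 h2 h3
  have e1 : ∫ t in (0 : ℝ)..T, f' t * deriv φ t = ∫ t in (0 : ℝ)..T, f t * deriv φ t := by
    refine intervalIntegral.integral_congr_ae ?_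
    refine ae_interval_of_ae_seg hT ?_
    filter_upwards [hf] with t ht
    rw [ht]
  have e2 : ∫ t in (0 : ℝ)..T, g' t * φ t = ∫ t in (0 : ℝ)..T, g t * φ t := by
    refine intervalIntegral.integral_congr_ae ?_
    refine ae_interval_of_ae_seg hT ?_
    filter_upwards [hg] with t ht
    rw [ht]
  rw [e1, e2]
  exact h φ h1 h2 h3

theorem IsWeakDeriv.linear {T : ℝ} {f g f' g' : ℝ → ℝ}
    (hf : IntervalIntegrable f volume 0 T) (hg : IntervalIntegrable g volume 0 T)
    (hf' : IntervalIntegrable f' volume 0 T) (hg' : IntervalIntegrable g' volume 0 T)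
    (h : IsWeakDeriv T f g) (h' : IsWeakDeriv T f' g') (a b : ℝ) :
    IsWeakDeriv T (fun t => a * f t + b * f' t) (fun t => a * g t + b * g' t) := by
  intro φ h1 h2 h3
  have c0 : Continuous φ := h1.continuous
  have c1 : Continuous (deriv φ) := h1.continuous_deriv (by simp)
  have e1 : ∫ t in (0 : ℝ)..T, (a * f t + b * f' t) * deriv φ t =
      a * (∫ t in (0 : ℝ)..T, f t * deriv φ t) + b * ∫ t in (0 : ℝ)..T, f' t * deriv φ t := by
    rw [← intervalIntegral.integral_const_mul, ← intervalIntegral.integral_const_mul,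
      ← intervalIntegral.integral_add]
    · congr 1; ext t; ring
    · exact (hf.mul_continuousOn c1.continuousOn).const_mul a
    · exact (hf'.mul_continuousOn c1.continuousOn).const_mul b
  have e2 : ∫ t in (0 : ℝ)..T, (a * g t + b * g' t) * φ t =
      a * (∫ t in (0 : ℝ)..T, g t * φ t) + b * ∫ t in (0 : ℝ)..T, g' t * φ t := by
    rw [← intervalIntegral.integral_const_mul, ← intervalIntegral.integral_const_mul,
      ← intervalIntegral.integral_add]
    · congr 1; ext t; ring
    · exact (hg.mul_continuousOn c0.continuousOn).const_mul a
    · exact (hg'.mul_continuousOn c0.continuousOn).const_mul b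
  rw [e1, e2, h φ h1 h2 h3, h' φ h1 h2 h3]
  ring

/-- Lemma of du Bois-Reymond: an integrable function with zero weak derivative is constant. -/
theorem IsWeakDeriv.ae_eq_const {T : ℝ} (hT : 0 < T) {h : ℝ → ℝ}
    (hi : IntervalIntegrable h volume 0 T) (hw : IsWeakDeriv T h (fun _ => 0)) :
    ∃ c : ℝ, h =ᵐ[segMeasure T] fun _ => c := by
  -- a normalised bump function
  let f : ContDiffBump (T / 2) := ⟨T / 8, T / 4, by positivity, by linarith⟩
  let η : ℝ → ℝ := f.normed volume
  have ηs : ContDiff ℝ ∞ η := f.contDiff_normed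
  have ηc : HasCompactSupport η := f.hasCompactSupport_normed
  have ηt : tsupport η ⊆ Ioo 0 T := by
    have : tsupport η = Metric.closedBall (T / 2) (T / 4) := f.tsupport_normed_eq
    rw [this, Real.closedBall_eq_Icc]
    intro x hx
    constructor <;> linarith [hx.1, hx.2]
  have supp_int : ∀ ψ : ℝ → ℝ, tsupport ψ ⊆ Ioo 0 T → ∀ k : ℝ → ℝ,
      ∫ t, ψ t * k t = ∫ t in (0 : ℝ)..T, k t * ψ t := by
    intro ψ hψ k
    rw [intervalIntegral.integral_of_le hT.le, ← setIntegral_eq_integral_of_forall_compl_eq_zero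
      (s := Ioc 0 T)]
    · congr 1; ext t; ring
    · intro x hx
      have : ψ x = 0 := by
        by_contra hne
        exact hx (Ioo_subset_Ioc_self (hψ (subset_tsupport ψ hne)))
      simp [this]
  have ηint : ∫ t in (0 : ℝ)..T, η t = 1 := by
    have h1 := supp_int η ηt (fun _ => 1)
    simp only [mul_one, one_mul] at h1
    rw [← h1]
    exact f.integral_normed
  set c : ℝ := ∫ t in (0 : ℝ)..T, h t * η t with hc
  refine ⟨c, ?_⟩
  have hloc : LocallyIntegrableOn (fun t => h t - c) (Ioo 0 T) := by
    apply IntegrableOn.locallyIntegrableOn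
    have h1 : IntegrableOn h (Ioo 0 T) :=
      ((intervalIntegrable_iff_integrableOn_Ioo_of_le hT.le).1 hi)
    have h2 : IntegrableOn (fun _ : ℝ => c) (Ioo 0 T) := by
      apply integrableOn_const
      · simp
      · simp
    exact Integrable.sub h1 h2
  have key := isOpen_Ioo.ae_eq_zero_of_integral_contDiff_smul_eq_zero hloc (by
    intro ψ ψs ψc ψt
    simp only [smul_eq_mul]
    rw [supp_int ψ ψt (fun t => h t - c)]
    set m : ℝ := ∫ t in (0 : ℝ)..T, ψ t with hm
    let ρ : ℝ → ℝ := fun t => ψ t - m * η t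
    have ρs : ContDiff ℝ ∞ ρ := ψs.sub (contDiff_const.mul ηs)
    have ρcont : Continuous ρ := ρs.continuous
    let φ : ℝ → ℝ := fun t => ∫ s in (0 : ℝ)..t, ρ s
    have φd : ∀ t, HasDerivAt φ (ρ t) t := fun t =>
      intervalIntegral.integral_hasDerivAt_right (ρcont.intervalIntegrable _ _)
        (ρcont.stronglyMeasurableAtFilter _ _) ρcont.continuousAt
    have φderiv : deriv φ = ρ := funext fun t => (φd t).deriv
    have φs : ContDiff ℝ ∞ φ := by
      rw [contDiff_infty_iff_deriv]
      exact ⟨fun t => (φd t).differentiableAt, by rw [φderiv]; exact ρs⟩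
    -- the support of `ρ` is contained in some `[a, b] ⊆ (0, T)`
    have hK : IsCompact (tsupport ψ ∪ tsupport η) := ψc.isCompact.union ηc.isCompact
    have hKs : tsupport ψ ∪ tsupport η ⊆ Ioo 0 T := union_subset ψt ηt
    obtain ⟨a, b, ha, hab, hb, hKab⟩ : ∃ a b : ℝ, 0 < a ∧ a ≤ b ∧ b < T ∧
        tsupport ψ ∪ tsupport η ⊆ Icc a b := by
      have hne : (tsupport ψ ∪ tsupport η).Nonempty := by
        refine ⟨T / 2, Or.inr ?_⟩
        have : tsupport η = Metric.closedBall (T / 2) (T / 4) := f.tsupport_normed_eq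
        rw [this]
        exact Metric.mem_closedBall_self (by positivity)
      have hi := hK.sInf_mem hne
      have hs := hK.sSup_mem hne
      refine ⟨sInf _, sSup _, (hKs hi).1, ?_, (hKs hs).2, ?_⟩
      · exact csInf_le hK.bddBelow hs
      · intro x hx
        exact ⟨csInf_le hK.bddBelow hx, le_csSup hK.bddAbove hx⟩
    have ρz : ∀ x, x ∉ Icc a b → ρ x = 0 := by
      intro x hx
      have h1 : ψ x = 0 := by
        by_contra hne
        exact hx (hKab (Or.inl (subset_tsupport ψ hne)))
      have h2 : η x = 0 := by
        by_contra hne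
        exact hx (hKab (Or.inr (subset_tsupport η hne)))
      simp [ρ, h1, h2]
    have ρT : φ T = 0 := by
      change ∫ s in (0 : ℝ)..T, (ψ s - m * η s) = 0
      rw [intervalIntegral.integral_sub (ψs.continuous.intervalIntegrable _ _)
        ((ηs.continuous.intervalIntegrable _ _).const_mul m),
        intervalIntegral.integral_const_mul, ηint]
      simp [hm]
    have φz : ∀ x, x ∉ Icc a b → φ x = 0 := by
      intro x hx
      rcases lt_or_ge x a with h1 | h1
      · refine intervalIntegral.integral_zero_ae (ae_of_all _ ?_)
        intro s hs
        apply ρz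
        intro h2
        have := (mem_uIoc.1 hs)
        rcases this with h3 | h3 <;> linarith [h2.1, h3.1, h3.2]
      · have h1 : b < x := by
          by_contra h3
          exact hx ⟨h1, not_lt.1 h3⟩
        have h2 : φ x - φ T = ∫ s in T..x, ρ s :=
          intervalIntegral.integral_interval_sub_left (ρcont.intervalIntegrable _ _)
            (ρcont.intervalIntegrable _ _)
        have h3 : ∫ s in T..x, ρ s = 0 := by
          refine intervalIntegral.integral_zero_ae (ae_of_all _ ?_)
          intro s hs
          apply ρz
          intro h2
          have := (mem_uIoc.1 hs)
          rcases this with h3 | h3 <;> linarith [h2.2, h3.1, h3.2]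
        linarith
    have φt : tsupport φ ⊆ Icc a b := by
      refine closure_minimal ?_ isClosed_Icc
      intro x hx
      by_contra h1
      exact hx (φz x h1)
    have φc : HasCompactSupport φ := isCompact_Icc.of_isClosed_subset (isClosed_tsupport φ) φt
    have h1 := hw φ φs φc (φt.trans fun x hx => ⟨ha.trans_le hx.1, hx.2.trans_lt hb⟩)
    rw [φderiv] at h1
    simp only [zero_mul, intervalIntegral.integral_zero, neg_zero] at h1
    have h2 : ∫ t in (0 : ℝ)..T, h t * ρ t =
        (∫ t in (0 : ℝ)..T, h t * ψ t) - m * c := by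
      rw [hc, ← intervalIntegral.integral_const_mul, ← intervalIntegral.integral_sub
        (hi.mul_continuousOn ψs.continuous.continuousOn)
        ((hi.mul_continuousOn ηs.continuous.continuousOn).const_mul m)]
      congr 1; ext t; simp only [ρ]; ring
    have h3 : ∫ t in (0 : ℝ)..T, (h t - c) * ψ t =
        (∫ t in (0 : ℝ)..T, h t * ψ t) - c * m := by
      rw [hm, ← intervalIntegral.integral_const_mul, ← intervalIntegral.integral_sub
        (hi.mul_continuousOn ψs.continuous.continuousOn)
        ((ψs.continuous.intervalIntegrable _ _).const_mul c)]
      congr 1; ext t; ring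
    rw [h3]
    linarith)
  have h4 : ∀ᵐ t ∂(volume.restrict (Ioo 0 T)), h t = c := by
    rw [ae_restrict_iff' measurableSet_Ioo]
    filter_upwards [key] with t ht h5
    linarith [ht h5]
  change ∀ᵐ t ∂(volume.restrict (Icc 0 T)), h t = c
  rwa [← restrict_Ioo_eq_restrict_Icc]

/-- A function with an integrable weak derivative is a.e. a primitive of it. -/
theorem IsWeakDeriv.ae_eq_primitive {T : ℝ} (hT : 0 < T) {f g : ℝ → ℝ}
    (hf : IntervalIntegrable f volume 0 T) (hg : IntervalIntegrable g volume 0 T)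
    (hw : IsWeakDeriv T f g) :
    ∃ c : ℝ, f =ᵐ[segMeasure T] fun t => c + ∫ s in (0 : ℝ)..t, g s := by
  let G : ℝ → ℝ := fun t => ∫ s in (0 : ℝ)..t, g s
  have hGac : AbsolutelyContinuousOnInterval G 0 T :=
    hg.absolutelyContinuousOnInterval_intervalIntegral (c := 0) (by simp)
  have hGi : IntervalIntegrable G volume 0 T := hGac.continuousOn.intervalIntegrable
  have hGw : IsWeakDeriv T G g := by
    intro φ φs φc φt
    have hφac : AbsolutelyContinuousOnInterval φ 0 T :=
      (φs.contDiffOn.of_le (by simp)).absolutelyContinuousOnInterval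
    rw [hGac.integral_mul_deriv_eq_deriv_mul hφac]
    have z : ∀ x, x ∉ Ioo 0 T → φ x = 0 := by
      intro x hx
      by_contra hne
      exact hx (φt (subset_tsupport φ hne))
    rw [z 0 (by simp), z T (by simp)]
    have : ∫ x in (0 : ℝ)..T, deriv G x * φ x = ∫ x in (0 : ℝ)..T, g x * φ x := by
      apply intervalIntegral.integral_congr_ae
      filter_upwards [hg.ae_hasDerivAt_integral] with x hx h2
      rw [(hx (uIoc_subset_uIcc h2) 0 (by simp)).deriv]
    rw [this]
    ring
  have h0 : IsWeakDeriv T (fun t => f t - G t) (fun _ => 0) := by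
    have := hw.linear hf hg hGi hg hGw 1 (-1)
    have e1 : (fun t => 1 * f t + -1 * G t) = fun t => f t - G t := by ext t; ring
    have e2 : (fun t => 1 * g t + -1 * g t) = fun _ => (0 : ℝ) := by ext t; ring
    rwa [e1, e2] at this
  obtain ⟨c, hc⟩ := h0.ae_eq_const hT (hf.sub hGi)
  refine ⟨c, ?_⟩
  filter_upwards [hc] with t ht
  simp only [G] at ht
  linarith

/-! ### The Sobolev space `W^{2,p}_D` -/

/-- The functions of `W^{2,p}([0, T])` that vanish at both ends, each one given together with its
first and second weak derivatives (which it determines): triples `(u, u', u'')` in `L^p`. -/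
def sobolevTriples (p T : ℝ) [hp : Fact (1 < p)] [hT : Fact (0 < T)] :
    Submodule ℝ (LSeg p T × LSeg p T × LSeg p T) where
  carrier := {w | IsWeakDeriv T w.1 w.2.1 ∧ IsWeakDeriv T w.2.1 w.2.2 ∧ VanishesAtEnds T w.1}
  zero_mem' := by
    have z : ((0 : LSeg p T) : ℝ → ℝ) =ᵐ[segMeasure T] fun _ => 0 := Lp.coeFn_zero _ _ _
    have h0 : IsWeakDeriv T (fun _ => 0) (fun _ => 0) := by
      intro φ _ _ _; simp
    exact ⟨h0.congr hT.out z.symm z.symm, h0.congr hT.out z.symm z.symm,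
      fun _ => 0, continuousOn_const, z, rfl, rfl⟩
  add_mem' := by
    rintro x y ⟨hx1, hx2, cx, hxc, hxe, hx0, hxT⟩ ⟨hy1, hy2, cy, hyc, hye, hy0, hyT⟩
    have ii := fun f : LSeg p T => LSeg.intervalIntegrable hp.out hT.out f
    have lin : ∀ f g : LSeg p T, (fun t => 1 * f t + 1 * g t) =ᵐ[segMeasure T] (f + g : LSeg p T) := by
      intro f g
      filter_upwards [Lp.coeFn_add f g] with t ht
      rw [ht]; simp
    refine ⟨(hx1.linear (ii _) (ii _) (ii _) (ii _) hy1 1 1).congr hT.out (lin _ _) (lin _ _),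
      (hx2.linear (ii _) (ii _) (ii _) (ii _) hy2 1 1).congr hT.out (lin _ _) (lin _ _),
      fun t => cx t + cy t, hxc.add hyc, ?_, by simp [hx0, hy0], by simp [hxT, hyT]⟩
    filter_upwards [lin x.1 y.1, hxe, hye] with t h1 h2 h3
    rw [Prod.fst_add, ← h1, h2, h3]; ring
  smul_mem' := by
    rintro a x ⟨hx1, hx2, cx, hxc, hxe, hx0, hxT⟩
    have ii := fun f : LSeg p T => LSeg.intervalIntegrable hp.out hT.out f
    have lin : ∀ f : LSeg p T, (fun t => a * f t + 0 * f t) =ᵐ[segMeasure T] (a • f : LSeg p T) := by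
      intro f
      filter_upwards [Lp.coeFn_smul a f] with t ht
      rw [ht]; simp
    refine ⟨(hx1.linear (ii _) (ii _) (ii _) (ii _) hx1 a 0).congr hT.out (lin _) (lin _),
      (hx2.linear (ii _) (ii _) (ii _) (ii _) hx2 a 0).congr hT.out (lin _) (lin _),
      fun t => a * cx t, continuousOn_const.mul hxc, ?_, by simp [hx0], by simp [hxT]⟩
    filter_upwards [lin x.1, hxe] with t h1 h2
    rw [Prod.smul_fst, ← h1, h2]; ring

/-- The Sobolev space `W^{2,p}_D([0, T])`; its norm is `‖u''‖_p`, see below. -/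
def W2D (p T : ℝ) [Fact (1 < p)] [Fact (0 < T)] : Type := sobolevTriples p T

section W2D

variable (p T : ℝ) [hp : Fact (1 < p)] [hT : Fact (0 < T)]

instance instAddCommGroupW2D : AddCommGroup (W2D p T) :=
  inferInstanceAs (AddCommGroup (sobolevTriples p T))

instance instModuleW2D : Module ℝ (W2D p T) :=
  inferInstanceAs (Module ℝ (sobolevTriples p T))

/-- The function `u`, as an element of `L^p`. -/
def W2D.fn : W2D p T →ₗ[ℝ] LSeg p T :=
  (LinearMap.fst ℝ _ _).comp (sobolevTriples p T).subtype

/-- The weak derivative `u'`. -/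
def W2D.d1 : W2D p T →ₗ[ℝ] LSeg p T :=
  ((LinearMap.fst ℝ _ _).comp (LinearMap.snd ℝ _ _)).comp (sobolevTriples p T).subtype

/-- The second weak derivative `u''`. -/
def W2D.d2 : W2D p T →ₗ[ℝ] LSeg p T :=
  ((LinearMap.snd ℝ _ _).comp (LinearMap.snd ℝ _ _)).comp (sobolevTriples p T).subtype

variable {p T}

theorem W2D.spec (u : W2D p T) :
    IsWeakDeriv T (W2D.fn p T u) (W2D.d1 p T u) ∧ IsWeakDeriv T (W2D.d1 p T u) (W2D.d2 p T u) ∧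
      VanishesAtEnds T (W2D.fn p T u) := u.2

/-- `u` is recovered from `u''` by integrating twice. -/
theorem W2D.repr (u : W2D p T) : ∃ a : ℝ,
    (W2D.d1 p T u =ᵐ[segMeasure T] fun t => a + ∫ s in (0 : ℝ)..t, W2D.d2 p T u s) ∧
    (W2D.fn p T u =ᵐ[segMeasure T]
      fun t => ∫ r in (0 : ℝ)..t, (a + ∫ s in (0 : ℝ)..r, W2D.d2 p T u s)) ∧
    ∫ r in (0 : ℝ)..T, (a + ∫ s in (0 : ℝ)..r, W2D.d2 p T u s) = 0 := by
  obtain ⟨h1, h2, c, hc, hce, hc0, hcT⟩ := u.spec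
  have ii := fun f : LSeg p T => LSeg.intervalIntegrable hp.out hT.out f
  have T0 : 0 < T := hT.out
  obtain ⟨a, ha⟩ := h2.ae_eq_primitive T0 (ii _) (ii _)
  obtain ⟨b, hb⟩ := h1.ae_eq_primitive T0 (ii _) (ii _)
  let v : ℝ → ℝ := fun t => a + ∫ s in (0 : ℝ)..t, W2D.d2 p T u s
  have hvc : ContinuousOn v (uIcc 0 T) := continuousOn_const.add
    (((ii (W2D.d2 p T u)).absolutelyContinuousOnInterval_intervalIntegral
      (c := 0) (by simp)).continuousOn)
  have hvi : IntervalIntegrable v volume 0 T := hvc.intervalIntegrable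
  have hVc : ContinuousOn (fun t => ∫ r in (0 : ℝ)..t, v r) (Icc 0 T) := by
    have := (hvi.absolutelyContinuousOnInterval_intervalIntegral (c := 0) (by simp)).continuousOn
    rwa [uIcc_of_le T0.le] at this
  have e : ∀ t ∈ Icc 0 T, ∫ s in (0 : ℝ)..t, W2D.d1 p T u s = ∫ r in (0 : ℝ)..t, v r := by
    intro t ht
    apply intervalIntegral.integral_congr_ae
    filter_upwards [ae_interval_of_ae_seg T0 ha] with x hx h3
    apply hx
    rw [uIoc_of_le ht.1] at h3
    rw [uIoc_of_le T0.le]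
    exact ⟨h3.1, h3.2.trans ht.2⟩
  have hfb : W2D.fn p T u =ᵐ[segMeasure T] fun t => b + ∫ r in (0 : ℝ)..t, v r := by
    filter_upwards [hb, ae_restrict_mem measurableSet_Icc] with t ht h3
    rw [ht, e t h3]
  have heq : EqOn c (fun t => b + ∫ r in (0 : ℝ)..t, v r) (Icc 0 T) := by
    refine Measure.eqOn_Icc_of_ae_eq volume T0.ne (hce.symm.trans hfb) hc
      (continuousOn_const.add hVc)
  have hb0 : b = 0 := by
    have := heq (left_mem_Icc.2 T0.le)
    simp only [intervalIntegral.integral_same, add_zero] at this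
    rw [← this, hc0]
  have hT' := heq (right_mem_Icc.2 T0.le)
  simp only [hcT, hb0, zero_add] at hT'
  refine ⟨a, ha, ?_, hT'.symm⟩
  filter_upwards [hfb] with t ht
  rw [ht, hb0, zero_add]

/-- The uniform bound `|u| ≤ 2 T ‖u''‖₁`. -/
theorem W2D.bound (u : W2D p T) : ∀ᵐ t ∂(segMeasure T),
    ‖W2D.fn p T u t‖ ≤ 2 * T * ∫ s in (0 : ℝ)..T, |W2D.d2 p T u s| := by
  obtain ⟨a, -, h2, h3⟩ := u.repr
  have T0 : 0 < T := hT.out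
  have ii := LSeg.intervalIntegrable hp.out T0 (W2D.d2 p T u)
  set N : ℝ := ∫ s in (0 : ℝ)..T, |W2D.d2 p T u s| with hN
  have hW : ∀ r ∈ Icc 0 T, |∫ s in (0 : ℝ)..r, W2D.d2 p T u s| ≤ N := by
    intro r hr
    refine (intervalIntegral.abs_integral_le_integral_abs hr.1).trans ?_
    refine intervalIntegral.integral_mono_interval le_rfl hr.1 hr.2
      (ae_of_all _ fun _ => abs_nonneg _) ii.abs
  have hWi : IntervalIntegrable (fun r => ∫ s in (0 : ℝ)..r, W2D.d2 p T u s) volume 0 T :=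
    (ii.absolutelyContinuousOnInterval_intervalIntegral
      (c := 0) (by simp)).continuousOn.intervalIntegrable
  have ha : |a| ≤ N := by
    rw [intervalIntegral.integral_add intervalIntegrable_const hWi] at h3
    simp only [intervalIntegral.integral_const, sub_zero, smul_eq_mul] at h3
    have h4 : ‖∫ r in (0 : ℝ)..T, ∫ s in (0 : ℝ)..r, W2D.d2 p T u s‖ ≤ N * |T - 0| := by
      refine intervalIntegral.norm_integral_le_of_norm_le_const ?_
      intro x hx
      rw [uIoc_of_le T0.le] at hx
      exact hW x (Ioc_subset_Icc_self hx)
    have h5 : T * |a| ≤ T * N := by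
      rw [sub_zero, abs_of_pos T0] at h4
      have : T * a = -∫ r in (0 : ℝ)..T, ∫ s in (0 : ℝ)..r, W2D.d2 p T u s := by linarith
      calc T * |a| = |T * a| := by rw [abs_mul, abs_of_pos T0]
        _ ≤ N * T := by rw [this, abs_neg]; exact h4
        _ = T * N := mul_comm _ _
    exact le_of_mul_le_mul_left h5 T0
  have hN0 : 0 ≤ N := (abs_nonneg _).trans ha
  filter_upwards [h2, ae_restrict_mem measurableSet_Icc] with t ht h4
  rw [ht]
  have h5 : ‖∫ r in (0 : ℝ)..t, (a + ∫ s in (0 : ℝ)..r, W2D.d2 p T u s)‖ ≤ 2 * N * |t - 0| := by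
    refine intervalIntegral.norm_integral_le_of_norm_le_const ?_
    intro x hx
    rw [uIoc_of_le h4.1] at hx
    have := hW x ⟨hx.1.le, hx.2.trans h4.2⟩
    calc ‖a + ∫ s in (0 : ℝ)..x, W2D.d2 p T u s‖ ≤ |a| + |∫ s in (0 : ℝ)..x, W2D.d2 p T u s| :=
          abs_add_le _ _
      _ ≤ 2 * N := by linarith
  refine h5.trans ?_
  rw [sub_zero, abs_of_nonneg h4.1]
  nlinarith [h4.2]

theorem W2D.d2_injective : Function.Injective (W2D.d2 p T) := by
  rw [injective_iff_map_eq_zero]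
  intro u hu
  have T0 : 0 < T := hT.out
  obtain ⟨a, h1, h2, h3⟩ := u.repr
  have z : ((0 : LSeg p T) : ℝ → ℝ) =ᵐ[segMeasure T] fun _ => 0 := Lp.coeFn_zero _ _ _
  have hz : ∀ r ∈ Icc 0 T, ∫ s in (0 : ℝ)..r, W2D.d2 p T u s = 0 := by
    intro r hr
    rw [hu]
    refine intervalIntegral.integral_zero_ae ?_
    filter_upwards [ae_interval_of_ae_seg T0 z] with x hx h5
    apply hx
    rw [uIoc_of_le hr.1] at h5
    rw [uIoc_of_le T0.le]
    exact ⟨h5.1, h5.2.trans hr.2⟩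
  have ha : a = 0 := by
    have : ∫ r in (0 : ℝ)..T, (a + ∫ s in (0 : ℝ)..r, W2D.d2 p T u s) = ∫ r in (0 : ℝ)..T, a := by
      apply intervalIntegral.integral_congr
      intro r hr
      rw [uIcc_of_le T0.le] at hr
      simp only [hz r hr, add_zero]
    rw [this, intervalIntegral.integral_const] at h3
    simpa [T0.ne'] using h3
  have e1 : W2D.d1 p T u = 0 := by
    apply Lp.ext
    filter_upwards [h1, z, ae_restrict_mem measurableSet_Icc] with t ht hzt hm
    rw [ht, hzt, hz t hm, ha, add_zero]
  have e0 : W2D.fn p T u = 0 := by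
    apply Lp.ext
    have hb := W2D.bound u
    have hz' := hz T (right_mem_Icc.2 T0.le)
    have hN : ∫ s in (0 : ℝ)..T, |W2D.d2 p T u s| = 0 := by
      rw [hu]
      refine intervalIntegral.integral_zero_ae ?_
      filter_upwards [ae_interval_of_ae_seg T0 z] with x hx h5
      rw [hx h5, abs_zero]
    filter_upwards [hb, z] with t ht hzt
    rw [hN, mul_zero] at ht
    rw [hzt]
    exact norm_le_zero_iff.1 ht
  apply Subtype.ext
  exact Prod.ext e0 (Prod.ext e1 hu)

variable (p T)

/-- The norm of `W^{2,p}_D` is `‖u''‖_p`. -/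
instance instNormedAddCommGroupW2D : NormedAddCommGroup (W2D p T) :=
  NormedAddCommGroup.induced (W2D p T) (LSeg p T) (W2D.d2 p T) W2D.d2_injective

instance instNormedSpaceW2D : NormedSpace ℝ (W2D p T) :=
  NormedSpace.induced ℝ (W2D p T) (LSeg p T) (W2D.d2 p T)

variable {p T}

theorem W2D.norm_eq (u : W2D p T) : ‖u‖ = ‖W2D.d2 p T u‖ := rfl

theorem W2D.memLp (q : ℝ) (u : W2D p T) :
    MemLp (W2D.fn p T u) (ENNReal.ofReal q) (segMeasure T) :=
  MemLp.of_bound (Lp.aestronglyMeasurable _) _ u.bound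

theorem W2D.exists_bound (q : ℝ) : ∃ C : ℝ, ∀ u : W2D p T,
    ‖(u.memLp q).toLp‖ ≤ C * ‖u‖ := by
  have T0 : 0 < T := hT.out
  refine ⟨(segMeasure T univ).toReal ^ (ENNReal.ofReal q).toReal⁻¹ * (2 * T *
    ((segMeasure T univ) ^ (1 / (1 : ℝ≥0∞).toReal - 1 / (ENNReal.ofReal p).toReal)).toReal), ?_⟩
  intro u
  have hN : ∫ s in (0 : ℝ)..T, |W2D.d2 p T u s| ≤
      ((segMeasure T univ) ^ (1 / (1 : ℝ≥0∞).toReal - 1 / (ENNReal.ofReal p).toReal)).toReal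
        * ‖u‖ := by
    have h1 := eLpNorm_le_eLpNorm_mul_rpow_measure_univ (μ := segMeasure T)
      (p := 1) (q := ENNReal.ofReal p) (by simpa using hp.out.le)
      (Lp.aestronglyMeasurable (W2D.d2 p T u))
    have fin : eLpNorm (W2D.d2 p T u) (ENNReal.ofReal p) (segMeasure T) *
        (segMeasure T univ) ^ (1 / (1 : ℝ≥0∞).toReal - 1 / (ENNReal.ofReal p).toReal) ≠ ⊤ := by
      refine ENNReal.mul_ne_top (Lp.eLpNorm_ne_top _) ?_
      refine ENNReal.rpow_ne_top_of_nonneg ?_ (measure_ne_top _ _)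
      rw [ENNReal.toReal_ofReal (by linarith [hp.out])]
      have := hp.out
      simp only [ENNReal.toReal_one, div_one, one_div, sub_nonneg]
      exact inv_le_one_of_one_le₀ this.le
    have h2 := ENNReal.toReal_mono fin h1
    rw [ENNReal.toReal_mul] at h2
    have h3 : ∫ s in (0 : ℝ)..T, |W2D.d2 p T u s| =
        (eLpNorm (W2D.d2 p T u) 1 (segMeasure T)).toReal := by
      rw [eLpNorm_one_eq_lintegral_enorm, intervalIntegral.integral_of_le T0.le,
        ← integral_Icc_eq_integral_Ioc, ← integral_norm_eq_lintegral_enorm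
          (Lp.aestronglyMeasurable _)]
      rfl
    rw [h3, W2D.norm_eq, Lp.norm_def, mul_comm]
    exact h2
  have h4 := Lp.norm_le_of_ae_bound (f := (u.memLp q).toLp) (p := ENNReal.ofReal q)
    (C := 2 * T * ∫ s in (0 : ℝ)..T, |W2D.d2 p T u s|) (by
      refine mul_nonneg (by positivity) ?_
      exact intervalIntegral.integral_nonneg T0.le fun _ _ => abs_nonneg _) (by
      filter_upwards [(u.memLp q).coeFn_toLp, u.bound] with t h1 h2
      rw [h1]; exact h2)
  refine h4.trans ?_
  calc _ ≤ (segMeasure T univ).toReal ^ (ENNReal.ofReal q).toReal⁻¹ * (2 * T * (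
        ((segMeasure T univ) ^ (1 / (1 : ℝ≥0∞).toReal - 1 / (ENNReal.ofReal p).toReal)).toReal
          * ‖u‖)) := by
        refine mul_le_mul_of_nonneg_left ?_ (by positivity)
        exact mul_le_mul_of_nonneg_left hN (by positivity)
    _ = _ := by ring

variable (p T)

/-- The second order Sobolev embedding `E₂ : W^{2,p}_D([0, T]) → L^q([0, T])`, `u ↦ u`. -/
def E2 (q : ℝ) [Fact (1 < q)] : W2D p T →L[ℝ] LSeg q T :=
  LinearMap.mkContinuousOfExistsBound
    { toFun := fun u => (u.memLp q).toLp
      map_add' := by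
        intro u v
        rw [← MemLp.toLp_add]
        apply MemLp.toLp_congr
        rw [map_add]
        exact Lp.coeFn_add _ _
      map_smul' := by
        intro a u
        rw [RingHom.id_apply, ← MemLp.toLp_const_smul]
        apply MemLp.toLp_congr
        rw [map_smul]
        exact Lp.coeFn_smul _ _ }
    (W2D.exists_bound q)

theorem E2_coeFn (q : ℝ) [Fact (1 < q)] (u : W2D p T) :
    E2 p T q u =ᵐ[segMeasure T] W2D.fn p T u := (u.memLp q).coeFn_toLp

end W2D

/-! ### Approximation numbers and isomorphism numbers -/

section SNumbers

universe u

variable {X Y : Type u} [NormedAddCommGroup X] [NormedSpace ℝ X]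
  [NormedAddCommGroup Y] [NormedSpace ℝ Y]

/-- The `n`-th approximation number
`a_n(S) = inf {‖S - F‖ : F bounded linear with rank F < n}`, for `n ≥ 1`. -/
def approxNumber (n : ℕ) (S : X →L[ℝ] Y) : ℝ :=
  sInf {r : ℝ | ∃ F : X →L[ℝ] Y, LinearMap.rank (F : X →ₗ[ℝ] Y) < n ∧ r = ‖S - F‖}

/-- The `n`-th isomorphism number `i_n(S) = sup ‖A‖⁻¹ ‖B‖⁻¹`, the supremum being over all Banach
spaces `G` of dimension at least `n` and all bounded linear `A : Y → G`, `B : G → X` with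
`A S B = id`, for `n ≥ 1`. (Each number in the set is at most `‖S‖`.) -/
def isoNumber (n : ℕ) (S : X →L[ℝ] Y) : ℝ :=
  sSup {r : ℝ | ∃ (G : Type u) (_ : NormedAddCommGroup G) (_ : NormedSpace ℝ G)
    (_ : CompleteSpace G) (A : Y →L[ℝ] G) (B : G →L[ℝ] X),
    (n : Cardinal.{u}) ≤ Module.rank ℝ G ∧ (A.comp S).comp B = ContinuousLinearMap.id ℝ G ∧
      r = ‖A‖⁻¹ * ‖B‖⁻¹}

end SNumbers

/-! ### The `pq`-biharmonic eigenvalue problem -/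

/-- The signed power `|x|^{r-2} x`. -/
def spow (x r : ℝ) : ℝ := |x| ^ (r - 2) * x

/-- The second derivative of `u` on the closed segment `[0, T]` (one-sided at the ends). -/
def secondDeriv (T : ℝ) (u : ℝ → ℝ) : ℝ → ℝ := iteratedDerivWithin 2 u (Icc 0 T)

/-- `(u, lam)` is an eigenpair on `[0, T]`: `u ≠ 0`, `lam > 0` and
`(|u''|^{p-2} u'')'' = lam |u|^{q-2} u` on `[0, T]` with `u = u'' = 0` at both ends. -/
structure IsEigenpair (p q T : ℝ) (u : ℝ → ℝ) (lam : ℝ) : Prop where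
  lam_pos : 0 < lam
  ne_zero : ∃ t ∈ Icc 0 T, u t ≠ 0
  contDiffOn : ContDiffOn ℝ 2 u (Icc 0 T)
  contDiffOn_spow : ContDiffOn ℝ 2 (fun t => spow (secondDeriv T u t) p) (Icc 0 T)
  eqn : ∀ t ∈ Icc 0 T,
    secondDeriv T (fun s => spow (secondDeriv T u s) p) t = lam * spow (u t) q
  left : u 0 = 0
  right : u T = 0
  left_second : secondDeriv T u 0 = 0
  right_second : secondDeriv T u T = 0

/-- `(f, lam)` is a spectral couple: an eigenpair with `‖f''‖_p = 1` and `f'(0) > 0`. -/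
structure IsSpectralCouple (p q T : ℝ) (f : ℝ → ℝ) (lam : ℝ) : Prop
    extends IsEigenpair p q T f lam where
  norm_eq_one : eLpNorm (secondDeriv T f) (ENNReal.ofReal p) (segMeasure T) = 1
  deriv_pos : 0 < derivWithin f (Icc 0 T) 0

/-- `lam` is an `n`-th spectral number on `[0, T]`: it belongs to a spectral couple whose function
has exactly `n - 1` zeros in `(0, T)`. -/
def IsSpectralNumber (p q T : ℝ) (n : ℕ) (lam : ℝ) : Prop :=
  ∃ f : ℝ → ℝ, IsSpectralCouple p q T f lam ∧ {t ∈ Ioo 0 T | f t = 0}.encard + 1 = n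

end Biharmonic

end

namespace Biharmonic

/-! ### Signed powers -/

/-! With v = -[u'']^p and p' the exponent conjugate to p, the eigenvalue equation becomes the system
u'' = -[v]^{p'}, v'' = -λ[u]^q, with u and v zero at both ends. Everything is expressed through one
positive reference solution on [0, 1].

Existence. Functions vanishing at both ends are, up to sign, images of their second derivatives
under the Green operator, so the best constant of the embedding is the supremum Q of ‖green g‖_q^q
over the unit ball of L^p. It is attained: a maximizing sequence of images converges by
Arzelà–Ascoli, and duality (Hölder, then the equality case of Young) shows that the limit is the
image of an explicit function and solves the system with λ = 1/Q (`exists_extremal`).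

Uniqueness. Raising v'(0) alone pushes v up and u down (`IsSol.compare`), so the boundary conditions
leave no freedom in v'(0) once u'(0) is fixed. The initial value problem is well posed along
solutions whose zeros are simple, although signed powers need not be Lipschitz at 0 (`IsSol.agree`).
With the scalings u ↦ a u(·/c), this makes the positive solution symmetric; hence it extends
antiperiodically to a solution on the line, and every spectral couple is a rescaled piece of this
extension. The zero count fixes c, the normalization fixes a, and λ follows
(`isSpectralNumber_iff`). In particular 1/Q is the first spectral number, which makes the embedding
inequality sharp in terms of λ₁ (`integral_green_rpow_le_sharp`).

Approximation numbers, q ≤ p. Piecewise linear interpolation at the n - 1 interior nodes of a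
uniform grid has rank less than n. On each cell the error is a function with zero boundary values
and the same second derivative, so the sharp inequality applies cell by cell, and Hölder for sums
recombines the cells (`interp_error`).

Isomorphism numbers, p ≤ q. Multiples of the reference bump on the n cells have mismatched slopes at
the nodes. Adding a piecewise linear function repairs this: for a sequence y reflected at its ends,
amplitudes y_k + 2y_{k+1} + y_{k+2} and node values proportional to (-1)^k (y_{k+1} - y_k) glue to
an element of W^{2,p}_D (`IsAntiSol.green_glued`). Its moments against [w]^q on the cells form a
diagonally dominant image of y, invertible with bound 1/(4m), where m is the cell integral of |w|^q
(`le_norm_dominantMap`). The amplitude map has norm at most 4, so the two factors 4 cancel and the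
identity of ℓ^q_n factors through the embedding with exactly the required constant. -/

theorem spow_neg (x r : ℝ) : spow (-x) r = -spow x r := by
  simp [spow]

theorem spow_zero (r : ℝ) : spow 0 r = 0 := by simp [spow]

theorem spow_of_nonneg {x r : ℝ} (hr : 1 < r) (hx : 0 ≤ x) : spow x r = x ^ (r - 1) := by
  rcases hx.eq_or_lt with rfl | h
  · rw [spow_zero, Real.zero_rpow (by linarith)]
  · rw [spow, abs_of_pos h]
    nth_rewrite 2 [← Real.rpow_one x]
    rw [← Real.rpow_add h]; congr 1; ring

theorem abs_spow {r : ℝ} (hr : 1 < r) (x : ℝ) : |spow x r| = |x| ^ (r - 1) := by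
  rw [← spow_of_nonneg hr (abs_nonneg x), spow, spow, abs_mul, abs_abs,
    abs_of_nonneg (Real.rpow_nonneg (abs_nonneg x) _)]

theorem mul_spow {r : ℝ} (hr : 1 < r) (x : ℝ) : x * spow x r = |x| ^ r := by
  have : x * spow x r = |x| * spow |x| r := by
    simp only [spow, abs_abs]
    have := abs_mul_abs_self x
    linear_combination -(|x| ^ (r - 2)) * this
  rw [this, spow_of_nonneg hr (abs_nonneg x)]
  rcases (abs_nonneg x).eq_or_lt with h | h
  · rw [← h, zero_mul, Real.zero_rpow (by linarith)]
  · nth_rewrite 1 [← Real.rpow_one |x|]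
    rw [← Real.rpow_add h]; congr 1; ring

/-- Positive and negative parts reduce continuity and monotonicity to those of a power with positive
exponent `r - 1`; the factor `|x| ^ (r - 2)` in the definition is singular at 0 when `r < 2`. -/
theorem spow_eq_sub {r : ℝ} (hr : 1 < r) (x : ℝ) :
    spow x r = (max x 0) ^ (r - 1) - (max (-x) 0) ^ (r - 1) := by
  have h0 : (0 : ℝ) ^ (r - 1) = 0 := Real.zero_rpow (by linarith)
  rcases le_total 0 x with h | h
  · rw [max_eq_left h, max_eq_right (by linarith), h0, spow_of_nonneg hr h, sub_zero]
  · rw [max_eq_right h, max_eq_left (by linarith), h0, ← spow_of_nonneg hr (by linarith : 0 ≤ -x),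
      spow_neg]
    ring

theorem continuous_spow {r : ℝ} (hr : 1 < r) : Continuous fun x => spow x r := by
  have h : (fun x => spow x r) = fun x => (max x 0) ^ (r - 1) - (max (-x) 0) ^ (r - 1) :=
    funext (spow_eq_sub hr)
  rw [h]
  have h1 : Continuous fun x : ℝ => x ^ (r - 1) := Real.continuous_rpow_const (by linarith)
  exact (h1.comp (continuous_id.max continuous_const)).sub
    (h1.comp (continuous_neg.max continuous_const))

theorem spow_mono {r : ℝ} (hr : 1 < r) : Monotone fun x => spow x r := by
  intro x y h
  simp only [spow_eq_sub hr]
  have h1 : (max x 0) ^ (r - 1) ≤ (max y 0) ^ (r - 1) :=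
    Real.rpow_le_rpow (le_max_right _ _) (max_le_max h le_rfl) (by linarith)
  have h2 : (max (-y) 0) ^ (r - 1) ≤ (max (-x) 0) ^ (r - 1) :=
    Real.rpow_le_rpow (le_max_right _ _) (max_le_max (by linarith) le_rfl) (by linarith)
  linarith

theorem spow_pos {x r : ℝ} (hr : 1 < r) (hx : 0 < x) : 0 < spow x r := by
  rw [spow_of_nonneg hr hx.le]; exact Real.rpow_pos_of_pos hx _

theorem spow_mul {a r : ℝ} (hr : 1 < r) (ha : 0 < a) (x : ℝ) :
    spow (a * x) r = a ^ (r - 1) * spow x r := by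
  rw [← spow_of_nonneg hr ha.le, spow, spow, spow, abs_mul,
    Real.mul_rpow (abs_nonneg _) (abs_nonneg _)]
  ring

/-- Conjugacy means (p - 1)(p' - 1) = 1. This inversion is what allows the fourth order equation to
be written as a second order system. -/
theorem spow_spow {p p' : ℝ} (h : p.HolderConjugate p') (x : ℝ) : spow (spow x p) p' = x := by
  have hp := h.lt
  have hp' := h.symm.lt
  have key : ∀ x : ℝ, 0 ≤ x → spow (spow x p) p' = x := by
    intro x hx
    have e : (p - 1) * (p' - 1) = 1 := by linarith [h.mul_eq_add]
    rw [spow_of_nonneg hp hx, spow_of_nonneg hp' (Real.rpow_nonneg hx _), ← Real.rpow_mul hx,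
      e, Real.rpow_one]
  rcases le_total 0 x with hx | hx
  · exact key x hx
  · have := key (-x) (by linarith)
    rw [spow_neg, spow_neg] at this
    linarith

/-- A local Lipschitz estimate for the signed power, away from `0`. -/
theorem abs_spow_sub_le {r k K x y s : ℝ} (hr : 1 < r) (hk : 0 < k) (hs : s = 1 ∨ s = -1)
    (hx : k ≤ s * x) (hy : k ≤ s * y) (hx' : |x| ≤ K) (hy' : |y| ≤ K) :
    |spow x r - spow y r| ≤ (r - 1) * K ^ (r - 1) / k * |x - y| := by
  have key : ∀ x y : ℝ, k ≤ x → k ≤ y → |x| ≤ K → |y| ≤ K →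
      |spow x r - spow y r| ≤ (r - 1) * K ^ (r - 1) / k * |x - y| := by
    intro x y hx hy hx' hy'
    rw [spow_of_nonneg hr (hk.le.trans hx), spow_of_nonneg hr (hk.le.trans hy)]
    refine (convex_Icc k K).norm_image_sub_le_of_norm_hasDerivWithin_le
      (f := fun x => x ^ (r - 1)) (f' := fun x => (r - 1) * x ^ (r - 1 - 1)) ?_ ?_
      ⟨hy, (le_abs_self _).trans hy'⟩ ⟨hx, (le_abs_self _).trans hx'⟩
    · intro t ht
      exact (Real.hasDerivAt_rpow_const (Or.inl (hk.trans_le ht.1).ne')).hasDerivWithinAt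
    · intro t ht
      have ht0 : 0 < t := hk.trans_le ht.1
      have h1 : t ^ (r - 1) ≤ K ^ (r - 1) := Real.rpow_le_rpow ht0.le ht.2 (by linarith)
      have h2 : 0 ≤ t ^ (r - 1) := Real.rpow_nonneg ht0.le _
      -- Writing t^{r-2} as t^{r-1}/t gives one bound for both signs of r - 2.
      rw [Real.rpow_sub_one ht0.ne', norm_mul, Real.norm_of_nonneg (by linarith : 0 ≤ r - 1),
        Real.norm_of_nonneg (by positivity), mul_div_assoc]
      refine mul_le_mul_of_nonneg_left ?_ (by linarith)
      exact div_le_div₀ (h2.trans h1) h1 hk ht.1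
  rcases hs with rfl | rfl
  · exact key x y (by linarith) (by linarith) hx' hy'
  · have := key (-x) (-y) (by linarith) (by linarith) (by rwa [abs_neg]) (by rwa [abs_neg])
    rw [spow_neg, spow_neg, neg_sub_neg, neg_sub_neg, abs_sub_comm, abs_sub_comm y x] at this
    exact this

/-! ### The first order system -/

/-- `(u, v)`, with derivatives `(u', v')`, solves `u'' = -[v]^{p'}`, `v'' = -lam [u]^q` on `D`. -/
structure IsSol (p' q lam : ℝ) (D : Set ℝ) (u u' v v' : ℝ → ℝ) : Prop where
  du : ∀ t ∈ D, HasDerivWithinAt u (u' t) D t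
  du' : ∀ t ∈ D, HasDerivWithinAt u' (-spow (v t) p') D t
  dv : ∀ t ∈ D, HasDerivWithinAt v (v' t) D t
  dv' : ∀ t ∈ D, HasDerivWithinAt v' (-(lam * spow (u t) q)) D t

theorem IsSol.mono {p' q lam : ℝ} {D D' : Set ℝ} {u u' v v' : ℝ → ℝ}
    (h : IsSol p' q lam D u u' v v') (hD : D' ⊆ D) : IsSol p' q lam D' u u' v v' :=
  ⟨fun t ht => (h.du t (hD ht)).mono hD, fun t ht => (h.du' t (hD ht)).mono hD,
    fun t ht => (h.dv t (hD ht)).mono hD, fun t ht => (h.dv' t (hD ht)).mono hD⟩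

theorem monotoneOn_of_hasDerivWithinAt_Icc {f f' : ℝ → ℝ} {a b : ℝ}
    (h : ∀ t ∈ Icc a b, HasDerivWithinAt f (f' t) (Icc a b) t) (h0 : ∀ t ∈ Ioo a b, 0 ≤ f' t) :
    MonotoneOn f (Icc a b) := by
  refine monotoneOn_of_hasDerivWithinAt_nonneg (f' := f') (convex_Icc a b)
    (fun t ht => (h t ht).continuousWithinAt)
    (fun t ht => (h t (interior_subset ht)).mono interior_subset) ?_
  rw [interior_Icc]; exact h0

theorem strictMonoOn_of_hasDerivWithinAt_Icc {f f' : ℝ → ℝ} {a b : ℝ}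
    (h : ∀ t ∈ Icc a b, HasDerivWithinAt f (f' t) (Icc a b) t) (h0 : ∀ t ∈ Ioo a b, 0 < f' t) :
    StrictMonoOn f (Icc a b) := by
  refine strictMonoOn_of_hasDerivWithinAt_pos (f' := f') (convex_Icc a b)
    (fun t ht => (h t ht).continuousWithinAt)
    (fun t ht => (h t (interior_subset ht)).mono interior_subset) ?_
  rw [interior_Icc]; exact h0

/-- Comparison of two solutions with different `v'(0)`. -/
theorem IsSol.compare {p' q lam T : ℝ} (hp' : 1 < p') (hq : 1 < q) (hlam : 0 < lam) (hT : 0 < T)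
    {u u' v v' w w' z z' : ℝ → ℝ} (h1 : IsSol p' q lam (Icc 0 T) u u' v v')
    (h2 : IsSol p' q lam (Icc 0 T) w w' z z') (e1 : u 0 = w 0) (e2 : v 0 = z 0)
    (e3 : u' 0 = w' 0) (e4 : v' 0 < z' 0) : v T < z T ∧ w T ≤ u T := by
  -- While z' - v' is nonnegative, four integrations close up: z - v, then u' - w', then u - w, then
  -- z' - v' are nondecreasing. So z' - v' never falls below its positive initial value.
  have step : ∀ s, 0 ≤ s → s ≤ T → (∀ t ∈ Ioo 0 s, 0 ≤ z' t - v' t) →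
      w s ≤ u s ∧ z' 0 - v' 0 ≤ z' s - v' s := by
    intro s hs hsT hpos
    have k1 := h1.mono (Icc_subset_Icc_right hsT)
    have k2 := h2.mono (Icc_subset_Icc_right hsT)
    have l0 : (0 : ℝ) ∈ Icc 0 s := left_mem_Icc.2 hs
    have ls : s ∈ Icc 0 s := right_mem_Icc.2 hs
    have m1 := monotoneOn_of_hasDerivWithinAt_Icc (fun t ht => (k2.dv t ht).sub (k1.dv t ht)) hpos
    have m2 := monotoneOn_of_hasDerivWithinAt_Icc (fun t ht => (k1.du' t ht).sub (k2.du' t ht))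
      (fun t ht => by
        have := m1 l0 (Ioo_subset_Icc_self ht) ht.1.le
        simp only [Pi.sub_apply, e2, sub_self] at this
        have := spow_mono hp' (sub_nonneg.1 this)
        simp only at this
        linarith)
    have m3 := monotoneOn_of_hasDerivWithinAt_Icc (fun t ht => (k1.du t ht).sub (k2.du t ht))
      (fun t ht => by
        have := m2 l0 (Ioo_subset_Icc_self ht) ht.1.le
        simpa only [Pi.sub_apply, e3, sub_self] using this)
    have m4 := monotoneOn_of_hasDerivWithinAt_Icc (fun t ht => (k2.dv' t ht).sub (k1.dv' t ht))
      (fun t ht => by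
        have := m3 l0 (Ioo_subset_Icc_self ht) ht.1.le
        simp only [Pi.sub_apply, e1, sub_self] at this
        have := mul_le_mul_of_nonneg_left (spow_mono hq (sub_nonneg.1 this)) hlam.le
        simp only at this
        linarith)
    have r3 := m3 l0 ls hs
    have r4 := m4 l0 ls hs
    simp only [Pi.sub_apply, e1, sub_self] at r3 r4
    exact ⟨sub_nonneg.1 r3, r4⟩
  have hW : ∀ t ∈ Icc 0 T, 0 < z' t - v' t := by
    by_contra hcon
    push Not at hcon
    obtain ⟨t0, ht0, hz0⟩ := hcon
    have hc : ContinuousOn (fun t => z' t - v' t) (Icc 0 T) := fun t ht =>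
      ((h2.dv' t ht).sub (h1.dv' t ht)).continuousWithinAt
    have hcl : IsClosed (Icc 0 T ∩ (fun t => z' t - v' t) ⁻¹' Iic 0) :=
      hc.preimage_isClosed_of_isClosed isClosed_Icc isClosed_Iic
    have hne : (Icc 0 T ∩ (fun t => z' t - v' t) ⁻¹' Iic 0).Nonempty := ⟨t0, ht0, hz0⟩
    have hbd : BddBelow (Icc 0 T ∩ (fun t => z' t - v' t) ⁻¹' Iic 0) :=
      ⟨0, fun x hx => hx.1.1⟩
    have hm := hcl.csInf_mem hne hbd
    -- At the first time where z' - v' is not positive, `step` still bounds it below by its initial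
    -- value.
    set s := sInf (Icc 0 T ∩ (fun t => z' t - v' t) ⁻¹' Iic 0)
    have := (step s hm.1.1 hm.1.2 (fun t ht => by
      by_contra hlt
      have : s ≤ t := csInf_le hbd ⟨⟨ht.1.le, ht.2.le.trans hm.1.2⟩, (not_le.1 hlt).le⟩
      linarith [ht.2])).2
    have h3 : z' s - v' s ≤ 0 := hm.2
    linarith
  have m1 := strictMonoOn_of_hasDerivWithinAt_Icc (fun t ht => (h2.dv t ht).sub (h1.dv t ht))
    (fun t ht => hW t (Ioo_subset_Icc_self ht))
  have := m1 (left_mem_Icc.2 hT.le) (right_mem_Icc.2 hT.le) hT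
  simp only [Pi.sub_apply, e2, sub_self] at this
  exact ⟨sub_pos.1 this,
    (step T hT.le le_rfl fun t ht => (hW t (Ioo_subset_Icc_self ht)).le).1⟩

open Topology in
-- A nonzero value and a simple zero are treated alike: both keep f at distance at least k(t - a)
-- from 0, which is what the Lipschitz estimate for the signed power requires.
theorem eventually_linear_lower_bound {f : ℝ → ℝ} {f₁ a s : ℝ} {S : Set ℝ} (hS : S ⊆ Ici a)
    (h : HasDerivWithinAt f f₁ S a) (hs : 0 < s * f a ∨ (f a = 0 ∧ 0 < s * f₁)) :
    ∃ k > 0, ∀ᶠ t in 𝓝[S] a, k * (t - a) ≤ s * f t := by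
  have hmem : ∀ᶠ t in 𝓝[S] a, a ≤ t := by
    filter_upwards [self_mem_nhdsWithin] with t ht using hS ht
  rcases hs with hs | ⟨h0, hs⟩
  · refine ⟨s * f a / 2, by positivity, ?_⟩
    have h1 : ∀ᶠ t in 𝓝[S] a, s * f a / 2 < s * f t :=
      (h.continuousWithinAt.const_mul s).eventually (lt_mem_nhds (by linarith))
    have h2 : ∀ᶠ t in 𝓝[S] a, t < a + 1 :=
      mem_nhdsWithin_of_mem_nhds (Iio_mem_nhds (by linarith))
    filter_upwards [h1, h2, hmem] with t h1 h2 h3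
    nlinarith
  · refine ⟨s * f₁ / 2, by positivity, ?_⟩
    have h1 := (hasDerivWithinAt_iff_isLittleO.1 (h.const_mul s)).def (c := s * f₁ / 2)
      (by positivity)
    filter_upwards [h1, hmem] with t h1 h3
    simp only [h0, mul_zero, sub_zero, smul_eq_mul, Real.norm_eq_abs] at h1
    rw [abs_of_nonneg (by linarith : 0 ≤ t - a)] at h1
    have := (abs_le.1 h1).1
    linarith

open Topology in
/-- The signed power along two functions with the same nondegenerate first order data. -/
theorem eventually_spow_sub_le {f g : ℝ → ℝ} {f₁ a r : ℝ} {S : Set ℝ} (hr : 1 < r)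
    (hS : S ⊆ Ici a) (hf : HasDerivWithinAt f f₁ S a) (hg : HasDerivWithinAt g f₁ S a)
    (hfg : f a = g a) (hne : g a ≠ 0 ∨ f₁ ≠ 0) :
    ∃ C ≥ 0, ∀ᶠ t in 𝓝[S] a, (t - a) * |spow (f t) r - spow (g t) r| ≤ C * |f t - g t| := by
  obtain ⟨s, hs, hs'⟩ : ∃ s : ℝ, (s = 1 ∨ s = -1) ∧ (0 < s * g a ∨ (g a = 0 ∧ 0 < s * f₁)) := by
    rcases lt_trichotomy (g a) 0 with h | h | h
    · exact ⟨-1, Or.inr rfl, Or.inl (by linarith)⟩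
    · rcases lt_or_gt_of_ne (hne.resolve_left (by simp [h])) with h1 | h1
      · exact ⟨-1, Or.inr rfl, Or.inr ⟨h, by linarith⟩⟩
      · exact ⟨1, Or.inl rfl, Or.inr ⟨h, by linarith⟩⟩
    · exact ⟨1, Or.inl rfl, Or.inl (by linarith)⟩
  obtain ⟨k₁, hk₁, h1⟩ := eventually_linear_lower_bound hS hf (by rwa [hfg])
  obtain ⟨k₂, hk₂, h2⟩ := eventually_linear_lower_bound hS hg hs'
  have b1 : ∀ᶠ t in 𝓝[S] a, |f t| < |g a| + 1 :=
    hf.continuousWithinAt.abs.eventually (gt_mem_nhds (by simp only [hfg]; linarith))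
  have b2 : ∀ᶠ t in 𝓝[S] a, |g t| < |g a| + 1 :=
    hg.continuousWithinAt.abs.eventually (gt_mem_nhds (by linarith))
  refine ⟨(r - 1) * (|g a| + 1) ^ (r - 1) / min k₁ k₂, ?_, ?_⟩
  · have : 0 < r - 1 := by linarith
    positivity
  · filter_upwards [h1, h2, b1, b2, self_mem_nhdsWithin] with t h1 h2 b1 b2 ht
    have hta : a ≤ t := hS ht
    rcases hta.eq_or_lt with rfl | hlt
    · simp [hfg]
    · have hlt' : 0 < t - a := by linarith
      have hk : 0 < min k₁ k₂ := lt_min hk₁ hk₂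
      -- The distance to 0 is at least min k₁ k₂ · (t - a), so the Lipschitz constant blows up only
      -- like 1/(t - a).
      have := abs_spow_sub_le hr (mul_pos hk hlt') hs
        ((mul_le_mul_of_nonneg_right (min_le_left _ _) hlt'.le).trans h1)
        ((mul_le_mul_of_nonneg_right (min_le_right _ _) hlt'.le).trans h2) b1.le b2.le
      calc _ ≤ (t - a) * ((r - 1) * (|g a| + 1) ^ (r - 1) / (min k₁ k₂ * (t - a)) * |f t - g t|) :=
            mul_le_mul_of_nonneg_left this hlt'.le
        _ = _ := by field_simp

open Topology in
-- The signed powers lose a factor 1/(t - a) in their Lipschitz bound. The loss is compensated by |u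
-- - w| ≤ N(t - a) and |v - z| ≤ N(t - a), where N is the maximum of the differences of u' and v'.
-- The second derivatives then differ by at most a constant times N, and on a short interval this
-- forces N = 0.
theorem IsSol.eventually_agree {p' q lam a b : ℝ} (hp' : 1 < p') (hq : 1 < q) (hlam : 0 < lam)
    (hab : a < b) {u u' v v' w w' z z' : ℝ → ℝ} (h1 : IsSol p' q lam (Icc a b) u u' v v')
    (h2 : IsSol p' q lam (Icc a b) w w' z z') (e1 : u a = w a) (e2 : u' a = w' a)
    (e3 : v a = z a) (e4 : v' a = z' a) (n1 : w a ≠ 0 ∨ w' a ≠ 0) (n2 : z a ≠ 0 ∨ z' a ≠ 0) :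
    ∃ c, a < c ∧ c ≤ b ∧ ∀ t ∈ Icc a c, u t = w t ∧ u' t = w' t ∧ v t = z t ∧ v' t = z' t := by
  have ha : a ∈ Icc a b := left_mem_Icc.2 hab.le
  obtain ⟨C₁, hC₁, k1⟩ := eventually_spow_sub_le hq Icc_subset_Ici_self
    (by simpa only [e2] using h1.du a ha) (h2.du a ha) e1 n1
  obtain ⟨C₂, hC₂, k2⟩ := eventually_spow_sub_le hp' Icc_subset_Ici_self
    (by simpa only [e4] using h1.dv a ha) (h2.dv a ha) e3 n2
  set D : ℝ := C₂ + lam * C₁ with hD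
  have hD0 : 0 ≤ D := by positivity
  -- This length restriction gives (c - a) D < 1, the contraction behind N = 0; the denominator D +
  -- 1 also covers D = 0.
  have k3 : ∀ᶠ t in 𝓝[Icc a b] a, t < a + 1 / (D + 1) :=
    mem_nhdsWithin_of_mem_nhds (Iio_mem_nhds (by linarith [show 0 < 1 / (D + 1) by positivity]))
  have k4 : ∀ᶠ t in 𝓝[Icc a b] a, t ≤ b := by
    filter_upwards [self_mem_nhdsWithin] with t ht using ht.2
  have k := (k1.and k2).and (k3.and k4)
  rw [nhdsWithin_Icc_eq_nhdsGE hab] at k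
  obtain ⟨c, hc, hk⟩ := mem_nhdsGE_iff_exists_Icc_subset.1 k
  have hac : a < c := hc
  have hcb : c ≤ b := (hk (right_mem_Icc.2 hac.le)).2.2
  have hcD : (c - a) * D < 1 := by
    have h3 : c < a + 1 / (D + 1) := (hk (right_mem_Icc.2 hac.le)).2.1
    have h4 : (c - a) * (D + 1) < 1 / (D + 1) * (D + 1) :=
      mul_lt_mul_of_pos_right (by linarith) (by linarith)
    rw [one_div_mul_cancel (by linarith)] at h4
    nlinarith
  refine ⟨c, hac, hcb, ?_⟩
  replace h1 := h1.mono (Icc_subset_Icc_right hcb)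
  replace h2 := h2.mono (Icc_subset_Icc_right hcb)
  have hcont : ContinuousOn (fun t => max |u' t - w' t| |v' t - z' t|) (Icc a c) := fun t ht =>
    (((h1.du' t ht).sub (h2.du' t ht)).continuousWithinAt.abs).max
      (((h1.dv' t ht).sub (h2.dv' t ht)).continuousWithinAt.abs)
  obtain ⟨m, hm, hmax⟩ := isCompact_Icc.exists_isMaxOn ⟨a, left_mem_Icc.2 hac.le⟩ hcont
  set N := max |u' m - w' m| |v' m - z' m| with hN
  have hN0 : 0 ≤ N := (abs_nonneg _).trans (le_max_left _ _)
  have bu : ∀ t ∈ Icc a c, |u t - w t| ≤ N * (t - a) := by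
    intro t ht
    have := norm_image_sub_le_of_norm_deriv_le_segment' (C := N)
      (fun t ht => (h1.du t ht).sub (h2.du t ht))
      (fun x hx => (le_max_left _ _).trans (hmax (Ico_subset_Icc_self hx))) t ht
    simpa [e1] using this
  have bv : ∀ t ∈ Icc a c, |v t - z t| ≤ N * (t - a) := by
    intro t ht
    have := norm_image_sub_le_of_norm_deriv_le_segment' (C := N)
      (fun t ht => (h1.dv t ht).sub (h2.dv t ht))
      (fun x hx => (le_max_right _ _).trans (hmax (Ico_subset_Icc_self hx))) t ht
    simpa [e3] using this
  have lip : ∀ {f g : ℝ → ℝ} {r C : ℝ}, 0 ≤ C → f a = g a → ∀ t ∈ Icc a c,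
      |f t - g t| ≤ N * (t - a) →
      (t - a) * |spow (f t) r - spow (g t) r| ≤ C * |f t - g t| →
      |spow (f t) r - spow (g t) r| ≤ C * N := by
    intro f g r C hC hfg t ht hb hs
    rcases ht.1.eq_or_lt with rfl | hlt
    · rw [hfg, sub_self, abs_zero]; positivity
    · have hlt' : 0 < t - a := by linarith
      refine le_of_mul_le_mul_left (hs.trans ?_) hlt'
      calc C * |f t - g t| ≤ C * (N * (t - a)) := mul_le_mul_of_nonneg_left hb hC
        _ = _ := by ring
  have bu' : ∀ t ∈ Icc a c, |u' t - w' t| ≤ C₂ * N * (t - a) := by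
    intro t ht
    have := norm_image_sub_le_of_norm_deriv_le_segment' (C := C₂ * N)
      (fun t ht => (h1.du' t ht).sub (h2.du' t ht))
      (fun x hx => by
        have hx' := Ico_subset_Icc_self hx
        rw [Real.norm_eq_abs, neg_sub_neg, abs_sub_comm]
        exact lip hC₂ e3 x hx' (bv x hx') (hk hx').1.2) t ht
    simpa [e2] using this
  have bv' : ∀ t ∈ Icc a c, |v' t - z' t| ≤ lam * C₁ * N * (t - a) := by
    intro t ht
    have := norm_image_sub_le_of_norm_deriv_le_segment' (C := lam * C₁ * N)
      (fun t ht => (h1.dv' t ht).sub (h2.dv' t ht))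
      (fun x hx => by
        have hx' := Ico_subset_Icc_self hx
        rw [Real.norm_eq_abs, neg_sub_neg, abs_sub_comm, ← mul_sub, abs_mul, abs_of_pos hlam,
          mul_assoc]
        exact mul_le_mul_of_nonneg_left
          (lip hC₁ e1 x hx' (bu x hx') (hk hx').1.1) hlam.le) t ht
    simpa [e4] using this
  have hNz : N = 0 := by
    have hma : 0 ≤ m - a := by linarith [hm.1]
    have h5 : N ≤ D * N * (m - a) := by
      rw [hN]
      refine max_le ((bu' m hm).trans ?_) ((bv' m hm).trans ?_)
      · refine mul_le_mul_of_nonneg_right (mul_le_mul_of_nonneg_right ?_ hN0) hma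
        rw [hD]; linarith [show 0 ≤ lam * C₁ by positivity]
      · refine mul_le_mul_of_nonneg_right (mul_le_mul_of_nonneg_right ?_ hN0) hma
        rw [hD]; linarith
    have h6 : D * N * (m - a) ≤ D * N * (c - a) :=
      mul_le_mul_of_nonneg_left (by linarith [hm.2]) (by positivity)
    by_contra hne
    have hpos : 0 < N := lt_of_le_of_ne hN0 (Ne.symm hne)
    nlinarith
  intro t ht
  have z1 := bu t ht
  have z2 := bu' t ht
  have z3 := bv t ht
  have z4 := bv' t ht
  simp only [hNz, mul_zero, zero_mul] at z1 z2 z3 z4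
  have key : ∀ {x y : ℝ}, |x - y| ≤ 0 → x = y := fun h =>
    sub_eq_zero.1 (abs_eq_zero.1 (le_antisymm h (abs_nonneg _)))
  exact ⟨key z1, key z2, key z3, key z4⟩

/-- Uniqueness for the initial value problem along a nondegenerate solution. -/
theorem IsSol.agree {p' q lam T : ℝ} (hp' : 1 < p') (hq : 1 < q) (hlam : 0 < lam)
    {u u' v v' w w' z z' : ℝ → ℝ} (h1 : IsSol p' q lam (Icc 0 T) u u' v v')
    (h2 : IsSol p' q lam (Icc 0 T) w w' z z') (e1 : u 0 = w 0) (e2 : u' 0 = w' 0)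
    (e3 : v 0 = z 0) (e4 : v' 0 = z' 0)
    (n : ∀ t ∈ Ico 0 T, (w t ≠ 0 ∨ w' t ≠ 0) ∧ (z t ≠ 0 ∨ z' t ≠ 0)) :
    ∀ t ∈ Icc 0 T, u t = w t ∧ u' t = w' t ∧ v t = z t ∧ v' t = z' t := by
  set s : Set ℝ := {t | u t - w t = 0 ∧ u' t - w' t = 0 ∧ v t - z t = 0 ∧ v' t - z' t = 0}
  have cl : ∀ {f g : ℝ → ℝ}, ContinuousOn (fun t => f t - g t) (Icc 0 T) →
      IsClosed (Icc 0 T ∩ {t | f t - g t = 0}) := fun hc =>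
    hc.preimage_isClosed_of_isClosed isClosed_Icc isClosed_singleton
  have hcl : IsClosed (s ∩ Icc 0 T) := by
    have c1 := cl fun t ht => ((h1.du t ht).sub (h2.du t ht)).continuousWithinAt
    have c2 := cl fun t ht => ((h1.du' t ht).sub (h2.du' t ht)).continuousWithinAt
    have c3 := cl fun t ht => ((h1.dv t ht).sub (h2.dv t ht)).continuousWithinAt
    have c4 := cl fun t ht => ((h1.dv' t ht).sub (h2.dv' t ht)).continuousWithinAt
    convert ((c1.inter c2).inter c3).inter c4 using 1
    ext t
    simp only [s, mem_inter_iff, mem_ofPred_eq]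
    tauto
  -- The set of agreement is closed and, by local uniqueness, extends to the right of each of its
  -- points, so it is the whole segment.
  have hsub : Icc 0 T ⊆ s := by
    refine hcl.Icc_subset_of_forall_exists_gt ?_ ?_
    · simp [s, e1, e2, e3, e4]
    · rintro x ⟨⟨x1, x2, x3, x4⟩, hx⟩ y hy
      have hsubx : Icc x T ⊆ Icc 0 T := Icc_subset_Icc_left hx.1
      obtain ⟨c, hc1, hc2, hc⟩ := (h1.mono hsubx).eventually_agree hp' hq hlam hx.2
        (h2.mono hsubx) (sub_eq_zero.1 x1) (sub_eq_zero.1 x2) (sub_eq_zero.1 x3)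
        (sub_eq_zero.1 x4) (n x hx).1 (n x hx).2
      refine ⟨min c y, ?_, lt_min hc1 hy, min_le_right _ _⟩
      obtain ⟨y1, y2, y3, y4⟩ := hc (min c y) ⟨(lt_min hc1 hy).le, min_le_left _ _⟩
      exact ⟨sub_eq_zero.2 y1, sub_eq_zero.2 y2, sub_eq_zero.2 y3, sub_eq_zero.2 y4⟩
  intro t ht
  obtain ⟨y1, y2, y3, y4⟩ := hsub ht
  exact ⟨sub_eq_zero.1 y1, sub_eq_zero.1 y2, sub_eq_zero.1 y3, sub_eq_zero.1 y4⟩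

/-! ### Scaling, reflection and uniqueness of positive solutions -/

/-- Under u ↦ a u(·/c) the second derivative gains a/c², so v gains (a/c²)^{p-1} and v'' a further
c⁻². Comparison with the factor a^{q-1} of [u]^q leaves a^{p-q} c^{-2p} for λ. -/
theorem IsSol.scale {p p' q lam a c : ℝ} (hpp : p.HolderConjugate p') (hq : 1 < q) (ha : 0 < a)
    (hc : 0 < c) {D D' : Set ℝ} {u u' v v' : ℝ → ℝ} (h : IsSol p' q lam D u u' v v')
    (hD : MapsTo (fun t => t / c) D' D) :
    IsSol p' q (lam * a ^ (p - q) * c ^ (-2 * p)) D' (fun t => a * u (t / c))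
      (fun t => a / c * u' (t / c)) (fun t => (a / c ^ 2) ^ (p - 1) * v (t / c))
      (fun t => (a / c ^ 2) ^ (p - 1) / c * v' (t / c)) := by
  have hd : ∀ t, HasDerivWithinAt (fun t : ℝ => t / c) (1 / c) D' t := fun t =>
    (hasDerivWithinAt_id t D').div_const c
  have key : ∀ {f : ℝ → ℝ} {f₁ : ℝ} (k : ℝ) {t : ℝ}, t ∈ D' → HasDerivWithinAt f f₁ D (t / c) →
      HasDerivWithinAt (fun t => k * f (t / c)) (k / c * f₁) D' t := by
    intro f f₁ k t ht hf
    exact ((hf.comp t (hd t) hD).const_mul k).congr_deriv (by ring)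
  have hac : 0 < a / c ^ 2 := by positivity
  have e : (p - 1) * (p' - 1) = 1 := by linarith [hpp.mul_eq_add]
  refine ⟨fun t ht => key a ht (h.du _ (hD ht)), fun t ht => ?_,
    fun t ht => key _ ht (h.dv _ (hD ht)), fun t ht => ?_⟩
  · convert key (a / c) ht (h.du' _ (hD ht)) using 1
    rw [spow_mul hpp.symm.lt (by positivity), ← Real.rpow_mul hac.le, e, Real.rpow_one]
    ring
  · convert key ((a / c ^ 2) ^ (p - 1) / c) ht (h.dv' _ (hD ht)) using 1
    rw [spow_mul hq ha, Real.div_rpow ha.le (by positivity), ← Real.rpow_natCast c 2,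
      ← Real.rpow_mul hc.le, show -2 * p = -((2 : ℕ) * (p - 1) + 1 + 1) by push_cast; ring,
      Real.rpow_neg hc.le, Real.rpow_add hc, Real.rpow_add hc, Real.rpow_one,
      show p - q = (p - 1) - (q - 1) by ring, Real.rpow_sub ha]
    have := (Real.rpow_pos_of_pos ha (q - 1)).ne'
    field_simp

theorem IsSol.reflect {p' q lam T : ℝ} {u u' v v' : ℝ → ℝ}
    (h : IsSol p' q lam (Icc 0 T) u u' v v') :
    IsSol p' q lam (Icc 0 T) (fun t => u (T - t)) (fun t => -u' (T - t)) (fun t => v (T - t))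
      (fun t => -v' (T - t)) := by
  have hm : MapsTo (fun t => T - t) (Icc 0 T) (Icc 0 T) := fun t ht =>
    ⟨by linarith [ht.2], by linarith [ht.1]⟩
  have key : ∀ {f : ℝ → ℝ} {f₁ : ℝ} {t : ℝ}, t ∈ Icc 0 T →
      HasDerivWithinAt f f₁ (Icc 0 T) (T - t) →
      HasDerivWithinAt (fun t => f (T - t)) (-f₁) (Icc 0 T) t := by
    intro f f₁ t ht hf
    exact (hf.comp t ((hasDerivWithinAt_id t _).const_sub T) hm).congr_deriv (by ring)
  refine ⟨fun t ht => key ht (h.du _ (hm ht)), fun t ht => ?_,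
    fun t ht => key ht (h.dv _ (hm ht)), fun t ht => ?_⟩
  · exact (key ht (h.du' _ (hm ht))).neg.congr_deriv (by ring)
  · exact (key ht (h.dv' _ (hm ht))).neg.congr_deriv (by ring)

/-- A solution that is positive inside `[0, c]`, with zero boundary values. -/
structure IsPosSol (p' q lam c : ℝ) (u u' v v' : ℝ → ℝ) : Prop
    extends IsSol p' q lam (Icc 0 c) u u' v v' where
  u_pos : ∀ t ∈ Ioo 0 c, 0 < u t
  v_pos : ∀ t ∈ Ioo 0 c, 0 < v t
  u_left : u 0 = 0
  v_left : v 0 = 0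
  u_right : u c = 0
  v_right : v c = 0

/-- A nonpositive slope at 0 would stay nonpositive by concavity, and f could not become positive.
-/
theorem exists_deriv_pos_of_pos {f f' : ℝ → ℝ} {c : ℝ} (hc : 0 < c)
    (h : ∀ t ∈ Icc 0 c, HasDerivWithinAt f (f' t) (Icc 0 c) t) (h0 : f 0 = 0)
    (hpos : ∀ t ∈ Ioo 0 c, 0 < f t) (hm : AntitoneOn f' (Icc 0 c)) : 0 < f' 0 := by
  by_contra hle
  have : AntitoneOn f (Icc 0 c) := by
    have := monotoneOn_of_hasDerivWithinAt_Icc (fun t ht => (h t ht).neg) (fun t ht => by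
      have := hm (left_mem_Icc.2 hc.le) (Ioo_subset_Icc_self ht) ht.1.le
      linarith)
    intro x hx y hy hxy
    have := this hx hy hxy
    simpa using this
  have h1 := this (left_mem_Icc.2 hc.le) (show c / 2 ∈ Icc 0 c from ⟨by linarith, by linarith⟩)
    (by linarith)
  have h2 := hpos (c / 2) ⟨by linarith, by linarith⟩
  linarith

theorem IsPosSol.antitoneOn_u' {p' q lam c : ℝ} (hp' : 1 < p')
    {u u' v v' : ℝ → ℝ} (h : IsPosSol p' q lam c u u' v v') : AntitoneOn u' (Icc 0 c) := by
  have := monotoneOn_of_hasDerivWithinAt_Icc (fun t ht => (h.du' t ht).neg) (fun t ht => by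
    have := spow_pos hp' (h.v_pos t ht)
    simpa using this.le)
  intro x hx y hy hxy
  simpa using this hx hy hxy

theorem IsPosSol.antitoneOn_v' {p' q lam c : ℝ} (hq : 1 < q) (hlam : 0 < lam)
    {u u' v v' : ℝ → ℝ} (h : IsPosSol p' q lam c u u' v v') : AntitoneOn v' (Icc 0 c) := by
  have := monotoneOn_of_hasDerivWithinAt_Icc (fun t ht => (h.dv' t ht).neg) (fun t ht => by
    have := mul_pos hlam (spow_pos hq (h.u_pos t ht))
    simpa using this.le)
  intro x hx y hy hxy
  simpa using this hx hy hxy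

theorem IsPosSol.u'_pos {p' q lam c : ℝ} (hp' : 1 < p') (hc : 0 < c)
    {u u' v v' : ℝ → ℝ} (h : IsPosSol p' q lam c u u' v v') : 0 < u' 0 :=
  exists_deriv_pos_of_pos hc h.du h.u_left h.u_pos (h.antitoneOn_u' hp')

theorem IsPosSol.v'_pos {p' q lam c : ℝ} (hq : 1 < q) (hlam : 0 < lam) (hc : 0 < c)
    {u u' v v' : ℝ → ℝ} (h : IsPosSol p' q lam c u u' v v') : 0 < v' 0 :=
  exists_deriv_pos_of_pos hc h.dv h.v_left h.v_pos (h.antitoneOn_v' hq hlam)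

theorem IsPosSol.v_nonneg {p' q lam c : ℝ} {u u' v v' : ℝ → ℝ}
    (h : IsPosSol p' q lam c u u' v v') {t : ℝ} (ht : t ∈ Icc 0 c) : 0 ≤ v t := by
  rcases ht.1.eq_or_lt with rfl | h0
  · exact h.v_left.ge
  · rcases ht.2.eq_or_lt with rfl | h1
    · exact h.v_right.ge
    · exact (h.v_pos t ⟨h0, h1⟩).le

theorem IsPosSol.reflect {p' q lam c : ℝ} {u u' v v' : ℝ → ℝ}
    (h : IsPosSol p' q lam c u u' v v') :
    IsPosSol p' q lam c (fun t => u (c - t)) (fun t => -u' (c - t)) (fun t => v (c - t))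
      (fun t => -v' (c - t)) where
  toIsSol := h.toIsSol.reflect
  u_pos t ht := h.u_pos _ ⟨by linarith [ht.2], by linarith [ht.1]⟩
  v_pos t ht := h.v_pos _ ⟨by linarith [ht.2], by linarith [ht.1]⟩
  u_left := by simpa using h.u_right
  v_left := by simpa using h.v_right
  u_right := by simpa using h.u_left
  v_right := by simpa using h.v_left

theorem IsPosSol.scale {p p' q lam a c T : ℝ} (hpp : p.HolderConjugate p') (hq : 1 < q)
    (ha : 0 < a) (hc : 0 < c) {u u' v v' : ℝ → ℝ} (h : IsPosSol p' q lam T u u' v v') :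
    IsPosSol p' q (lam * a ^ (p - q) * c ^ (-2 * p)) (c * T) (fun t => a * u (t / c))
      (fun t => a / c * u' (t / c)) (fun t => (a / c ^ 2) ^ (p - 1) * v (t / c))
      (fun t => (a / c ^ 2) ^ (p - 1) / c * v' (t / c)) := by
  have hI : ∀ t ∈ Ioo 0 (c * T), t / c ∈ Ioo 0 T := fun t ht =>
    ⟨div_pos ht.1 hc, by rw [div_lt_iff₀' hc]; exact ht.2⟩
  have hb : 0 < (a / c ^ 2) ^ (p - 1) := by positivity
  have hcT : c * T / c = T := by field_simp
  exact
  { toIsSol := h.toIsSol.scale hpp hq ha hc fun t ht =>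
      ⟨div_nonneg ht.1 hc.le, by rw [div_le_iff₀' hc]; exact ht.2⟩
    u_pos := fun t ht => mul_pos ha (h.u_pos _ (hI t ht))
    v_pos := fun t ht => mul_pos hb (h.v_pos _ (hI t ht))
    u_left := by simp [h.u_left]
    v_left := by simp [h.v_left]
    u_right := by simp [h.u_right, hcT]
    v_right := by simp [h.v_right, hcT] }

/-- The slopes of v and z at 0 must agree. If v'(0) < z'(0), comparison at c gives z(c) > 0 and w(c)
≤ 0, impossible both for c = d and for c < d; if v'(0) > z'(0), it gives z(c) < 0. Uniqueness for
the initial value problem then applies, and w(c) = 0 forces c = d. -/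
theorem IsPosSol.unique_of_le {p' q lam c d : ℝ} (hp' : 1 < p') (hq : 1 < q) (hlam : 0 < lam)
    (hc : 0 < c) (hcd : c ≤ d) {u u' v v' w w' z z' : ℝ → ℝ}
    (h1 : IsPosSol p' q lam c u u' v v') (h2 : IsPosSol p' q lam d w w' z z')
    (e : u' 0 = w' 0) :
    c = d ∧ ∀ t ∈ Icc 0 c, u t = w t ∧ u' t = w' t ∧ v t = z t ∧ v' t = z' t := by
  have h2' := h2.toIsSol.mono (Icc_subset_Icc_right hcd)
  have e0 : u 0 = w 0 := by rw [h1.u_left, h2.u_left]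
  have e1 : v 0 = z 0 := by rw [h1.v_left, h2.v_left]
  have hv : v' 0 = z' 0 := by
    rcases lt_trichotomy (v' 0) (z' 0) with h | h | h
    · obtain ⟨k1, k2⟩ := h1.toIsSol.compare hp' hq hlam hc h2' e0 e1 e h
      rw [h1.v_right] at k1
      rw [h1.u_right] at k2
      rcases hcd.eq_or_lt with rfl | hlt
      · rw [h2.v_right] at k1; exact absurd k1 (lt_irrefl _)
      · linarith [h2.u_pos c ⟨hc, hlt⟩]
    · exact h
    · obtain ⟨k1, -⟩ := h2'.compare hp' hq hlam hc h1.toIsSol e0.symm e1.symm e.symm h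
      rw [h1.v_right] at k1
      linarith [h2.v_nonneg (show c ∈ Icc 0 d from ⟨hc.le, hcd⟩)]
  have hag := h1.toIsSol.agree hp' hq hlam h2' e0 e e1 hv (fun t ht => by
    rcases ht.1.eq_or_lt with rfl | h0
    · exact ⟨Or.inr (h2.u'_pos hp' (hc.trans_le hcd)).ne',
        Or.inr (h2.v'_pos hq hlam (hc.trans_le hcd)).ne'⟩
    · have : t ∈ Ioo 0 d := ⟨h0, ht.2.trans_le hcd⟩
      exact ⟨Or.inl (h2.u_pos t this).ne', Or.inl (h2.v_pos t this).ne'⟩)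
  refine ⟨?_, hag⟩
  rcases hcd.eq_or_lt with h | hlt
  · exact h
  · have := (hag c (right_mem_Icc.2 hc.le)).1
    rw [h1.u_right] at this
    exact absurd this (h2.u_pos c ⟨hc, hlt⟩).ne

/-- With a = ρc the condition becomes λ ρ^{p-q} c^{-(p+q)} = μ, solvable for c because p + q ≠ 0.
Thus a solution can be rescaled to any eigenvalue and any positive initial slope, the latter being
multiplied by a/c. -/
theorem exists_scale {p q : ℝ} (hp : 0 < p) (hq : 0 < q) {lam mu rho : ℝ} (hlam : 0 < lam)
    (hmu : 0 < mu) (hrho : 0 < rho) :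
    ∃ a c : ℝ, 0 < a ∧ 0 < c ∧ lam * a ^ (p - q) * c ^ (-2 * p) = mu ∧ a / c = rho := by
  set c : ℝ := (lam / mu * rho ^ (p - q)) ^ (1 / (p + q)) with hc
  have hb : 0 < lam / mu * rho ^ (p - q) := by positivity
  have hc0 : 0 < c := by positivity
  have hcp : c ^ (p + q) = lam / mu * rho ^ (p - q) := by
    rw [hc, ← Real.rpow_mul hb.le, one_div_mul_cancel (by linarith), Real.rpow_one]
  refine ⟨rho * c, c, by positivity, hc0, ?_, by field_simp⟩
  rw [Real.mul_rpow hrho.le hc0.le, mul_assoc, mul_assoc, ← Real.rpow_add hc0,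
    show p - q + -2 * p = -(p + q) by ring, Real.rpow_neg hc0.le, hcp]
  have := (Real.rpow_pos_of_pos hrho (p - q)).ne'
  field_simp

/-- A positive solution is symmetric. -/
theorem IsPosSol.symmetric {p p' q lam c : ℝ} (hpp : p.HolderConjugate p') (hq : 1 < q)
    (hlam : 0 < lam) (hc : 0 < c) {u u' v v' : ℝ → ℝ} (h : IsPosSol p' q lam c u u' v v') :
    ∀ t ∈ Icc 0 c, u (c - t) = u t ∧ u' (c - t) = -u' t ∧ v (c - t) = v t ∧
      v' (c - t) = -v' t := by
  have hp' := hpp.symm.lt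
  have hr := h.reflect
  have p1 := h.u'_pos hp' hc
  have p2 := hr.u'_pos hp' hc
  -- The reflected solution is rescaled to the eigenvalue and initial slope of the original one.
  -- Uniqueness identifies the two, and equality of their lengths c and d * c gives d = 1.
  obtain ⟨a, d, ha, hd, hl, had⟩ := exists_scale (p := p) (q := q) hpp.pos (by linarith)
    hlam hlam (div_pos p1 p2)
  have hs := hr.scale hpp hq ha hd
  rw [hl] at hs
  have e : u' 0 = a / d * -u' (c - 0 / d) := by
    rw [had, zero_div, div_mul_cancel₀ _ p2.ne']
  obtain ⟨k1, k2⟩ : c = d * c ∧ ∀ t ∈ Icc 0 c, u t = a * u (c - t / d) ∧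
      u' t = a / d * -u' (c - t / d) ∧ v t = (a / d ^ 2) ^ (p - 1) * v (c - t / d) ∧
      v' t = (a / d ^ 2) ^ (p - 1) / d * -v' (c - t / d) := by
    rcases le_total c (d * c) with hle | hle
    · exact h.unique_of_le hp' hq hlam hc hle hs e
    · obtain ⟨k1, k2⟩ := hs.unique_of_le hp' hq hlam (by positivity) hle h e.symm
      refine ⟨k1.symm, fun t ht => ?_⟩
      rw [← k1] at ht
      obtain ⟨a1, a2, a3, a4⟩ := k2 t ht
      exact ⟨a1.symm, a2.symm, a3.symm, a4.symm⟩
  have hd1 : d = 1 := by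
    have : (d - 1) * c = 0 := by linarith
    rcases mul_eq_zero.1 this with h | h <;> linarith
  subst hd1
  -- The midpoint is fixed by the reflection and the solution is positive there, so the amplitude
  -- factor is 1.
  have ha1 : a = 1 := by
    have hm : c / 2 ∈ Ioo 0 c := ⟨by linarith, by linarith⟩
    have h3 := (k2 (c / 2) (Ioo_subset_Icc_self hm)).1
    rw [div_one, show c - c / 2 = c / 2 by ring] at h3
    have h4 := h.u_pos _ hm
    nlinarith
  subst ha1
  intro t ht
  obtain ⟨a1, a2, a3, a4⟩ := k2 t ht
  simp only [div_one, one_pow, Real.one_rpow, one_mul] at a1 a2 a3 a4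
  exact ⟨a1.symm, by linarith, a3.symm, by linarith⟩

/-! ### The Green operator of `-u''` with zero boundary values -/

/-- The double primitive of `g`. -/
noncomputable def dblInt (g : ℝ → ℝ) (t : ℝ) : ℝ := ∫ r in (0 : ℝ)..t, ∫ s in (0 : ℝ)..r, g s

/-- The solution `u` of `-u'' = g`, `u 0 = u L = 0`. -/
noncomputable def green (L : ℝ) (g : ℝ → ℝ) (t : ℝ) : ℝ := t / L * dblInt g L - dblInt g t

/-- The derivative of `green L g`. -/
noncomputable def greenDeriv (L : ℝ) (g : ℝ → ℝ) (t : ℝ) : ℝ :=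
  1 / L * dblInt g L - ∫ s in (0 : ℝ)..t, g s

theorem hasDerivWithinAt_integral_Icc {f : ℝ → ℝ} {L t : ℝ} (hf : ContinuousOn f (Icc 0 L))
    (ht : t ∈ Icc 0 L) : HasDerivWithinAt (fun t => ∫ s in (0 : ℝ)..t, f s) (f t) (Icc 0 L) t := by
  have := Fact.mk ht
  refine intervalIntegral.integral_hasDerivWithinAt_right ?_
    (hf.stronglyMeasurableAtFilter_nhdsWithin measurableSet_Icc t) (hf t ht)
  refine ContinuousOn.intervalIntegrable (hf.mono ?_)
  rw [uIcc_of_le ht.1]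
  exact Icc_subset_Icc_right ht.2

theorem intervalIntegrable_left {g : ℝ → ℝ} {L r : ℝ} (hg : IntervalIntegrable g volume 0 L)
    (hr : r ∈ Icc 0 L) : IntervalIntegrable g volume 0 r :=
  hg.mono_set (by
    rw [uIcc_of_le hr.1, uIcc_of_le (hr.1.trans hr.2)]; exact Icc_subset_Icc_right hr.2)

theorem continuousOn_integral_Icc {g : ℝ → ℝ} {L : ℝ} (hL : 0 < L)
    (hg : IntervalIntegrable g volume 0 L) :
    ContinuousOn (fun t => ∫ s in (0 : ℝ)..t, g s) (Icc 0 L) := by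
  have := (hg.absolutelyContinuousOnInterval_intervalIntegral (c := 0) (by simp)).continuousOn
  rwa [uIcc_of_le hL.le] at this

theorem continuousOn_intervalIntegrable {f : ℝ → ℝ} {L : ℝ} (hL : 0 < L)
    (hf : ContinuousOn f (Icc 0 L)) : IntervalIntegrable f volume 0 L :=
  ContinuousOn.intervalIntegrable (by rwa [uIcc_of_le hL.le])

theorem hasDerivWithinAt_green {g : ℝ → ℝ} {L t : ℝ} (hL : 0 < L)
    (hg : IntervalIntegrable g volume 0 L) (ht : t ∈ Icc 0 L) :
    HasDerivWithinAt (green L g) (greenDeriv L g t) (Icc 0 L) t :=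
  (((hasDerivWithinAt_id t _).div_const L).mul_const _).sub
    (hasDerivWithinAt_integral_Icc (continuousOn_integral_Icc hL hg) ht)

theorem hasDerivWithinAt_greenDeriv {g : ℝ → ℝ} {L t : ℝ} (hg : ContinuousOn g (Icc 0 L))
    (ht : t ∈ Icc 0 L) : HasDerivWithinAt (greenDeriv L g) (-g t) (Icc 0 L) t :=
  (hasDerivWithinAt_integral_Icc hg ht).const_sub _

theorem green_zero (L : ℝ) (g : ℝ → ℝ) : green L g 0 = 0 := by simp [green, dblInt]

theorem green_right {L : ℝ} (hL : 0 < L) (g : ℝ → ℝ) : green L g L = 0 := by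
  simp [green, hL.ne']

theorem abs_greenDeriv_le {g : ℝ → ℝ} {L t : ℝ} (hL : 0 < L)
    (hg : IntervalIntegrable g volume 0 L) (ht : t ∈ Icc 0 L) :
    |greenDeriv L g t| ≤ 2 * ∫ s in (0 : ℝ)..L, |g s| := by
  have hI : ∀ r ∈ Icc 0 L, |∫ s in (0 : ℝ)..r, g s| ≤ ∫ s in (0 : ℝ)..L, |g s| := by
    intro r hr
    refine (intervalIntegral.abs_integral_le_integral_abs hr.1).trans ?_
    exact intervalIntegral.integral_mono_interval le_rfl hr.1 hr.2
      (ae_of_all _ fun _ => abs_nonneg _) hg.abs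
  have hJ : |dblInt g L| ≤ (∫ s in (0 : ℝ)..L, |g s|) * |L - 0| :=
    intervalIntegral.norm_integral_le_of_norm_le_const (C := ∫ s in (0 : ℝ)..L, |g s|)
      (f := fun r => ∫ s in (0 : ℝ)..r, g s) fun x hx => by
      rw [uIoc_of_le hL.le] at hx
      exact hI x (Ioc_subset_Icc_self hx)
  have hJ' : |1 / L * dblInt g L| ≤ ∫ s in (0 : ℝ)..L, |g s| := by
    rw [sub_zero, abs_of_pos hL] at hJ
    rw [abs_mul, abs_of_pos (by positivity : 0 < 1 / L), one_div_mul_eq_div, div_le_iff₀ hL]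
    exact hJ
  have := hI t ht
  have := abs_sub (1 / L * dblInt g L) (∫ s in (0 : ℝ)..t, g s)
  rw [greenDeriv]
  linarith

theorem abs_green_sub_le {g : ℝ → ℝ} {L x y : ℝ} (hL : 0 < L)
    (hg : IntervalIntegrable g volume 0 L) (hx : x ∈ Icc 0 L) (hy : y ∈ Icc 0 L) :
    |green L g x - green L g y| ≤ (2 * ∫ s in (0 : ℝ)..L, |g s|) * |x - y| :=
  (convex_Icc 0 L).norm_image_sub_le_of_norm_hasDerivWithin_le
    (fun _ ht => hasDerivWithinAt_green hL hg ht) (fun _ ht => abs_greenDeriv_le hL hg ht) hy hx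

theorem abs_green_le {g : ℝ → ℝ} {L x : ℝ} (hL : 0 < L)
    (hg : IntervalIntegrable g volume 0 L) (hx : x ∈ Icc 0 L) :
    |green L g x| ≤ 2 * L * ∫ s in (0 : ℝ)..L, |g s| := by
  have h := abs_green_sub_le hL hg hx (left_mem_Icc.2 hL.le)
  rw [green_zero, sub_zero, sub_zero, abs_of_nonneg hx.1] at h
  have h0 : 0 ≤ ∫ s in (0 : ℝ)..L, |g s| :=
    intervalIntegral.integral_nonneg hL.le fun _ _ => abs_nonneg _
  nlinarith [hx.2]

theorem continuousOn_green {g : ℝ → ℝ} {L : ℝ} (hL : 0 < L)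
    (hg : IntervalIntegrable g volume 0 L) : ContinuousOn (green L g) (Icc 0 L) :=
  fun _ ht => (hasDerivWithinAt_green hL hg ht).continuousWithinAt

/-- For g ≥ 0 the double primitive is convex and vanishes at 0, so it lies below its chord over [0,
L]. The inner integral at t is the intermediate slope used in the comparison. -/
theorem green_nonneg {g : ℝ → ℝ} {L t : ℝ} (hL : 0 < L) (hg : IntervalIntegrable g volume 0 L)
    (h0 : ∀ t ∈ Icc 0 L, 0 ≤ g t) (ht : t ∈ Icc 0 L) : 0 ≤ green L g t := by
  set I : ℝ → ℝ := fun r => ∫ s in (0 : ℝ)..r, g s with hI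
  have hmono : ∀ r ∈ Icc 0 L, ∀ r' ∈ Icc 0 L, r ≤ r' → I r ≤ I r' := by
    intro r hr r' hr' h
    have : I r' - I r = ∫ s in r..r', g s := intervalIntegral.integral_interval_sub_left
      (intervalIntegrable_left hg hr') (intervalIntegrable_left hg hr)
    have : 0 ≤ ∫ s in r..r', g s := intervalIntegral.integral_nonneg h fun x hx =>
      h0 x ⟨hr.1.trans hx.1, hx.2.trans hr'.2⟩
    linarith
  have hIi : IntervalIntegrable I volume 0 L :=
    continuousOn_intervalIntegrable hL (continuousOn_integral_Icc hL hg)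
  have hIi' : IntervalIntegrable I volume 0 t := intervalIntegrable_left hIi ht
  have hIi'' : IntervalIntegrable I volume t L := hIi'.symm.trans hIi
  have h1 : dblInt g t ≤ t * I t := by
    have := intervalIntegral.integral_mono_on (g := fun _ => I t) ht.1 hIi'
      intervalIntegrable_const fun x hx => hmono x ⟨hx.1, hx.2.trans ht.2⟩ t ht hx.2
    simpa [dblInt, hI] using this
  have h2 : (L - t) * I t ≤ dblInt g L - dblInt g t := by
    have e : dblInt g L - dblInt g t = ∫ r in t..L, I r :=
      intervalIntegral.integral_interval_sub_left hIi hIi'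
    have := intervalIntegral.integral_mono_on (f := fun _ => I t) ht.2
      intervalIntegrable_const hIi'' fun x hx => hmono t ht x ⟨ht.1.trans hx.1, hx.2⟩ hx.1
    rw [e]
    simpa using this
  have h3 : L * dblInt g t ≤ t * dblInt g L := by
    have := mul_le_mul_of_nonneg_left h1 (sub_nonneg.2 ht.2)
    have := mul_le_mul_of_nonneg_left h2 ht.1
    nlinarith
  rw [green, sub_nonneg, div_mul_eq_mul_div, le_div_iff₀ hL]
  linarith

theorem dblInt_const_mul (k : ℝ) (g : ℝ → ℝ) (t : ℝ) :
    dblInt (fun s => k * g s) t = k * dblInt g t := by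
  simp only [dblInt, intervalIntegral.integral_const_mul]

theorem dblInt_add {f g : ℝ → ℝ} {L t : ℝ} (hL : 0 < L) (hf : IntervalIntegrable f volume 0 L)
    (hg : IntervalIntegrable g volume 0 L) (ht : t ∈ Icc 0 L) :
    dblInt (fun s => f s + g s) t = dblInt f t + dblInt g t := by
  rw [dblInt, dblInt, dblInt, ← intervalIntegral.integral_add]
  · apply intervalIntegral.integral_congr
    intro r hr
    rw [uIcc_of_le ht.1] at hr
    have hr' : r ∈ Icc 0 L := ⟨hr.1, hr.2.trans ht.2⟩
    exact intervalIntegral.integral_add (intervalIntegrable_left hf hr')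
      (intervalIntegrable_left hg hr')
  · exact intervalIntegrable_left
      (continuousOn_intervalIntegrable hL (continuousOn_integral_Icc hL hf)) ht
  · exact intervalIntegrable_left
      (continuousOn_intervalIntegrable hL (continuousOn_integral_Icc hL hg)) ht

theorem green_const_mul (L k : ℝ) (g : ℝ → ℝ) (t : ℝ) :
    green L (fun s => k * g s) t = k * green L g t := by
  simp only [green, dblInt_const_mul]; ring

theorem green_add {f g : ℝ → ℝ} {L t : ℝ} (hL : 0 < L) (hf : IntervalIntegrable f volume 0 L)
    (hg : IntervalIntegrable g volume 0 L) (ht : t ∈ Icc 0 L) :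
    green L (fun s => f s + g s) t = green L f t + green L g t := by
  rw [green, green, green, dblInt_add hL hf hg ht, dblInt_add hL hf hg (right_mem_Icc.2 hL.le)]
  ring

theorem green_congr_ae {f g : ℝ → ℝ} {L t : ℝ} (hL : 0 < L) (h : f =ᵐ[segMeasure L] g)
    (ht : t ∈ Icc 0 L) : green L f t = green L g t := by
  have h1 : ∀ r ∈ Icc 0 L, ∫ s in (0 : ℝ)..r, f s = ∫ s in (0 : ℝ)..r, g s := by
    intro r hr
    apply intervalIntegral.integral_congr_ae
    filter_upwards [ae_interval_of_ae_seg hL h] with x hx h5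
    apply hx
    rw [uIoc_of_le hr.1] at h5
    rw [uIoc_of_le hL.le]
    exact ⟨h5.1, h5.2.trans hr.2⟩
  have h2 : ∀ r ∈ Icc 0 L, dblInt f r = dblInt g r := by
    intro r hr
    apply intervalIntegral.integral_congr
    intro s hs
    rw [uIcc_of_le hr.1] at hs
    exact h1 s ⟨hs.1, hs.2.trans hr.2⟩
  rw [green, green, h2 t ht, h2 L (right_mem_Icc.2 hL.le)]

/-- Positivity of the Green operator, applied to |g| - g and |g| + g. -/
theorem abs_green_le_green_abs {g : ℝ → ℝ} {L t : ℝ} (hL : 0 < L)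
    (hg : IntervalIntegrable g volume 0 L) (ht : t ∈ Icc 0 L) :
    |green L g t| ≤ green L (fun s => |g s|) t := by
  have hn : IntervalIntegrable (fun s => (-1) * g s) volume 0 L := hg.const_mul (-1)
  have h1 := green_nonneg hL (hg.abs.add hn) (fun s _ => by
    simpa using le_abs_self (g s)) ht
  have h2 := green_nonneg hL (hg.abs.add hg) (fun s _ => by
    linarith [neg_abs_le (g s)]) ht
  rw [green_add hL hg.abs hn ht, green_const_mul] at h1
  rw [green_add hL hg.abs hg ht] at h2
  exact abs_le.2 ⟨by linarith, by linarith⟩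

/-- Integration by parts against a `C²` function with zero boundary values. -/
theorem integral_green_mul {g h h' h'' : ℝ → ℝ} {L : ℝ} (hL : 0 < L)
    (hg : IntervalIntegrable g volume 0 L) (d1 : ∀ t ∈ Icc 0 L, HasDerivWithinAt h (h' t) (Icc 0 L) t)
    (d2 : ∀ t ∈ Icc 0 L, HasDerivWithinAt h' (h'' t) (Icc 0 L) t)
    (hc : ContinuousOn h'' (Icc 0 L)) (h0 : h 0 = 0) (hr : h L = 0) :
    ∫ t in (0 : ℝ)..L, green L g t * h'' t = -∫ t in (0 : ℝ)..L, g t * h t := by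
  have u : uIcc 0 L = Icc 0 L := uIcc_of_le hL.le
  have c1 : ContinuousOn h' (Icc 0 L) := fun t ht => (d2 t ht).continuousWithinAt
  have i1 : IntervalIntegrable h' volume 0 L := continuousOn_intervalIntegrable hL c1
  have cI := continuousOn_integral_Icc hL hg
  have iG : IntervalIntegrable (greenDeriv L g) volume 0 L :=
    continuousOn_intervalIntegrable hL (continuousOn_const.sub cI)
  rw [intervalIntegral.integral_mul_deriv_eq_deriv_mul_of_hasDerivWithinAt (u' := greenDeriv L g)
    (v := h') (by rw [u]; exact fun t ht => hasDerivWithinAt_green hL hg ht) (by rw [u]; exact d2)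
    iG (continuousOn_intervalIntegrable hL hc), green_zero, green_right hL]
  -- As g is only integrable, its primitive is only absolutely continuous. A bound on h' makes h
  -- Lipschitz, so the second integration by parts takes place between absolutely continuous
  -- functions.
  obtain ⟨K, hK⟩ := isCompact_Icc.exists_bound_of_continuousOn c1
  have hlip : LipschitzOnWith K.toNNReal h (Icc 0 L) :=
    (convex_Icc 0 L).lipschitzOnWith_of_nnnorm_hasDerivWithin_le d1 fun x hx => by
      rw [← NNReal.coe_le_coe, coe_nnnorm]
      exact (hK x hx).trans (Real.le_coe_toNNReal K)
  have hac : AbsolutelyContinuousOnInterval h 0 L :=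
    LipschitzOnWith.absolutelyContinuousOnInterval (by rwa [u])
  have hIac := hg.absolutelyContinuousOnInterval_intervalIntegral (c := 0) (by simp)
  have parts := hIac.integral_mul_deriv_eq_deriv_mul hac
  have e1 : ∫ t in (0 : ℝ)..L, (∫ s in (0 : ℝ)..t, g s) * deriv h t =
      ∫ t in (0 : ℝ)..L, (∫ s in (0 : ℝ)..t, g s) * h' t := by
    rw [intervalIntegral.integral_of_le hL.le, intervalIntegral.integral_of_le hL.le,
      integral_Ioc_eq_integral_Ioo, integral_Ioc_eq_integral_Ioo]
    apply setIntegral_congr_fun measurableSet_Ioo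
    intro t ht
    simp only
    rw [((d1 t (Ioo_subset_Icc_self ht)).hasDerivAt (Icc_mem_nhds ht.1 ht.2)).deriv]
  have e2 : ∫ t in (0 : ℝ)..L, deriv (fun t => ∫ s in (0 : ℝ)..t, g s) t * h t =
      ∫ t in (0 : ℝ)..L, g t * h t := by
    apply intervalIntegral.integral_congr_ae
    filter_upwards [hg.ae_hasDerivAt_integral] with x hx h2
    rw [(hx (uIoc_subset_uIcc h2) 0 (by simp)).deriv]
  rw [e1, e2, h0, hr] at parts
  -- The constant term of `greenDeriv` drops out because h' has integral zero.
  have e3 : ∫ t in (0 : ℝ)..L, h' t = 0 := by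
    rw [intervalIntegral.integral_eq_sub_of_hasDeriv_right_of_le hL.le
      (fun t ht => (d1 t ht).continuousWithinAt)
      (fun t ht => ((d1 t (Ioo_subset_Icc_self ht)).hasDerivAt
        (Icc_mem_nhds ht.1 ht.2)).hasDerivWithinAt) i1, h0, hr, sub_zero]
  have e4 : ∫ t in (0 : ℝ)..L, greenDeriv L g t * h' t =
      1 / L * dblInt g L * (∫ t in (0 : ℝ)..L, h' t) -
        ∫ t in (0 : ℝ)..L, (∫ s in (0 : ℝ)..t, g s) * h' t := by
    have i2 : IntervalIntegrable (fun t => (∫ s in (0 : ℝ)..t, g s) * h' t) volume 0 L :=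
      continuousOn_intervalIntegrable hL (cI.mul c1)
    rw [← intervalIntegral.integral_const_mul, ← intervalIntegral.integral_sub
      (i1.const_mul _) i2]
    apply intervalIntegral.integral_congr
    intro t _
    simp only [greenDeriv]; ring
  rw [e4, e3, parts]
  ring

/-- Self-adjointness of the Green operator: integration by parts against `green L ψ`, whose second
derivative is -ψ. Only ψ needs to be continuous; g will be a member of a maximizing sequence. -/
theorem integral_green_mul_comm {g ψ : ℝ → ℝ} {L : ℝ} (hL : 0 < L)
    (hg : IntervalIntegrable g volume 0 L) (hψ : ContinuousOn ψ (Icc 0 L)) :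
    ∫ t in (0 : ℝ)..L, green L g t * ψ t = ∫ t in (0 : ℝ)..L, g t * green L ψ t := by
  have := integral_green_mul hL hg
    (fun t ht => hasDerivWithinAt_green hL (continuousOn_intervalIntegrable hL hψ) ht)
    (fun t ht => hasDerivWithinAt_greenDeriv hψ ht) hψ.neg (green_zero _ _) (green_right hL _)
  simp only [mul_neg, intervalIntegral.integral_neg, neg_inj] at this
  exact this

/-- A function with `-u'' = g` and zero boundary values is `green L g`. -/
theorem eq_green {u u' g : ℝ → ℝ} {L : ℝ} (hL : 0 < L) (hg : IntervalIntegrable g volume 0 L)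
    {a : ℝ} (h1 : ∀ t ∈ Icc 0 L, u' t = a - ∫ s in (0 : ℝ)..t, g s)
    (h2 : ∀ t ∈ Icc 0 L, u t = ∫ r in (0 : ℝ)..t, u' r) (h3 : u L = 0) :
    ∀ t ∈ Icc 0 L, u t = green L g t := by
  have hI := continuousOn_integral_Icc hL hg
  have e : ∀ t ∈ Icc 0 L, u t = a * t - dblInt g t := by
    intro t ht
    have hIt := intervalIntegrable_left (continuousOn_intervalIntegrable hL hI) ht
    have : ∫ r in (0 : ℝ)..t, u' r = ∫ r in (0 : ℝ)..t, (a - ∫ s in (0 : ℝ)..r, g s) := by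
      apply intervalIntegral.integral_congr
      intro r hr
      rw [uIcc_of_le ht.1] at hr
      exact h1 r ⟨hr.1, hr.2.trans ht.2⟩
    rw [h2 t ht, this, intervalIntegral.integral_sub intervalIntegrable_const hIt,
      intervalIntegral.integral_const, smul_eq_mul, sub_zero, mul_comm]
    rfl
  have ha : a * L = dblInt g L := by
    have := e L (right_mem_Icc.2 hL.le)
    linarith
  intro t ht
  rw [e t ht, green, ← ha]
  field_simp

/-! ### The extremal problem for the Green operator -/

theorem integral_segMeasure {L : ℝ} (hL : 0 < L) (f : ℝ → ℝ) :
    ∫ t, f t ∂(segMeasure L) = ∫ t in (0 : ℝ)..L, f t := by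
  rw [intervalIntegral.integral_of_le hL.le, ← integral_Icc_eq_integral_Ioc]

theorem intervalIntegrable_iff_segMeasure {L : ℝ} (hL : 0 < L) (f : ℝ → ℝ) :
    IntervalIntegrable f volume 0 L ↔ Integrable f (segMeasure L) :=
  intervalIntegrable_iff_integrableOn_Icc_of_le hL.le

theorem MemLp.intervalIntegrable_seg {p L : ℝ} (hp : 1 < p) (hL : 0 < L) {g : ℝ → ℝ}
    (hg : MemLp g (ENNReal.ofReal p) (segMeasure L)) : IntervalIntegrable g volume 0 L :=
  (intervalIntegrable_iff_segMeasure hL g).2 (hg.integrable (by simpa using hp.le))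

theorem MemLp.intervalIntegrable_rpow {p L : ℝ} (hp : 1 < p) (hL : 0 < L) {g : ℝ → ℝ}
    (hg : MemLp g (ENNReal.ofReal p) (segMeasure L)) :
    IntervalIntegrable (fun t => |g t| ^ p) volume 0 L := by
  rw [intervalIntegrable_iff_segMeasure hL]
  have := hg.integrable_norm_rpow (by simp; linarith) (by simp)
  rw [ENNReal.toReal_ofReal (by linarith)] at this
  exact this

theorem continuousOn_memLp {L : ℝ} (p : ℝ) {g : ℝ → ℝ} (hg : ContinuousOn g (Icc 0 L)) :
    MemLp g (ENNReal.ofReal p) (segMeasure L) := by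
  obtain ⟨K, hK⟩ := isCompact_Icc.exists_bound_of_continuousOn hg
  refine MemLp.of_bound (hg.aestronglyMeasurable measurableSet_Icc) K ?_
  filter_upwards [ae_restrict_mem measurableSet_Icc] with t ht using hK t ht

theorem continuousOn_abs_rpow {f : ℝ → ℝ} {S : Set ℝ} {r : ℝ} (hr : 0 ≤ r)
    (hf : ContinuousOn f S) : ContinuousOn (fun t => |f t| ^ r) S :=
  (Real.continuous_rpow_const hr).comp_continuousOn hf.abs

/-- Hölder's inequality on `[0, L]`. -/
theorem integral_mul_le_of_nonneg {p p' L : ℝ} (hpp : p.HolderConjugate p') (hL : 0 < L)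
    {f g : ℝ → ℝ} (hf0 : ∀ t ∈ Icc 0 L, 0 ≤ f t) (hg0 : ∀ t ∈ Icc 0 L, 0 ≤ g t)
    (hf : MemLp f (ENNReal.ofReal p) (segMeasure L))
    (hg : MemLp g (ENNReal.ofReal p') (segMeasure L)) :
    ∫ t in (0 : ℝ)..L, f t * g t ≤
      (∫ t in (0 : ℝ)..L, f t ^ p) ^ (1 / p) * (∫ t in (0 : ℝ)..L, g t ^ p') ^ (1 / p') := by
  simp only [← integral_segMeasure hL]
  refine integral_mul_le_Lp_mul_Lq_of_nonneg hpp ?_ ?_ hf hg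
  · filter_upwards [ae_restrict_mem measurableSet_Icc] with t ht using hf0 t ht
  · filter_upwards [ae_restrict_mem measurableSet_Icc] with t ht using hg0 t ht

/-- Young's inequality with the case of equality. -/
theorem mul_rpow_lt_young {x y q : ℝ} (hq : 1 < q) (hx : 0 ≤ x) (hy : 0 ≤ y) (hxy : x ≠ y) :
    x * y ^ (q - 1) < x ^ q / q + (1 - 1 / q) * y ^ q := by
  have hq0 : 0 < q := by linarith
  rcases hy.eq_or_lt with rfl | hy
  · rw [Real.zero_rpow (by linarith), Real.zero_rpow hq0.ne', mul_zero, mul_zero, add_zero]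
    have : 0 < x := lt_of_le_of_ne hx (Ne.symm hxy)
    positivity
  · have h := one_add_mul_self_lt_rpow_one_add (s := x / y - 1)
      (by linarith [div_nonneg hx hy.le]) (by
        intro h
        apply hxy
        field_simp at h
        linarith) hq
    rw [show 1 + (x / y - 1) = x / y by ring, Real.div_rpow hx hy.le,
      lt_div_iff₀ (by positivity)] at h
    rw [Real.rpow_sub_one hy.ne']
    have e : x * (y ^ q / y) = ((1 + q * (x / y - 1)) * y ^ q) / q + (1 - 1 / q) * y ^ q := by
      field_simp
      ring
    rw [e]
    gcongr

theorem mul_rpow_le_young {x y q : ℝ} (hq : 1 < q) (hx : 0 ≤ x) (hy : 0 ≤ y) :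
    x * y ^ (q - 1) ≤ x ^ q / q + (1 - 1 / q) * y ^ q := by
  by_cases h : x = y
  · subst h
    have hq0 : 0 < q := by linarith
    have := mul_spow hq x
    rw [spow_of_nonneg hq hx, abs_of_nonneg hx] at this
    rw [this]
    apply le_of_eq
    field_simp
    ring
  · exact (mul_rpow_lt_young hq hx hy h).le

/-- The nonnegative unit ball of `L^p`. -/
structure Admissible (p L : ℝ) (g : ℝ → ℝ) : Prop where
  memLp : MemLp g (ENNReal.ofReal p) (segMeasure L)
  nonneg : ∀ t ∈ Icc 0 L, 0 ≤ g t
  le_one : ∫ t in (0 : ℝ)..L, |g t| ^ p ≤ 1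

/-- The pointwise bound |g| ≤ 1 + |g|^p gives an L¹ bound independent of g, hence uniform sup and
Lipschitz bounds for the images under the Green operator. -/
theorem Admissible.integral_abs_le {p L : ℝ} (hp : 1 < p) (hL : 0 < L) {g : ℝ → ℝ}
    (h : Admissible p L g) : ∫ t in (0 : ℝ)..L, |g t| ≤ L + 1 := by
  have i1 := MemLp.intervalIntegrable_rpow hp hL h.memLp
  have i2 := MemLp.intervalIntegrable_seg hp hL h.memLp
  have := intervalIntegral.integral_mono_on (g := fun t => 1 + |g t| ^ p) hL.le i2.abs
    (intervalIntegrable_const.add i1) (fun t _ => by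
      rcases le_total (|g t|) 1 with h1 | h1
      · linarith [Real.rpow_nonneg (abs_nonneg (g t)) p]
      · have := Real.rpow_le_rpow_of_exponent_le h1 hp.le
        rw [Real.rpow_one] at this
        linarith)
  rw [intervalIntegral.integral_add intervalIntegrable_const i1,
    intervalIntegral.integral_const] at this
  simp only [sub_zero, smul_eq_mul, mul_one] at this
  linarith [h.le_one]

theorem Admissible.abs_green_le {p L : ℝ} (hp : 1 < p) (hL : 0 < L) {g : ℝ → ℝ}
    (h : Admissible p L g) {t : ℝ} (ht : t ∈ Icc 0 L) : |green L g t| ≤ 2 * L * (L + 1) := by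
  refine (Biharmonic.abs_green_le hL (MemLp.intervalIntegrable_seg hp hL h.memLp) ht).trans ?_
  exact mul_le_mul_of_nonneg_left (h.integral_abs_le hp hL) (by positivity)

theorem integral_rpow_le_of_bound {q L M : ℝ} (hq : 1 < q) (hL : 0 < L) {f : ℝ → ℝ}
    (hf : ContinuousOn f (Icc 0 L)) (hM : ∀ t ∈ Icc 0 L, |f t| ≤ M) :
    ∫ t in (0 : ℝ)..L, |f t| ^ q ≤ L * M ^ q := by
  have := intervalIntegral.integral_mono_on (g := fun _ => M ^ q) hL.le
    (continuousOn_intervalIntegrable hL (continuousOn_abs_rpow (by linarith : 0 ≤ q) hf))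
    intervalIntegrable_const
    (fun t ht => Real.rpow_le_rpow (abs_nonneg _) (hM t ht) (by linarith))
  simpa using this

open Topology in
/-- A pointwise convergent subsequence of `green L (g k)`, with a continuous limit. -/
theorem exists_subseq_tendsto_green {p L : ℝ} (hp : 1 < p) (hL : 0 < L) {g : ℕ → ℝ → ℝ}
    (hg : ∀ k, Admissible p L (g k)) :
    ∃ (u : ℝ → ℝ) (φ : ℕ → ℕ), StrictMono φ ∧ Continuous u ∧
      ∀ t ∈ Icc 0 L, Tendsto (fun k => green L (g (φ k)) t) atTop (𝓝 (u t)) := by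
  set M : ℝ := 2 * L * (L + 1) with hM
  have hgi : ∀ k, IntervalIntegrable (g k) volume 0 L := fun k =>
    MemLp.intervalIntegrable_seg hp hL (hg k).memLp
  let K : NNReal := (2 * (L + 1)).toNNReal
  -- Functions bounded by M with a common Lipschitz constant form a compact set by Arzelà–Ascoli;
  -- the images `green L (g k)` all lie in it.
  let A : Set (BoundedContinuousFunction (Icc 0 L) ℝ) :=
    {f | (∀ x, f x ∈ Metric.closedBall 0 M) ∧ LipschitzWith K f}
  have hAc : IsClosed A := by
    have h1 : IsClosed {f : BoundedContinuousFunction (Icc 0 L) ℝ |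
        ∀ x, f x ∈ Metric.closedBall 0 M} := by
      simp only [ofPred_forall]
      exact isClosed_iInter fun x => Metric.isClosed_closedBall.preimage
        (continuous_eval_const x)
    have h2 : IsClosed {f : BoundedContinuousFunction (Icc 0 L) ℝ | LipschitzWith K f} := by
      simp only [LipschitzWith, ofPred_forall]
      refine isClosed_iInter fun x => isClosed_iInter fun y => isClosed_le ?_ continuous_const
      exact (continuous_eval_const x).edist
        (continuous_eval_const y)
    exact h1.inter h2
  have hcomp : IsCompact A := by
    refine BoundedContinuousFunction.arzela_ascoli₂ (Metric.closedBall 0 M)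
      (isCompact_closedBall 0 M) A hAc (fun f x hf => hf.1 x) ?_
    exact (LipschitzWith.uniformEquicontinuous _ K fun f => f.2.2).equicontinuous
  let F : ℕ → BoundedContinuousFunction (Icc 0 L) ℝ := fun k =>
    BoundedContinuousFunction.mkOfCompact
      ⟨fun x => green L (g k) x, (continuousOn_green hL (hgi k)).domRestrict⟩
  have hF : ∀ k, F k ∈ A := by
    intro k
    refine ⟨fun x => ?_, ?_⟩
    · rw [mem_closedBall_zero_iff]
      exact (hg k).abs_green_le hp hL x.2
    · refine LipschitzWith.of_dist_le_mul fun x y => ?_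
      have := abs_green_sub_le hL (hgi k) x.2 y.2
      rw [Real.coe_toNNReal _ (by positivity)]
      refine this.trans (mul_le_mul_of_nonneg_right ?_ (abs_nonneg _))
      linarith [(hg k).integral_abs_le hp hL]
  obtain ⟨f, -, φ, hφ, hlim⟩ := hcomp.tendsto_subseq hF
  refine ⟨fun t => f (projIcc 0 L hL.le t), φ, hφ, f.continuous.comp continuous_projIcc, ?_⟩
  intro t ht
  have := ((continuous_eval_const (F := BoundedContinuousFunction (Icc 0 L) ℝ) (⟨t, ht⟩ : Icc 0 L)).tendsto
    f).comp hlim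
  simp only [projIcc_of_mem hL.le ht]
  exact this

/-- The image of a nonnegative function is concave and zero at both ends, so it lies above the
chords that join the two end points to any point of its graph. -/
theorem green_pos_of_exists {g : ℝ → ℝ} {L : ℝ} (hL : 0 < L) (hg : ContinuousOn g (Icc 0 L))
    (h0 : ∀ t ∈ Icc 0 L, 0 ≤ g t) (hne : ∃ t ∈ Icc 0 L, green L g t ≠ 0) :
    ∀ t ∈ Ioo 0 L, 0 < green L g t := by
  have hgi := continuousOn_intervalIntegrable hL hg
  have hd : ∀ t ∈ Ioo 0 L, HasDerivAt (green L g) (greenDeriv L g t) t := fun t ht =>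
    (hasDerivWithinAt_green hL hgi (Ioo_subset_Icc_self ht)).hasDerivAt (Icc_mem_nhds ht.1 ht.2)
  have hanti : AntitoneOn (greenDeriv L g) (Icc 0 L) := by
    have := monotoneOn_of_hasDerivWithinAt_Icc
      (fun t ht => (hasDerivWithinAt_greenDeriv hg ht).neg) (fun t ht => by
        simpa using h0 t (Ioo_subset_Icc_self ht))
    intro x hx y hy hxy
    simpa using this hx hy hxy
  have hconc : ConcaveOn ℝ (Icc 0 L) (green L g) := by
    refine AntitoneOn.concaveOn_of_deriv (convex_Icc 0 L) (continuousOn_green hL hgi) ?_ ?_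
    · rw [interior_Icc]
      exact fun t ht => (hd t ht).differentiableAt.differentiableWithinAt
    · rw [interior_Icc]
      intro x hx y hy hxy
      rw [(hd x hx).deriv, (hd y hy).deriv]
      exact hanti (Ioo_subset_Icc_self hx) (Ioo_subset_Icc_self hy) hxy
  obtain ⟨s, hs, hs'⟩ := hne
  have hspos : 0 < green L g s := lt_of_le_of_ne (green_nonneg hL hgi h0 hs) (Ne.symm hs')
  have hs0 : 0 < s := lt_of_le_of_ne hs.1 (by rintro rfl; exact hs' (green_zero _ _))
  have hsL : s < L := lt_of_le_of_ne hs.2 (by rintro rfl; exact hs' (green_right hL _))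
  intro t ht
  rcases le_total t s with hts | hts
  · have h1 := hconc.2 (left_mem_Icc.2 hL.le) hs 
      (show 0 ≤ 1 - t / s by rw [sub_nonneg, div_le_one hs0]; exact hts)
      (show 0 ≤ t / s from div_nonneg ht.1.le hs.1) (by ring)
    have e : (1 - t / s) • (0 : ℝ) + (t / s) • s = t := by
      simp only [smul_eq_mul]; field_simp; ring
    rw [e, green_zero, smul_zero, zero_add, smul_eq_mul] at h1
    exact lt_of_lt_of_le (mul_pos (div_pos ht.1 hs0) hspos) h1
  · have hLs : 0 < L - s := by linarith
    have h1 := hconc.2 (right_mem_Icc.2 hL.le) hs 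
      (show 0 ≤ 1 - (L - t) / (L - s) by rw [sub_nonneg, div_le_one hLs]; linarith)
      (show 0 ≤ (L - t) / (L - s) from div_nonneg (by linarith [ht.2]) hLs.le)
      (by ring)
    have e : (1 - (L - t) / (L - s)) • L + ((L - t) / (L - s)) • s = t := by
      simp only [smul_eq_mul]; field_simp; ring
    rw [e, green_right hL, smul_zero, zero_add, smul_eq_mul] at h1
    exact lt_of_lt_of_le (mul_pos (div_pos (by linarith [ht.2]) hLs) hspos) h1

theorem green_one {L : ℝ} (hL : 0 < L) (c t : ℝ) :
    green L (fun _ => c) t = c * (t * (L - t) / 2) := by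
  have : ∀ t, dblInt (fun _ => c) t = c * (t ^ 2 / 2) := by
    intro t
    simp only [dblInt, intervalIntegral.integral_const, sub_zero, smul_eq_mul]
    rw [intervalIntegral.integral_mul_const, integral_id]
    ring
  have hL0 : L ≠ 0 := hL.ne'
  rw [green, this, this]
  field_simp

/-- The constant function of norm one; it guarantees that the supremum of the extremal problem is
positive. -/
theorem exists_admissible_pos {p q L : ℝ} (hp : 1 < p) (hq : 1 < q) (hL : 0 < L) :
    ∃ g, Admissible p L g ∧ 0 < ∫ t in (0 : ℝ)..L, |green L g t| ^ q := by
  set c : ℝ := (1 / L) ^ (1 / p)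
  have hc : 0 < c := by positivity
  refine ⟨fun _ => c, ⟨memLp_const c, fun _ _ => hc.le, ?_⟩, ?_⟩
  · rw [intervalIntegral.integral_const, abs_of_pos hc, ← Real.rpow_mul (by positivity),
      one_div_mul_cancel (by linarith), Real.rpow_one, smul_eq_mul, sub_zero]
    exact (mul_one_div_cancel hL.ne').le
  · refine intervalIntegral.intervalIntegral_pos_of_pos_on ?_ (fun t ht => ?_) hL
    · exact continuousOn_intervalIntegrable hL (continuousOn_abs_rpow (by linarith)
        (continuousOn_green hL intervalIntegrable_const))
    · rw [green_one hL]
      have h1 := ht.1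
      have h2 : 0 < L - t := by linarith [ht.2]
      positivity

/-- The bound on the unit ball extends to all of `L^p` by homogeneity. -/
theorem integral_green_rpow_le {p q L Q : ℝ} (hp : 1 < p) (hq : 1 < q) (hL : 0 < L)
    (hQ : ∀ g, Admissible p L g → ∫ t in (0 : ℝ)..L, |green L g t| ^ q ≤ Q) {g : ℝ → ℝ}
    (hg : MemLp g (ENNReal.ofReal p) (segMeasure L)) :
    ∫ t in (0 : ℝ)..L, |green L g t| ^ q ≤ Q * (∫ t in (0 : ℝ)..L, |g t| ^ p) ^ (q / p) := by
  have hp0 : 0 < p := by linarith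
  have hq0 : 0 < q := by linarith
  have hgi := MemLp.intervalIntegrable_seg hp hL hg
  have hgp := MemLp.intervalIntegrable_rpow hp hL hg
  set M := ∫ t in (0 : ℝ)..L, |g t| ^ p with hM
  have hM0 : 0 ≤ M := intervalIntegral.integral_nonneg hL.le fun t _ =>
    Real.rpow_nonneg (abs_nonneg _) _
  rcases hM0.eq_or_lt with h | hMpos
  · have hz : g =ᵐ[segMeasure L] fun _ => 0 := by
      have h1 := h.symm
      rw [hM, ← integral_segMeasure hL, integral_eq_zero_iff_of_nonneg
        (fun t => Real.rpow_nonneg (abs_nonneg _) _)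
        ((intervalIntegrable_iff_segMeasure hL _).1 hgp)] at h1
      filter_upwards [h1] with t ht
      have ht' : |g t| ^ p = 0 := ht
      rw [Real.rpow_eq_zero (abs_nonneg _) hp0.ne'] at ht'
      exact abs_eq_zero.1 ht'
    have e : ∫ t in (0 : ℝ)..L, |green L g t| ^ q = ∫ t in (0 : ℝ)..L, (0 : ℝ) := by
      apply intervalIntegral.integral_congr
      intro t ht
      rw [uIcc_of_le hL.le] at ht
      simp only
      rw [green_congr_ae hL hz ht, green_one hL, zero_mul, abs_zero, Real.zero_rpow hq0.ne']
    rw [e, ← h, Real.zero_rpow (by positivity)]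
    simp
  · set k : ℝ := M ^ (1 / p) with hk
    have hk0 : 0 < k := by positivity
    have hkp : k ^ p = M := by
      rw [hk, ← Real.rpow_mul hM0, one_div_mul_cancel hp0.ne', Real.rpow_one]
    -- Admissibility requires a nonnegative function, so |g| is normalized instead of g; its image
    -- dominates that of g pointwise.
    have had : Admissible p L (fun t => k⁻¹ * |g t|) := by
      refine ⟨hg.abs.const_mul _, fun t _ => by positivity, ?_⟩
      have : ∀ t, |(k⁻¹ * |g t|)| ^ p = M⁻¹ * |g t| ^ p := by
        intro t
        rw [abs_mul, abs_abs, abs_of_pos (by positivity : 0 < k⁻¹),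
          Real.mul_rpow (by positivity) (abs_nonneg _), Real.inv_rpow hk0.le, hkp]
      simp only [this, intervalIntegral.integral_const_mul]
      rw [← hM, inv_mul_cancel₀ hMpos.ne']
    have h1 := hQ _ had
    have e : ∀ t, |green L (fun t => k⁻¹ * |g t|) t| ^ q =
        (k ^ q)⁻¹ * |green L (fun s => |g s|) t| ^ q := by
      intro t
      rw [green_const_mul, abs_mul, abs_of_pos (by positivity : 0 < k⁻¹),
          Real.mul_rpow (by positivity) (abs_nonneg _), Real.inv_rpow hk0.le]
    simp only [e, intervalIntegral.integral_const_mul] at h1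
    rw [inv_mul_le_iff₀ (by positivity)] at h1
    have e2 : k ^ q = M ^ (q / p) := by
      rw [hk, ← Real.rpow_mul hM0]; congr 1; ring
    rw [← e2, mul_comm]
    refine le_trans ?_ h1
    refine intervalIntegral.integral_mono_on hL.le
      (continuousOn_intervalIntegrable hL (continuousOn_abs_rpow hq0.le (continuousOn_green hL hgi)))
      (continuousOn_intervalIntegrable hL
        (continuousOn_abs_rpow hq0.le (continuousOn_green hL hgi.abs))) ?_
    intro t ht
    exact Real.rpow_le_rpow (abs_nonneg _)
      ((abs_green_le_green_abs hL hgi ht).trans (le_abs_self _)) hq0.le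

open Topology in
theorem tendsto_integral_of_bounded {L M : ℝ} (hL : 0 < L) {F : ℕ → ℝ → ℝ} {f : ℝ → ℝ}
    (hF : ∀ k, ContinuousOn (F k) (Icc 0 L)) (hM : ∀ k, ∀ t ∈ Icc 0 L, |F k t| ≤ M)
    (hlim : ∀ t ∈ Icc 0 L, Tendsto (fun k => F k t) atTop (𝓝 (f t))) :
    Tendsto (fun k => ∫ t in (0 : ℝ)..L, F k t) atTop (𝓝 (∫ t in (0 : ℝ)..L, f t)) := by
  refine intervalIntegral.tendsto_integral_filter_of_dominated_convergence (fun _ => M)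
    (Eventually.of_forall fun k => ?_) (Eventually.of_forall fun k => ae_of_all _ fun t ht => ?_)
    intervalIntegrable_const (ae_of_all _ fun t ht => ?_)
  · rw [uIoc_of_le hL.le]
    exact ((hF k).mono Ioc_subset_Icc_self).aestronglyMeasurable measurableSet_Ioc
  · rw [uIoc_of_le hL.le] at ht
    exact hM k t (Ioc_subset_Icc_self ht)
  · rw [uIoc_of_le hL.le] at ht
    exact hlim t (Ioc_subset_Icc_self ht)

open Topology in
/-- The supremum of `‖green g‖_q` over the nonnegative unit ball of `L^p` is approached along a
pointwise convergent sequence. -/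
theorem exists_maximizing_limit {p q L : ℝ} (hp : 1 < p) (hq : 1 < q) (hL : 0 < L) :
    ∃ (Q : ℝ) (g : ℕ → ℝ → ℝ) (u : ℝ → ℝ), 0 < Q ∧ Continuous u ∧ (∀ k, Admissible p L (g k)) ∧
      (∀ t ∈ Icc 0 L, Tendsto (fun k => green L (g k) t) atTop (𝓝 (u t))) ∧
      (∫ t in (0 : ℝ)..L, |u t| ^ q = Q) ∧
      ∀ g, Admissible p L g → ∫ t in (0 : ℝ)..L, |green L g t| ^ q ≤ Q := by
  have hq0 : 0 ≤ q := by linarith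
  set M : ℝ := 2 * L * (L + 1)
  set S : Set ℝ := {x | ∃ g, Admissible p L g ∧ x = ∫ t in (0 : ℝ)..L, |green L g t| ^ q}
  have hcont : ∀ {g}, Admissible p L g → ContinuousOn (green L g) (Icc 0 L) := fun hg =>
    continuousOn_green hL (MemLp.intervalIntegrable_seg hp hL hg.memLp)
  have hbdd : BddAbove S := by
    refine ⟨L * M ^ q, ?_⟩
    rintro x ⟨g, hg, rfl⟩
    exact integral_rpow_le_of_bound hq hL (hcont hg) fun t ht => hg.abs_green_le hp hL ht
  obtain ⟨g₀, hg₀, hpos⟩ := exists_admissible_pos hp hq hL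
  have hQ : ∀ g, Admissible p L g → ∫ t in (0 : ℝ)..L, |green L g t| ^ q ≤ sSup S := fun g hg =>
    le_csSup hbdd ⟨g, hg, rfl⟩
  obtain ⟨x, -, hx, hxS⟩ := exists_seq_tendsto_sSup (S := S) ⟨_, g₀, hg₀, rfl⟩ hbdd
  choose g hg hxe using hxS
  obtain ⟨u, φ, hφ, hu, hlim⟩ := exists_subseq_tendsto_green hp hL hg
  refine ⟨sSup S, fun k => g (φ k), u, hpos.trans_le (hQ g₀ hg₀), hu, fun k => hg _, hlim, ?_, hQ⟩
  have h1 : Tendsto (fun k => ∫ t in (0 : ℝ)..L, |green L (g (φ k)) t| ^ q) atTop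
      (𝓝 (∫ t in (0 : ℝ)..L, |u t| ^ q)) := by
    refine tendsto_integral_of_bounded (M := M ^ q) hL
      (fun k => continuousOn_abs_rpow hq0 (hcont (hg _))) (fun k t ht => ?_) (fun t ht => ?_)
    · rw [abs_of_nonneg (Real.rpow_nonneg (abs_nonneg _) _)]
      exact Real.rpow_le_rpow (abs_nonneg _) ((hg _).abs_green_le hp hL ht) hq0
    · exact (((Real.continuous_rpow_const hq0).comp continuous_abs).tendsto _).comp (hlim t ht)
  have h2 := hx.comp hφ.tendsto_atTop
  have h3 : x ∘ φ = fun k => ∫ t in (0 : ℝ)..L, |green L (g (φ k)) t| ^ q :=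
    funext fun k => hxe (φ k)
  rw [h3] at h2
  exact tendsto_nhds_unique h1 h2

/-- The sharp constant of the embedding is attained, at a positive solution. -/
theorem exists_extremal {p p' q L : ℝ} (hpp : p.HolderConjugate p') (hq : 1 < q) (hL : 0 < L) :
    ∃ (Q : ℝ) (u u' v v' : ℝ → ℝ), 0 < Q ∧ IsPosSol p' q (1 / Q) L u u' v v' ∧
      (∫ t in (0 : ℝ)..L, |u t| ^ q = Q) ∧ (∫ t in (0 : ℝ)..L, |spow (v t) p'| ^ p = 1) ∧
      ∀ g, MemLp g (ENNReal.ofReal p) (segMeasure L) →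
        ∫ t in (0 : ℝ)..L, |green L g t| ^ q ≤ Q * (∫ t in (0 : ℝ)..L, |g t| ^ p) ^ (q / p) := by
  have hp := hpp.lt
  have hp' := hpp.symm.lt
  have hq0 : 0 < q := by linarith
  obtain ⟨Q, g, u, hQ0, hu, hg, hlim, huQ, hQ⟩ := exists_maximizing_limit (q := q) hp hq hL
  have hgi : ∀ k, IntervalIntegrable (g k) volume 0 L := fun k =>
    MemLp.intervalIntegrable_seg hp hL (hg k).memLp
  have hu0 : ∀ t ∈ Icc 0 L, 0 ≤ u t := fun t ht => ge_of_tendsto' (hlim t ht) fun k =>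
    green_nonneg hL (hgi k) (hg k).nonneg ht
  -- The function dual to the limit u: ∫ uψ = ∫ |u|^q = Q. The image of ψ, divided by its norm N in
  -- L^{p'}, will be the component v.
  set ψ : ℝ → ℝ := fun t => |u t| ^ (q - 1) with hψ
  have hψc : Continuous ψ := (Real.continuous_rpow_const (by linarith)).comp hu.abs
  have hψi : IntervalIntegrable ψ volume 0 L := hψc.intervalIntegrable _ _
  have hψ0 : ∀ t, 0 ≤ ψ t := fun t => Real.rpow_nonneg (abs_nonneg _) _
  have huψ : ∀ t, |u t| * ψ t = |u t| ^ q := fun t => by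
    have := mul_spow hq |u t|
    rwa [spow_of_nonneg hq (abs_nonneg _), abs_abs] at this
  set h : ℝ → ℝ := green L ψ with hh
  have hhc : ContinuousOn h (Icc 0 L) := continuousOn_green hL hψi
  have hh0 : ∀ t ∈ Icc 0 L, 0 ≤ h t := fun t ht => green_nonneg hL hψi (fun t _ => hψ0 t) ht
  set H : ℝ := ∫ t in (0 : ℝ)..L, h t ^ p' with hH
  have hH0 : 0 ≤ H := intervalIntegral.integral_nonneg hL.le fun t ht =>
    Real.rpow_nonneg (hh0 t ht) _
  set N : ℝ := H ^ (1 / p') with hN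
  have hNp : N ^ p' = H := by
    rw [hN, ← Real.rpow_mul hH0, one_div_mul_cancel (by linarith), Real.rpow_one]
  -- Q is the limit of ∫ green(g_k) ψ = ∫ g_k h, and each term is at most N by Hölder. Convergence
  -- of the g_k themselves is not needed.
  have hQN : Q ≤ N := by
    obtain ⟨K, hK⟩ := isCompact_Icc.exists_bound_of_continuousOn (hψc.continuousOn (s := Icc 0 L))
    have h1 := tendsto_integral_of_bounded (F := fun k t => green L (g k) t * ψ t)
      (f := fun t => u t * ψ t) (M := 2 * L * (L + 1) * K) hL
      (fun k => (continuousOn_green hL (hgi k)).mul hψc.continuousOn)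
      (fun k t ht => by
        rw [abs_mul]
        exact mul_le_mul ((hg k).abs_green_le hp hL ht) (hK t ht) (abs_nonneg _)
          (by positivity))
      (fun t ht => (hlim t ht).mul_const _)
    have h2 : ∫ t in (0 : ℝ)..L, u t * ψ t = Q := by
      rw [← huQ]
      apply intervalIntegral.integral_congr
      intro t ht
      rw [uIcc_of_le hL.le] at ht
      simp only
      rw [← huψ, abs_of_nonneg (hu0 t ht)]
    rw [h2] at h1
    refine le_of_tendsto' h1 fun k => ?_
    rw [integral_green_mul_comm hL (hgi k) hψc.continuousOn]
    refine (integral_mul_le_of_nonneg hpp hL (hg k).nonneg hh0 (hg k).memLp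
      (continuousOn_memLp _ hhc)).trans ?_
    have h3 : ∫ t in (0 : ℝ)..L, g k t ^ p ≤ 1 := by
      refine le_trans (le_of_eq ?_) (hg k).le_one
      apply intervalIntegral.integral_congr
      intro t ht
      rw [uIcc_of_le hL.le] at ht
      simp only
      rw [abs_of_nonneg ((hg k).nonneg t ht)]
    have h4 : (∫ t in (0 : ℝ)..L, g k t ^ p) ^ (1 / p) ≤ 1 :=
      Real.rpow_le_one (intervalIntegral.integral_nonneg hL.le fun t ht =>
        Real.rpow_nonneg ((hg k).nonneg t ht) _) h3 (one_div_nonneg.2 (by linarith))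
    have h5 : 0 ≤ N := Real.rpow_nonneg hH0 _
    calc _ ≤ 1 * N := mul_le_mul_of_nonneg_right h4 h5
      _ = N := one_mul _
  have hN0 : 0 < N := hQ0.trans_le hQN
  have hHpos : 0 < H := by rw [← hNp]; positivity
  set v : ℝ → ℝ := fun t => h t / N with hv
  have hv0 : ∀ t ∈ Icc 0 L, 0 ≤ v t := fun t ht => div_nonneg (hh0 t ht) hN0.le
  -- The equality case of Hölder against h: G has norm one and ∫ G h = N. Its image w replaces the
  -- possibly missing limit of the g_k.
  set G : ℝ → ℝ := fun t => spow (v t) p' with hG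
  have hGc : ContinuousOn G (Icc 0 L) :=
    (continuous_spow hp').comp_continuousOn (hhc.div_const N)
  have hGi : IntervalIntegrable G volume 0 L := continuousOn_intervalIntegrable hL hGc
  have hG0 : ∀ t ∈ Icc 0 L, 0 ≤ G t := fun t ht => by
    simp only [hG]
    rw [spow_of_nonneg hp' (hv0 t ht)]
    exact Real.rpow_nonneg (hv0 t ht) _
  have hvp : ∫ t in (0 : ℝ)..L, |v t| ^ p' = 1 := by
    have : ∫ t in (0 : ℝ)..L, |v t| ^ p' = ∫ t in (0 : ℝ)..L, H⁻¹ * h t ^ p' := by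
      apply intervalIntegral.integral_congr
      intro t ht
      rw [uIcc_of_le hL.le] at ht
      simp only [hv]
      rw [abs_of_nonneg (hv0 t ht), Real.div_rpow (hh0 t ht) hN0.le, hNp]
      ring
    rw [this, intervalIntegral.integral_const_mul, ← hH, inv_mul_cancel₀ hHpos.ne']
  have hGp : ∫ t in (0 : ℝ)..L, |G t| ^ p = 1 := by
    rw [← hvp]
    congr 1
    ext t
    simp only [hG]
    rw [abs_spow hp', ← Real.rpow_mul (abs_nonneg _), hpp.symm.sub_one_mul_conj]
  have hGad : Admissible p L G := ⟨continuousOn_memLp _ hGc, hG0, hGp.le⟩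
  have hGh : ∫ t in (0 : ℝ)..L, G t * h t = N := by
    have : ∫ t in (0 : ℝ)..L, G t * h t = ∫ t in (0 : ℝ)..L, N * |v t| ^ p' := by
      congr 1
      ext t
      rw [← mul_spow hp']
      simp only [hG, hv]
      field_simp
    rw [this, intervalIntegral.integral_const_mul, hvp, mul_one]
  set w : ℝ → ℝ := green L G with hw
  have hwc : ContinuousOn w (Icc 0 L) := continuousOn_green hL hGi
  have hw0 : ∀ t ∈ Icc 0 L, 0 ≤ w t := fun t ht => green_nonneg hL hGi hG0 ht
  have hwψ : ∫ t in (0 : ℝ)..L, w t * ψ t = N := by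
    rw [hw, integral_green_mul_comm hL hGi hψc.continuousOn, hGh]
  have c1 := continuousOn_abs_rpow hq0.le hwc
  have c2 := continuousOn_abs_rpow (S := Icc 0 L) hq0.le hu.continuousOn
  have i1 := continuousOn_intervalIntegrable hL c1
  have i2 := continuousOn_intervalIntegrable hL c2
  have i3 : IntervalIntegrable (fun t => w t * ψ t) volume 0 L :=
    continuousOn_intervalIntegrable hL (hwc.mul hψc.continuousOn)
  -- The integrand is the deficit in Young's inequality for w and u. The maximality of Q bounds ∫
  -- w^q, so the deficit integrates to at most Q - N ≤ 0; being nonnegative, it vanishes, which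
  -- gives N = Q and w = u.
  have hD : ∫ t in (0 : ℝ)..L, (|w t| ^ q / q + (1 - 1 / q) * |u t| ^ q - w t * ψ t) ≤ Q - N := by
    rw [intervalIntegral.integral_sub ((i1.div_const q).add (i2.const_mul _)) i3,
      intervalIntegral.integral_add (i1.div_const q) (i2.const_mul _),
      intervalIntegral.integral_div, intervalIntegral.integral_const_mul, huQ, hwψ]
    have h1 : (∫ t in (0 : ℝ)..L, |w t| ^ q) / q ≤ Q / q := by
      gcongr
      exact hQ G hGad
    have h2 : Q / q + (1 - 1 / q) * Q = Q := by field_simp; ring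
    linarith
  have hDc : ContinuousOn (fun t => |w t| ^ q / q + (1 - 1 / q) * |u t| ^ q - w t * ψ t)
      (Icc 0 L) :=
    ((c1.div_const q).add (continuousOn_const.mul c2)).sub (hwc.mul hψc.continuousOn)
  have hD0 : ∀ t ∈ Icc 0 L, 0 ≤ |w t| ^ q / q + (1 - 1 / q) * |u t| ^ q - w t * ψ t := by
    intro t ht
    have := mul_rpow_le_young hq (hw0 t ht) (abs_nonneg (u t))
    rw [abs_of_nonneg (hw0 t ht)]
    linarith
  have hNQ : N = Q := by
    have := intervalIntegral.integral_nonneg (μ := volume) hL.le hD0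
    linarith
  have hwu : ∀ t ∈ Icc 0 L, w t = u t := by
    by_contra hcon
    push Not at hcon
    obtain ⟨t, ht, hne⟩ := hcon
    have := intervalIntegral.integral_pos hL hDc
      (fun x hx => hD0 x (Ioc_subset_Icc_self hx)) ⟨t, ht, by
        have := mul_rpow_lt_young hq (hw0 t ht) (abs_nonneg (u t))
          (by rwa [abs_of_nonneg (hu0 t ht)])
        rw [abs_of_nonneg (hw0 t ht)]
        linarith⟩
    linarith
  have hwQ : ∫ t in (0 : ℝ)..L, |w t| ^ q = Q := by
    rw [← huQ]
    apply intervalIntegral.integral_congr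
    intro t ht
    rw [uIcc_of_le hL.le] at ht
    simp only
    rw [hwu t ht]
  -- w is not identically zero because ∫ |w|^q = Q > 0.
  have hwpos := green_pos_of_exists hL hGc hG0 (by
    by_contra hcon
    push Not at hcon
    have : ∫ t in (0 : ℝ)..L, |w t| ^ q = ∫ t in (0 : ℝ)..L, (0 : ℝ) := by
      apply intervalIntegral.integral_congr
      intro t ht
      rw [uIcc_of_le hL.le] at ht
      simp only
      rw [hw, hcon t ht, abs_zero, Real.zero_rpow hq0.ne']
    rw [hwQ] at this
    simp only [intervalIntegral.integral_zero] at this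
    linarith)
  have hhpos := green_pos_of_exists hL hψc.continuousOn (fun t _ => hψ0 t) (by
    by_contra hcon
    push Not at hcon
    have : H = ∫ t in (0 : ℝ)..L, (0 : ℝ) := by
      apply intervalIntegral.integral_congr
      intro t ht
      rw [uIcc_of_le hL.le] at ht
      simp only
      rw [hh, hcon t ht, Real.zero_rpow (by linarith)]
    simp only [intervalIntegral.integral_zero] at this
    linarith)
  refine ⟨Q, w, greenDeriv L G, v, fun t => greenDeriv L ψ t / N, hQ0, ?_, hwQ, hGp, fun f hf =>
    integral_green_rpow_le hp hq hL hQ hf⟩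
  exact
  { du := fun t ht => hasDerivWithinAt_green hL hGi ht
    du' := fun t ht => hasDerivWithinAt_greenDeriv hGc ht
    dv := fun t ht => (hasDerivWithinAt_green hL hψi ht).div_const N
    dv' := fun t ht => by
      refine ((hasDerivWithinAt_greenDeriv hψc.continuousOn ht).div_const N).congr_deriv ?_
      rw [spow_of_nonneg hq (hw0 t ht), hwu t ht, hNQ]
      simp only [hψ]
      rw [abs_of_nonneg (hu0 t ht)]
      ring
    u_pos := hwpos
    v_pos := fun t ht => div_pos (hhpos t ht) hN0
    u_left := green_zero _ _
    v_left := by simp only [hv, hh, green_zero, zero_div]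
    u_right := green_right hL _
    v_right := by simp only [hv, hh, green_right hL, zero_div] }

/-! ### Antiperiodic extension -/

/-- The extension of `u : [0, 1] → ℝ` with `antiExt u (t + 1) = -antiExt u t`. -/
noncomputable def antiExt (u : ℝ → ℝ) (t : ℝ) : ℝ := (-1 : ℝ) ^ ⌊t⌋ * u (Int.fract t)

theorem antiExt_antiperiodic (u : ℝ → ℝ) : Function.Antiperiodic (antiExt u) 1 := by
  intro t
  simp only [antiExt, Int.floor_add_one, Int.fract_add_one]
  rw [zpow_add_one₀ (by norm_num)]
  ring

theorem antiExt_of_mem {u : ℝ → ℝ} {t : ℝ} (ht : t ∈ Ico (0 : ℝ) 1) : antiExt u t = u t := by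
  have h1 : ⌊t⌋ = 0 := Int.floor_eq_zero_iff.2 ht
  rw [antiExt, h1, Int.fract_eq_self.2 ht, zpow_zero, one_mul]

/-- The formula also holds at the right end of the cell, where the floor jumps, thanks to u(1) =
-u(0). Each integer thus belongs to two closed cells with valid formulas. -/
theorem antiExt_eqOn {u : ℝ → ℝ} (h0 : u 1 = -u 0) (k : ℤ) {s : ℝ}
    (hs : s ∈ Icc (k : ℝ) (k + 1)) : antiExt u s = (-1 : ℝ) ^ k * u (s - k) := by
  rcases hs.2.eq_or_lt with h | h
  · subst h
    have h1 : ((k : ℝ) + 1) = ((k + 1 : ℤ) : ℝ) := by push_cast; ring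
    rw [antiExt, h1, Int.floor_intCast, Int.fract_intCast, zpow_add_one₀ (by norm_num)]
    push_cast
    rw [show (k : ℝ) + 1 - k = 1 by ring, h0]
    ring
  · have h1 : ⌊s⌋ = k := Int.floor_eq_iff.2 ⟨hs.1, h⟩
    rw [antiExt, Int.fract, h1]

/-- At an integer the one-sided derivatives from the two adjacent cells agree because u' satisfies
the same sign condition as u. -/
theorem hasDerivAt_antiExt {u u' : ℝ → ℝ}
    (h : ∀ t ∈ Icc (0 : ℝ) 1, HasDerivWithinAt u (u' t) (Icc 0 1) t) (h0 : u 1 = -u 0)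
    (h1 : u' 1 = -u' 0) (t : ℝ) : HasDerivAt (antiExt u) (antiExt u' t) t := by
  have key : ∀ k : ℤ, ∀ s ∈ Icc (k : ℝ) (k + 1),
      HasDerivWithinAt (antiExt u) (antiExt u' s) (Icc (k : ℝ) (k + 1)) s := by
    intro k s hs
    have hm : MapsTo (fun s : ℝ => s - k) (Icc (k : ℝ) (k + 1)) (Icc 0 1) := fun x hx =>
      ⟨by linarith [hx.1], by linarith [hx.2]⟩
    rw [antiExt_eqOn h1 k hs]
    have := ((h (s - k) (hm hs)).comp s ((hasDerivWithinAt_id s _).sub_const (k : ℝ)) hm).const_mul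
      ((-1 : ℝ) ^ k)
    rw [mul_one] at this
    exact this.congr (fun x hx => antiExt_eqOn h0 k hx) (antiExt_eqOn h0 k hs)
  rcases (Int.floor_le t).eq_or_lt with he | hlt
  · have a1 := key ⌊t⌋ t ⟨he.le, (Int.lt_floor_add_one t).le⟩
    have a2 := key (⌊t⌋ - 1) t ⟨by push_cast; linarith, by push_cast; linarith⟩
    refine (a2.union a1).hasDerivAt ?_
    push_cast
    rw [sub_add_cancel, Icc_union_Icc_eq_Icc (by linarith) (by linarith)]
    exact Icc_mem_nhds (by linarith) (by linarith)
  · exact (key ⌊t⌋ t ⟨hlt.le, (Int.lt_floor_add_one t).le⟩).hasDerivAt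
      (Icc_mem_nhds hlt (Int.lt_floor_add_one t))

theorem spow_antiExt (v : ℝ → ℝ) (k r t : ℝ) :
    antiExt (fun t => -(k * spow (v t) r)) t = -(k * spow (antiExt v t) r) := by
  simp only [antiExt]
  rcases Int.even_or_odd ⌊t⌋ with h | h
  · rw [h.neg_one_zpow]; simp
  · rw [h.neg_one_zpow]; simp [spow_neg]

/-- A solution on the line, antiperiodic with antiperiod `L` and positive on `(0, L)`. -/
structure IsAntiSol (p' q lam L : ℝ) (w w' z z' : ℝ → ℝ) : Prop
    extends IsSol p' q lam univ w w' z z' where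
  anti_w : Function.Antiperiodic w L
  anti_w' : Function.Antiperiodic w' L
  anti_z : Function.Antiperiodic z L
  anti_z' : Function.Antiperiodic z' L
  w_pos : ∀ t ∈ Ioo 0 L, 0 < w t
  z_pos : ∀ t ∈ Ioo 0 L, 0 < z t
  w_zero : w 0 = 0
  z_zero : z 0 = 0
  w'_pos : 0 < w' 0
  z'_pos : 0 < z' 0
  symm : ∀ t ∈ Icc 0 L, w (L - t) = w t

/-- Symmetry of the positive solution gives u'(1) = -u'(0) and v'(1) = -v'(0), the matching
conditions for the first derivatives. The second derivatives match because u and v vanish at the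
ends and signed powers are odd. -/
theorem IsPosSol.exists_isAntiSol {p p' q lam : ℝ} (hpp : p.HolderConjugate p') (hq : 1 < q)
    (hlam : 0 < lam) {u u' v v' : ℝ → ℝ} (h : IsPosSol p' q lam 1 u u' v v') :
    ∃ w w' z z', IsAntiSol p' q lam 1 w w' z z' ∧ EqOn w u (Icc 0 1) ∧ EqOn z v (Icc 0 1) := by
  have hs := h.symmetric hpp hq hlam one_pos
  have hs0 := hs 0 (left_mem_Icc.2 zero_le_one)
  simp only [sub_zero] at hs0
  have hu1 : u 1 = -u 0 := by rw [h.u_left, h.u_right, neg_zero]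
  have hv1 : v 1 = -v 0 := by rw [h.v_left, h.v_right, neg_zero]
  have e1 : EqOn (antiExt u) u (Icc 0 1) := fun t ht => by
    have := antiExt_eqOn hu1 0 (s := t) (by simpa using ht)
    simpa using this
  have e2 : EqOn (antiExt v) v (Icc 0 1) := fun t ht => by
    have := antiExt_eqOn hv1 0 (s := t) (by simpa using ht)
    simpa using this
  have m0 : (0 : ℝ) ∈ Ico (0 : ℝ) 1 := by simp
  refine ⟨antiExt u, antiExt u', antiExt v, antiExt v', ?_, e1, e2⟩
  exact
  { du := fun t _ => (hasDerivAt_antiExt h.du hu1 hs0.2.1 t).hasDerivWithinAt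
    du' := fun t _ => by
      have := hasDerivAt_antiExt (u' := fun t => -(1 * spow (v t) p'))
        (by simpa using h.du') hs0.2.1 (by simp [h.v_left, h.v_right, spow_zero]) t
      rw [spow_antiExt, one_mul] at this
      exact this.hasDerivWithinAt
    dv := fun t _ => (hasDerivAt_antiExt h.dv hv1 hs0.2.2.2 t).hasDerivWithinAt
    dv' := fun t _ => by
      have := hasDerivAt_antiExt h.dv' hs0.2.2.2 (by simp [h.u_left, h.u_right, spow_zero]) t
      rw [spow_antiExt] at this
      exact this.hasDerivWithinAt
    anti_w := antiExt_antiperiodic _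
    anti_w' := antiExt_antiperiodic _
    anti_z := antiExt_antiperiodic _
    anti_z' := antiExt_antiperiodic _
    w_pos := fun t ht => by rw [e1 (Ioo_subset_Icc_self ht)]; exact h.u_pos t ht
    z_pos := fun t ht => by rw [e2 (Ioo_subset_Icc_self ht)]; exact h.v_pos t ht
    w_zero := by rw [antiExt_of_mem m0, h.u_left]
    z_zero := by rw [antiExt_of_mem m0, h.v_left]
    w'_pos := by rw [antiExt_of_mem m0]; exact h.u'_pos hpp.symm.lt one_pos
    z'_pos := by rw [antiExt_of_mem m0]; exact h.v'_pos hq hlam one_pos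
    symm := fun t ht => by
      rw [e1 ht, e1 (show 1 - t ∈ Icc (0 : ℝ) 1 from ⟨by linarith [ht.2], by linarith [ht.1]⟩)]
      exact (hs t ht).1 }

theorem IsAntiSol.scale {p p' q lam a c L : ℝ} (hpp : p.HolderConjugate p') (hq : 1 < q)
    (ha : 0 < a) (hc : 0 < c) {w w' z z' : ℝ → ℝ} (h : IsAntiSol p' q lam L w w' z z') :
    IsAntiSol p' q (lam * a ^ (p - q) * c ^ (-2 * p)) (c * L) (fun t => a * w (t / c))
      (fun t => a / c * w' (t / c)) (fun t => (a / c ^ 2) ^ (p - 1) * z (t / c))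
      (fun t => (a / c ^ 2) ^ (p - 1) / c * z' (t / c)) := by
  have hI : ∀ t ∈ Ioo 0 (c * L), t / c ∈ Ioo 0 L := fun t ht =>
    ⟨div_pos ht.1 hc, by rw [div_lt_iff₀' hc]; exact ht.2⟩
  have hb : 0 < (a / c ^ 2) ^ (p - 1) := by positivity
  have anti : ∀ {f : ℝ → ℝ} (k : ℝ), Function.Antiperiodic f L →
      Function.Antiperiodic (fun t => k * f (t / c)) (c * L) := by
    intro f k hf t
    have : (t + c * L) / c = t / c + L := by field_simp
    simp only [this, hf (t / c)]
    ring
  exact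
  { toIsSol := h.toIsSol.scale hpp hq ha hc (mapsTo_univ _ _)
    anti_w := anti _ h.anti_w
    anti_w' := anti _ h.anti_w'
    anti_z := anti _ h.anti_z
    anti_z' := anti _ h.anti_z'
    w_pos := fun t ht => mul_pos ha (h.w_pos _ (hI t ht))
    z_pos := fun t ht => mul_pos hb (h.z_pos _ (hI t ht))
    w_zero := by simp [h.w_zero]
    z_zero := by simp [h.z_zero]
    w'_pos := by simpa using mul_pos (div_pos ha hc) h.w'_pos
    z'_pos := by simpa using mul_pos (div_pos hb hc) h.z'_pos
    symm := fun t ht => by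
      have := h.symm (t / c) ⟨div_nonneg ht.1 hc.le, by rw [div_le_iff₀' hc]; exact ht.2⟩
      rw [show (c * L - t) / c = L - t / c by field_simp, this] }

theorem antiperiodic_add_int_mul {f : ℝ → ℝ} {L : ℝ} (h : Function.Antiperiodic f L) (s : ℝ)
    (k : ℤ) : f (s + k * L) = (-1 : ℝ) ^ k * f s := by
  rcases Int.even_or_odd k with he | he
  · obtain ⟨m, rfl⟩ := he
    have := h.periodic_two_mul.int_mul m s
    rw [Even.neg_one_zpow ⟨m, rfl⟩, one_mul, ← this]
    congr 1; push_cast; ring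
  · obtain ⟨m, rfl⟩ := he
    have := h.periodic_two_mul.int_mul m (s + L)
    rw [Odd.neg_one_zpow ⟨m, rfl⟩, neg_one_mul, ← h s, ← this]
    congr 1; push_cast; ring

/-- w and z have the same sign everywhere and only simple, common zeros. This supplies the
nondegeneracy for the initial value problem and excludes the sign patterns produced by comparison.
-/
theorem IsAntiSol.trichotomy {p' q lam L : ℝ} (hL : 0 < L) {w w' z z' : ℝ → ℝ}
    (h : IsAntiSol p' q lam L w w' z z') (t : ℝ) :
    (0 < w t ∧ 0 < z t) ∨ (w t < 0 ∧ z t < 0) ∨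
      ((∃ k : ℤ, t = k * L) ∧ w t = 0 ∧ z t = 0 ∧ w' t ≠ 0 ∧ z' t ≠ 0) := by
  set k := ⌊t / L⌋ with hk
  set s := t - k * L with hs
  have hst : t = s + k * L := by rw [hs]; ring
  have hs0 : 0 ≤ s := by
    have := Int.floor_le (t / L)
    rw [le_div_iff₀ hL] at this
    rw [hs]; linarith
  have hsL : s < L := by
    have := Int.lt_floor_add_one (t / L)
    rw [div_lt_iff₀ hL] at this
    rw [hs]; linarith
  have hw := antiperiodic_add_int_mul h.anti_w s k
  have hw' := antiperiodic_add_int_mul h.anti_w' s k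
  have hz := antiperiodic_add_int_mul h.anti_z s k
  have hz' := antiperiodic_add_int_mul h.anti_z' s k
  rw [← hst] at hw hw' hz hz'
  rcases hs0.eq_or_lt with h0 | h0
  · right; right
    rw [← h0] at hw hw' hz hz'
    refine ⟨⟨k, by linarith⟩, by rw [hw, h.w_zero, mul_zero], by rw [hz, h.z_zero, mul_zero], ?_, ?_⟩
    · rw [hw']
      exact mul_ne_zero (zpow_ne_zero _ (by norm_num)) h.w'_pos.ne'
    · rw [hz']
      exact mul_ne_zero (zpow_ne_zero _ (by norm_num)) h.z'_pos.ne'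
  · have p1 := h.w_pos s ⟨h0, hsL⟩
    have p2 := h.z_pos s ⟨h0, hsL⟩
    rcases Int.even_or_odd k with he | he
    · rw [he.neg_one_zpow, one_mul] at hw hz
      left; rw [hw, hz]; exact ⟨p1, p2⟩
    · rw [he.neg_one_zpow, neg_one_mul] at hw hz
      right; left; rw [hw, hz]; exact ⟨neg_neg_of_pos p1, neg_neg_of_pos p2⟩

theorem IsAntiSol.w_eq_zero_iff {p' q lam L : ℝ} (hL : 0 < L) {w w' z z' : ℝ → ℝ}
    (h : IsAntiSol p' q lam L w w' z z') (t : ℝ) : w t = 0 ↔ ∃ k : ℤ, t = k * L := by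
  constructor
  · intro ht
    rcases h.trichotomy hL t with h1 | h1 | h1
    · exact absurd ht h1.1.ne'
    · exact absurd ht h1.1.ne
    · exact h1.1
  · rintro ⟨k, rfl⟩
    have := antiperiodic_add_int_mul h.anti_w 0 k
    rw [zero_add, h.w_zero, mul_zero] at this
    exact this

theorem IsAntiSol.encard_zeros {p' q lam L : ℝ} (hL : 0 < L) {w w' z z' : ℝ → ℝ}
    (h : IsAntiSol p' q lam L w w' z z') {m : ℕ} (hm : 1 ≤ m) :
    {t ∈ Ioo 0 (m * L) | w t = 0}.encard + 1 = m := by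
  have hinj : Function.Injective fun k : ℕ => (k : ℝ) * L := fun a b hab => by
    have := mul_right_cancel₀ hL.ne' hab
    exact_mod_cast this
  have : {t ∈ Ioo 0 (m * L) | w t = 0} =
      (fun k : ℕ => (k : ℝ) * L) '' (Finset.Ioo 0 m : Finset ℕ) := by
    ext t
    simp only [mem_ofPred_eq, mem_Ioo, mem_image, Finset.coe_Ioo, h.w_eq_zero_iff hL]
    constructor
    · rintro ⟨⟨h0, h1⟩, k, rfl⟩
      have k0 : (0 : ℝ) < k := pos_of_mul_pos_left h0 hL.le
      have k1 : (k : ℝ) < m := lt_of_mul_lt_mul_right h1 hL.le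
      have k0' : 0 < k := by exact_mod_cast k0
      lift k to ℕ using k0'.le
      refine ⟨k, ⟨by exact_mod_cast k0', by exact_mod_cast k1⟩, by simp⟩
    · rintro ⟨k, ⟨h0, h1⟩, rfl⟩
      have h0' : (0 : ℝ) < k := by exact_mod_cast h0
      have h1' : (k : ℝ) < m := by exact_mod_cast h1
      exact ⟨⟨by positivity, mul_lt_mul_of_pos_right h1' hL⟩, k, by simp⟩
  rw [this, hinj.encard_image, encard_coe_eq_coe_finsetCard, Nat.card_Ioo]
  norm_cast
  omega

/-- A solution on `[0, T]` with zero boundary values is the antiperiodic solution with the same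
initial slope. -/
theorem IsAntiSol.eqOn_of_isSol {p' q lam L T : ℝ} (hp' : 1 < p') (hq : 1 < q) (hlam : 0 < lam)
    (hL : 0 < L) (hT : 0 < T) {w w' z z' u u' v v' : ℝ → ℝ}
    (h : IsAntiSol p' q lam L w w' z z') (k : IsSol p' q lam (Icc 0 T) u u' v v')
    (u0 : u 0 = 0) (v0 : v 0 = 0) (uT : u T = 0) (vT : v T = 0) (e : u' 0 = w' 0) :
    ∀ t ∈ Icc 0 T, u t = w t ∧ u' t = w' t ∧ v t = z t ∧ v' t = z' t := by
  have h' := h.toIsSol.mono (subset_univ (Icc 0 T))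
  have e0 : u 0 = w 0 := by rw [u0, h.w_zero]
  have e1 : v 0 = z 0 := by rw [v0, h.z_zero]
  have htri := h.trichotomy hL T
  -- If the slopes differed, comparison at T, where u and v vanish, would give w and z incompatible
  -- signs: z > 0 with w ≤ 0, or z < 0 with w ≥ 0.
  have hv : v' 0 = z' 0 := by
    rcases lt_trichotomy (v' 0) (z' 0) with hlt | heq | hlt
    · obtain ⟨k1, k2⟩ := k.compare hp' hq hlam hT h' e0 e1 e hlt
      rw [vT] at k1
      rw [uT] at k2
      rcases htri with h1 | h1 | h1
      · linarith [h1.1]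
      · linarith [h1.2]
      · linarith [h1.2.2.1]
    · exact heq
    · obtain ⟨k1, k2⟩ := h'.compare hp' hq hlam hT k e0.symm e1.symm e.symm hlt
      rw [vT] at k1
      rw [uT] at k2
      rcases htri with h1 | h1 | h1
      · linarith [h1.2]
      · linarith [h1.1]
      · linarith [h1.2.2.1]
  refine k.agree hp' hq hlam h' e0 e e1 hv fun t _ => ?_
  rcases h.trichotomy hL t with h1 | h1 | h1
  · exact ⟨Or.inl h1.1.ne', Or.inl h1.2.ne'⟩
  · exact ⟨Or.inl h1.1.ne, Or.inl h1.2.ne⟩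
  · exact ⟨Or.inr h1.2.2.2.1, Or.inr h1.2.2.2.2⟩

/-! ### Spectral couples as solutions of the system -/

theorem contDiffOn_two_hasDerivWithinAt {f : ℝ → ℝ} {T : ℝ} (hT : 0 < T)
    (hf : ContDiffOn ℝ 2 f (Icc 0 T)) {t : ℝ} (ht : t ∈ Icc 0 T) :
    HasDerivWithinAt f (derivWithin f (Icc 0 T) t) (Icc 0 T) t ∧
      HasDerivWithinAt (derivWithin f (Icc 0 T)) (secondDeriv T f t) (Icc 0 T) t := by
  have hu : UniqueDiffOn ℝ (Icc 0 T) := uniqueDiffOn_Icc hT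
  refine ⟨((hf.differentiableOn (by norm_num)) t ht).hasDerivWithinAt, ?_⟩
  have h1 : DifferentiableOn ℝ (iteratedDerivWithin 1 f (Icc 0 T)) (Icc 0 T) :=
    hf.differentiableOn_iteratedDerivWithin (by norm_num) hu
  have e : EqOn (iteratedDerivWithin 1 f (Icc 0 T)) (derivWithin f (Icc 0 T)) (Icc 0 T) :=
    fun x _ => by rw [iteratedDerivWithin_one]
  have h2 := (h1 t ht).hasDerivWithinAt
  rw [secondDeriv, iteratedDerivWithin_succ]
  exact h2.congr (fun x hx => (e hx).symm) (e ht).symm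

theorem secondDeriv_eqOn {f f' f'' : ℝ → ℝ} {T : ℝ} (hT : 0 < T)
    (h1 : ∀ t ∈ Icc 0 T, HasDerivWithinAt f (f' t) (Icc 0 T) t)
    (h2 : ∀ t ∈ Icc 0 T, HasDerivWithinAt f' (f'' t) (Icc 0 T) t) :
    EqOn (secondDeriv T f) f'' (Icc 0 T) := by
  have hu : UniqueDiffOn ℝ (Icc 0 T) := uniqueDiffOn_Icc hT
  have e1 : EqOn (derivWithin f (Icc 0 T)) f' (Icc 0 T) := fun t ht =>
    (h1 t ht).derivWithin (hu t ht)
  intro t ht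
  rw [secondDeriv, iteratedDerivWithin_succ]
  have e : EqOn (iteratedDerivWithin 1 f (Icc 0 T)) f' (Icc 0 T) :=
    fun x hx => by rw [iteratedDerivWithin_one, e1 hx]
  rw [derivWithin_congr e (e ht)]
  exact (h2 t ht).derivWithin (hu t ht)

theorem contDiffOn_two_of_hasDerivWithinAt {f f' f'' : ℝ → ℝ} {T : ℝ} (hT : 0 < T)
    (h1 : ∀ t ∈ Icc 0 T, HasDerivWithinAt f (f' t) (Icc 0 T) t)
    (h2 : ∀ t ∈ Icc 0 T, HasDerivWithinAt f' (f'' t) (Icc 0 T) t)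
    (h3 : ContinuousOn f'' (Icc 0 T)) : ContDiffOn ℝ 2 f (Icc 0 T) := by
  have hu : UniqueDiffOn ℝ (Icc 0 T) := uniqueDiffOn_Icc hT
  have key : ∀ {n : WithTop ℕ∞} {g g' : ℝ → ℝ}, n ≠ ω →
      (∀ t ∈ Icc 0 T, HasDerivWithinAt g (g' t) (Icc 0 T) t) → ContDiffOn ℝ n g' (Icc 0 T) →
      ContDiffOn ℝ (n + 1) g (Icc 0 T) := by
    intro n g g' hn hg hg'
    rw [contDiffOn_succ_iff_derivWithin hu]
    exact ⟨fun t ht => (hg t ht).differentiableWithinAt, fun h => absurd h hn,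
      hg'.congr fun t ht => (hg t ht).derivWithin (hu t ht)⟩
  have a0 : ContDiffOn ℝ 0 f'' (Icc 0 T) := contDiffOn_zero.2 h3
  have a1 := key (by simp) h2 a0
  rw [zero_add] at a1
  have a2 := key (by simp) h1 a1
  rwa [one_add_one_eq_two] at a2

theorem IsEigenpair.isSol {p p' q T lam : ℝ} (hpp : p.HolderConjugate p') (hT : 0 < T)
    {u : ℝ → ℝ} (h : IsEigenpair p q T u lam) :
    IsSol p' q lam (Icc 0 T) u (derivWithin u (Icc 0 T)) (fun t => -spow (secondDeriv T u t) p)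
      (fun t => -derivWithin (fun t => spow (secondDeriv T u t) p) (Icc 0 T) t) where
  du t ht := (contDiffOn_two_hasDerivWithinAt hT h.contDiffOn ht).1
  du' t ht := by
    rw [spow_neg, spow_spow hpp, neg_neg]
    exact (contDiffOn_two_hasDerivWithinAt hT h.contDiffOn ht).2
  dv t ht := (contDiffOn_two_hasDerivWithinAt hT h.contDiffOn_spow ht).1.neg
  dv' t ht := by
    rw [← h.eqn t ht]
    exact (contDiffOn_two_hasDerivWithinAt hT h.contDiffOn_spow ht).2.neg

theorem IsSol.continuousOn_u {p' q lam : ℝ} {D : Set ℝ} {u u' v v' : ℝ → ℝ}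
    (h : IsSol p' q lam D u u' v v') : ContinuousOn u D :=
  fun t ht => (h.du t ht).continuousWithinAt

theorem IsSol.continuousOn_v {p' q lam : ℝ} {D : Set ℝ} {u u' v v' : ℝ → ℝ}
    (h : IsSol p' q lam D u u' v v') : ContinuousOn v D :=
  fun t ht => (h.dv t ht).continuousWithinAt

theorem IsSol.secondDeriv_eqOn {p' q lam T : ℝ} (hT : 0 < T) {u u' v v' : ℝ → ℝ}
    (h : IsSol p' q lam (Icc 0 T) u u' v v') :
    EqOn (secondDeriv T u) (fun t => -spow (v t) p') (Icc 0 T) :=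
  Biharmonic.secondDeriv_eqOn hT h.du h.du'

theorem IsSol.isEigenpair {p p' q T lam : ℝ} (hpp : p.HolderConjugate p') (hq : 1 < q)
    (hT : 0 < T) (hlam : 0 < lam) {u u' v v' : ℝ → ℝ} (h : IsSol p' q lam (Icc 0 T) u u' v v')
    (hne : ∃ t ∈ Icc 0 T, u t ≠ 0) (u0 : u 0 = 0) (uT : u T = 0) (v0 : v 0 = 0) (vT : v T = 0) :
    IsEigenpair p q T u lam := by
  have hp' := hpp.symm.lt
  have e1 := h.secondDeriv_eqOn hT
  have e2 : EqOn (fun t => spow (secondDeriv T u t) p) (fun t => -v t) (Icc 0 T) := fun t ht => by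
    simp only
    rw [e1 ht, spow_neg, spow_spow hpp.symm]
  have c1 : ContinuousOn (fun t => -spow (v t) p') (Icc 0 T) :=
    ((continuous_spow hp').comp_continuousOn h.continuousOn_v).neg
  have c2 : ContinuousOn (fun t => lam * spow (u t) q) (Icc 0 T) :=
    continuousOn_const.mul ((continuous_spow hq).comp_continuousOn h.continuousOn_u)
  have d1 : ∀ t ∈ Icc 0 T, HasDerivWithinAt (fun t => spow (secondDeriv T u t) p) (-v' t)
      (Icc 0 T) t := fun t ht => (h.dv t ht).neg.congr e2 (e2 ht)
  have d2 : ∀ t ∈ Icc 0 T, HasDerivWithinAt (fun t => -v' t) (lam * spow (u t) q)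
      (Icc 0 T) t := fun t ht => by
    simpa only [neg_neg] using (h.dv' t ht).fun_neg
  exact
  { lam_pos := hlam
    ne_zero := hne
    contDiffOn := contDiffOn_two_of_hasDerivWithinAt hT h.du h.du' c1
    contDiffOn_spow := contDiffOn_two_of_hasDerivWithinAt hT d1 d2 c2
    eqn := Biharmonic.secondDeriv_eqOn hT d1 d2
    left := u0
    right := uT
    left_second := by
      rw [e1 (left_mem_Icc.2 hT.le)]; simp [v0, spow_zero]
    right_second := by
      rw [e1 (right_mem_Icc.2 hT.le)]; simp [vT, spow_zero] }

theorem eLpNorm_eq_one_iff {p T : ℝ} (hp : 1 < p) (hT : 0 < T) {f : ℝ → ℝ}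
    (hf : ContinuousOn f (Icc 0 T)) :
    eLpNorm f (ENNReal.ofReal p) (segMeasure T) = 1 ↔ ∫ t in (0 : ℝ)..T, |f t| ^ p = 1 := by
  have hp0 : 0 < p := by linarith
  have h0 : 0 ≤ ∫ t in (0 : ℝ)..T, |f t| ^ p := intervalIntegral.integral_nonneg hT.le
    fun t _ => Real.rpow_nonneg (abs_nonneg _) _
  rw [MemLp.eLpNorm_eq_integral_rpow_norm (by simpa using hp0) (by simp) (continuousOn_memLp p hf),
    ENNReal.toReal_ofReal hp0.le, integral_segMeasure hT]
  simp only [Real.norm_eq_abs]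
  rw [ENNReal.ofReal_eq_one, Real.rpow_inv_eq h0 zero_le_one hp0.ne', Real.one_rpow]

theorem integral_scaled_period {f : ℝ → ℝ} (hf : Function.Periodic f 1) (hfc : Continuous f) {c : ℝ}
    (hc : 0 < c) (n : ℕ) : ∫ t in (0 : ℝ)..n * c, f (t / c) = n * c * ∫ t in (0 : ℝ)..1, f t := by
  rw [intervalIntegral.integral_comp_div _ hc.ne', zero_div, mul_div_cancel_right₀ _ hc.ne']
  have := hf.intervalIntegral_add_zsmul_eq n 0 fun a b => hfc.intervalIntegrable a b
  simp only [zero_add, natCast_zsmul, nsmul_eq_mul, mul_one] at this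
  rw [this, smul_eq_mul]
  ring

/-- The amplitude a = c² T^{-1/p} is the one for which (a/c²)^p T = 1; it normalizes the second
derivative of the rescaled reference solution in L^p([0, T]) when T is a multiple of c. -/
theorem spectral_factor {p q T c : ℝ} (hT : 0 < T) (hc : 0 < c) :
    (c ^ 2 * T ^ (-1 / p)) ^ (p - q) * c ^ (-2 * p) = c ^ (-2 * q) * T ^ (-(p - q) / p) := by
  rw [Real.mul_rpow (by positivity) (by positivity), ← Real.rpow_natCast c 2, ← Real.rpow_mul hc.le,
    ← Real.rpow_mul hT.le, mul_right_comm, ← Real.rpow_add hc]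
  congr 2
  · push_cast; ring
  · ring

theorem IsAntiSol.abs_spow_periodic {p' q lam L r s : ℝ} {w w' z z' : ℝ → ℝ}
    (h : IsAntiSol p' q lam L w w' z z') : Function.Periodic (fun t => |spow (z t) r| ^ s) L := by
  intro t
  simp only
  rw [h.anti_z t, spow_neg, abs_neg]

theorem IsAntiSol.continuous_w {p' q lam L : ℝ} {w w' z z' : ℝ → ℝ}
    (h : IsAntiSol p' q lam L w w' z z') : Continuous w :=
  continuousOn_univ.1 h.toIsSol.continuousOn_u

theorem IsAntiSol.continuous_z {p' q lam L : ℝ} {w w' z z' : ℝ → ℝ}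
    (h : IsAntiSol p' q lam L w w' z z') : Continuous z :=
  continuousOn_univ.1 h.toIsSol.continuousOn_v

theorem IsAntiSol.continuous_abs_spow {p' q lam L r s : ℝ} (hr : 1 < r) (hs : 0 ≤ s)
    {w w' z z' : ℝ → ℝ} (h : IsAntiSol p' q lam L w w' z z') :
    Continuous fun t => |spow (z t) r| ^ s :=
  (Real.continuous_rpow_const hs).comp ((continuous_spow hr).comp h.continuous_z).abs

theorem IsAntiSol.integral_scaled {p p' q lam a c : ℝ} (hpp : p.HolderConjugate p')
    (ha : 0 < a) (hc : 0 < c) {w w' z z' : ℝ → ℝ} (h : IsAntiSol p' q lam 1 w w' z z')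
    (hn : ∫ t in (0 : ℝ)..1, |spow (z t) p'| ^ p = 1) (n : ℕ) :
    ∫ t in (0 : ℝ)..n * c, |spow ((a / c ^ 2) ^ (p - 1) * z (t / c)) p'| ^ p =
      (a / c ^ 2) ^ p * (n * c) := by
  have hac : 0 < a / c ^ 2 := by positivity
  have e : (p - 1) * (p' - 1) = 1 := by linarith [hpp.mul_eq_add]
  have : ∀ t, |spow ((a / c ^ 2) ^ (p - 1) * z (t / c)) p'| ^ p =
      (a / c ^ 2) ^ p * |spow (z (t / c)) p'| ^ p := by
    intro t
    rw [spow_mul hpp.symm.lt (by positivity), ← Real.rpow_mul hac.le, e, Real.rpow_one, abs_mul,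
      abs_of_pos hac, Real.mul_rpow hac.le (abs_nonneg _)]
  simp only [this, intervalIntegral.integral_const_mul]
  have h2 := integral_scaled_period (f := fun t => |spow (z t) p'| ^ p) h.abs_spow_periodic
    (h.continuous_abs_spow hpp.symm.lt hpp.pos.le) hc n
  rw [hn, mul_one] at h2
  rw [h2]

/-- The `n`-th spectral number in terms of the first one on `[0, 1]`. -/
theorem isSpectralNumber_iff {p p' q lam₁ : ℝ} (hpp : p.HolderConjugate p') (hq : 1 < q)
    (hlam₁ : 0 < lam₁) {w w' z z' : ℝ → ℝ} (h : IsAntiSol p' q lam₁ 1 w w' z z')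
    (hn : ∫ t in (0 : ℝ)..1, |spow (z t) p'| ^ p = 1) {T : ℝ} (hT : 0 < T) {n : ℕ} (h1n : 1 ≤ n)
    (lam : ℝ) : IsSpectralNumber p q T n lam ↔
      lam = lam₁ * ((T / n) ^ (-2 * q) * T ^ (-(p - q) / p)) := by
  have hp := hpp.lt
  have hp0 : 0 < p := by linarith
  have hp' := hpp.symm.lt
  have hn0 : (0 : ℝ) < n := by exact_mod_cast h1n
  constructor
  · rintro ⟨f, hf, hcard⟩
    have hsol := hf.toIsEigenpair.isSol hpp hT
    -- The reference solution is rescaled to the eigenvalue and initial slope of f, hence coincides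
    -- with f on [0, T].
    obtain ⟨a, c, ha, hc, hl, hac⟩ := exists_scale (p := p) (q := q) hp0 (by linarith) hlam₁
      hf.lam_pos (div_pos hf.deriv_pos h.w'_pos)
    have hs := h.scale hpp hq ha hc (a := a) (c := c)
    rw [hl, mul_one] at hs
    have hag := hs.eqOn_of_isSol hp' hq hf.lam_pos hc hT hsol hf.left
      (by simp [hf.left_second, spow_zero]) hf.right (by simp [hf.right_second, spow_zero])
      (by rw [hac, zero_div, div_mul_cancel₀ _ h.w'_pos.ne'])
    have hTm := (hag T (right_mem_Icc.2 hT.le)).1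
    rw [hf.right] at hTm
    -- Vanishing at T makes T a multiple of c, and counting the interior zeros identifies the
    -- multiple as n. The normalization then determines a, and with it λ.
    obtain ⟨k, hk⟩ := (hs.w_eq_zero_iff hc T).1 hTm.symm
    have hk0 : (0 : ℝ) < k := pos_of_mul_pos_left (hk ▸ hT) hc.le
    have hk0' : 0 < k := by exact_mod_cast hk0
    lift k to ℕ using hk0'.le
    rw [Int.cast_natCast] at hk
    have hset : {t ∈ Ioo 0 T | f t = 0} = {t ∈ Ioo 0 (k * c) | a * w (t / c) = 0} := by
      rw [← hk]
      ext t
      refine and_congr_right fun ht => ?_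
      rw [(hag t (Ioo_subset_Icc_self ht)).1]
    have hkn : (k : ℕ∞) = n := by
      rw [← hcard, hset]
      exact (hs.encard_zeros hc (by exact_mod_cast hk0')).symm
    have hkn' : k = n := by exact_mod_cast hkn
    subst hkn'
    have hnorm := hf.norm_eq_one
    have e2 := hsol.secondDeriv_eqOn hT
    have c2 : ContinuousOn (secondDeriv T f) (Icc 0 T) :=
      ((continuous_spow hp').comp_continuousOn hsol.continuousOn_v).neg.congr e2
    rw [eLpNorm_eq_one_iff hp hT c2] at hnorm
    have e3 : ∫ t in (0 : ℝ)..T, |secondDeriv T f t| ^ p =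
        ∫ t in (0 : ℝ)..T, |spow ((a / c ^ 2) ^ (p - 1) * z (t / c)) p'| ^ p := by
      apply intervalIntegral.integral_congr
      intro t ht
      rw [uIcc_of_le hT.le] at ht
      simp only
      rw [e2 ht]
      simp only
      rw [abs_neg, (hag t ht).2.2.1]
    rw [e3, hk, h.integral_scaled hpp ha hc hn, ← hk] at hnorm
    have hcT : c = T / k := by rw [hk]; field_simp
    have haT : a = c ^ 2 * T ^ (-1 / p) := by
      have h3 : a / c ^ 2 = T ^ (-1 / p) := by
        have h4 : (a / c ^ 2) ^ p = T⁻¹ := eq_inv_of_mul_eq_one_left hnorm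
        rw [neg_div, Real.rpow_neg hT.le, ← Real.inv_rpow hT.le, ← h4, ← Real.rpow_mul
          (by positivity), mul_one_div_cancel hp0.ne', Real.rpow_one]
      rw [← h3]; field_simp
    rw [← hl, mul_assoc, haT, spectral_factor hT hc, hcT]
  · intro hl
    set c : ℝ := T / n with hcdef
    have hc : 0 < c := by positivity
    have hTc : T = n * c := by rw [hcdef]; field_simp
    -- Conversely, c = T / n places the n-th zero at T, and this amplitude gives norm one.
    set a : ℝ := c ^ 2 * T ^ (-1 / p) with hadef
    have ha : 0 < a := by positivity
    have hs := h.scale hpp hq ha hc (a := a) (c := c)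
    have hlpos : 0 < lam := by rw [hl]; positivity
    rw [mul_assoc, hadef, spectral_factor hT hc, ← hl, mul_one, ← hadef] at hs
    have hsol := hs.toIsSol.mono (subset_univ (Icc 0 T))
    have wT : a * w (T / c) = 0 := (hs.w_eq_zero_iff hc T).2 ⟨n, by rw [hTc]; simp⟩
    have zT : (a / c ^ 2) ^ (p - 1) * z (T / c) = 0 := by
      rcases hs.trichotomy hc T with h1 | h1 | h1
      · exact absurd wT h1.1.ne'
      · exact absurd wT h1.1.ne
      · exact h1.2.2.1
    have hm : c / 2 ∈ Icc 0 T := ⟨by linarith, by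
      rw [hTc]
      have : (1 : ℝ) ≤ n := by exact_mod_cast h1n
      nlinarith⟩
    have heig := hsol.isEigenpair hpp hq hT hlpos
      ⟨c / 2, hm, (hs.w_pos _ ⟨by linarith, by linarith⟩).ne'⟩ hs.w_zero wT hs.z_zero zT
    have e2 := hsol.secondDeriv_eqOn hT
    refine ⟨fun t => a * w (t / c), { toIsEigenpair := heig, norm_eq_one := ?_, deriv_pos := ?_ }, ?_⟩
    · have c2 : ContinuousOn (secondDeriv T fun t => a * w (t / c)) (Icc 0 T) :=
        ((continuous_spow hp').comp_continuousOn hsol.continuousOn_v).neg.congr e2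
      rw [eLpNorm_eq_one_iff hp hT c2]
      have e3 : ∫ t in (0 : ℝ)..T, |secondDeriv T (fun t => a * w (t / c)) t| ^ p =
          ∫ t in (0 : ℝ)..T, |spow ((a / c ^ 2) ^ (p - 1) * z (t / c)) p'| ^ p := by
        apply intervalIntegral.integral_congr
        intro t ht
        rw [uIcc_of_le hT.le] at ht
        simp only
        rw [e2 ht]
        simp only
        rw [abs_neg]
      rw [e3]
      nth_rewrite 1 [hTc]
      rw [h.integral_scaled hpp ha hc hn, ← hTc]
      have : a / c ^ 2 = T ^ (-1 / p) := by rw [hadef]; field_simp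
      rw [this, ← Real.rpow_mul hT.le, div_mul_cancel₀ _ hp0.ne', Real.rpow_neg_one,
        inv_mul_cancel₀ hT.ne']
    · rw [(hsol.du 0 (left_mem_Icc.2 hT.le)).derivWithin
        (uniqueDiffOn_Icc hT 0 (left_mem_Icc.2 hT.le))]
      exact hs.w'_pos
    · have := hs.encard_zeros hc h1n
      rwa [← hTc] at this

/-! ### The sharp inequality on a segment -/

theorem IsPosSol.isSpectralNumber_one {p p' q L lam : ℝ} (hpp : p.HolderConjugate p') (hq : 1 < q)
    (hL : 0 < L) (hlam : 0 < lam) {u u' v v' : ℝ → ℝ} (h : IsPosSol p' q lam L u u' v v')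
    (hn : ∫ t in (0 : ℝ)..L, |spow (v t) p'| ^ p = 1) : IsSpectralNumber p q L 1 lam := by
  have hm : L / 2 ∈ Ioo 0 L := ⟨by linarith, by linarith⟩
  have e := h.toIsSol.secondDeriv_eqOn hL
  refine ⟨u, { toIsEigenpair := h.toIsSol.isEigenpair hpp hq hL hlam
                ⟨L / 2, Ioo_subset_Icc_self hm, (h.u_pos _ hm).ne'⟩ h.u_left h.u_right h.v_left
                h.v_right, norm_eq_one := ?_, deriv_pos := ?_ }, ?_⟩
  · have c : ContinuousOn (secondDeriv L u) (Icc 0 L) :=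
      ((continuous_spow hpp.symm.lt).comp_continuousOn h.continuousOn_v).neg.congr e
    rw [eLpNorm_eq_one_iff hpp.lt hL c, ← hn]
    apply intervalIntegral.integral_congr
    intro t ht
    rw [uIcc_of_le hL.le] at ht
    simp only
    rw [e ht]
    simp only
    rw [abs_neg]
  · rw [(h.du 0 (left_mem_Icc.2 hL.le)).derivWithin
      (uniqueDiffOn_Icc hL 0 (left_mem_Icc.2 hL.le))]
    exact h.u'_pos hpp.symm.lt hL
  · have : {t ∈ Ioo 0 L | u t = 0} = ∅ := by
      ext t
      simp only [mem_ofPred_eq, mem_empty_iff_false, iff_false, not_and]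
      exact fun ht => (h.u_pos t ht).ne'
    rw [this]
    simp

/-- The sharp inequality `‖u‖_q ≤ lam^{-1/q} ‖u''‖_p` on `[0, L]`. -/
theorem integral_green_rpow_le_sharp {p p' q lam₁ : ℝ} (hpp : p.HolderConjugate p') (hq : 1 < q)
    (hlam₁ : 0 < lam₁) {w w' z z' : ℝ → ℝ} (h : IsAntiSol p' q lam₁ 1 w w' z z')
    (hn : ∫ t in (0 : ℝ)..1, |spow (z t) p'| ^ p = 1) {L : ℝ} (hL : 0 < L) {g : ℝ → ℝ}
    (hg : MemLp g (ENNReal.ofReal p) (segMeasure L)) :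
    ∫ t in (0 : ℝ)..L, |green L g t| ^ q ≤
      (lam₁ * (L ^ (-2 * q) * L ^ (-(p - q) / p)))⁻¹ *
        (∫ t in (0 : ℝ)..L, |g t| ^ p) ^ (q / p) := by
  obtain ⟨Q, u, u', v, v', hQ, hpos, -, hv, hle⟩ := exists_extremal (L := L) hpp hq hL
  -- The extremal is itself a spectral couple without interior zeros, so uniqueness of the first
  -- spectral number determines the optimal constant Q.
  have h1 := hpos.isSpectralNumber_one hpp hq hL (by positivity) hv
  have h2 := (isSpectralNumber_iff hpp hq hlam₁ h hn hL le_rfl _).1 h1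
  rw [Nat.cast_one, div_one, one_div] at h2
  rw [← h2, inv_inv]
  exact hle g hg

/-! ### Norms and representatives -/

theorem LSeg.norm_rpow_eq {p T : ℝ} (hp : 1 < p) (hT : 0 < T) (f : LSeg p T) :
    ‖f‖ ^ p = ∫ t in (0 : ℝ)..T, |f t| ^ p := by
  have hp0 : 0 < p := by linarith
  have h0 : 0 ≤ ∫ t in (0 : ℝ)..T, |f t| ^ p := intervalIntegral.integral_nonneg hT.le
    fun t _ => Real.rpow_nonneg (abs_nonneg _) _
  rw [Lp.norm_def, MemLp.eLpNorm_eq_integral_rpow_norm (by simpa using hp0) (by simp) (Lp.memLp f),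
    ENNReal.toReal_ofReal hp0.le, integral_segMeasure hT]
  simp only [Real.norm_eq_abs]
  rw [ENNReal.toReal_ofReal (Real.rpow_nonneg h0 _), Real.rpow_inv_rpow h0 hp0.ne']

theorem LSeg.norm_rpow_eq_of_ae {p T : ℝ} (hp : 1 < p) (hT : 0 < T) (f : LSeg p T) {g : ℝ → ℝ}
    (h : f =ᵐ[segMeasure T] g) : ‖f‖ ^ p = ∫ t in (0 : ℝ)..T, |g t| ^ p := by
  rw [LSeg.norm_rpow_eq hp hT]
  apply intervalIntegral.integral_congr_ae
  refine ae_interval_of_ae_seg hT ?_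
  filter_upwards [h] with t ht
  rw [ht]

theorem integral_abs_le_norm {p p' T : ℝ} [Fact (1 < p)] (hpp : p.HolderConjugate p') (hT : 0 < T)
    (f : LSeg p T) : ∫ t in (0 : ℝ)..T, |f t| ≤ T ^ (1 / p') * ‖f‖ := by
  have h := integral_mul_le_of_nonneg hpp hT (f := fun t => |f t|) (g := fun _ => 1)
    (fun t _ => abs_nonneg _) (fun _ _ => zero_le_one) (Lp.memLp f).abs (memLp_const 1)
  simp only [mul_one, Real.one_rpow, intervalIntegral.integral_const, sub_zero, smul_eq_mul] at h
  rw [← LSeg.norm_rpow_eq hpp.lt hT, ← Real.rpow_mul (norm_nonneg _),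
    mul_one_div_cancel hpp.pos.ne', Real.rpow_one, mul_comm] at h
  exact h

section PointEval

variable {p T : ℝ} [hp : Fact (1 < p)] [hT : Fact (0 < T)]

theorem W2D.fn_ae_eq (u : W2D p T) :
    W2D.fn p T u =ᵐ[segMeasure T] fun t => -green T (W2D.d2 p T u) t := by
  obtain ⟨a, -, h2, h3⟩ := u.repr
  have hgi := LSeg.intervalIntegrable hp.out hT.out (W2D.d2 p T u)
  have hn : IntervalIntegrable (fun s => (-1) * W2D.d2 p T u s) volume 0 T := hgi.const_mul (-1)
  have key := eq_green (u := fun t => ∫ r in (0 : ℝ)..t, (a + ∫ s in (0 : ℝ)..r, W2D.d2 p T u s))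
    (u' := fun r => a + ∫ s in (0 : ℝ)..r, W2D.d2 p T u s) hT.out hn (a := a)
    (fun t _ => by rw [intervalIntegral.integral_const_mul]; ring) (fun t _ => rfl) h3
  filter_upwards [h2, ae_restrict_mem measurableSet_Icc] with t ht hm
  rw [ht, key t hm, green_const_mul]
  ring

/-- Evaluation of the continuous representative at a point of `[0, T]`. -/
noncomputable def pointEval (p : ℝ) {T : ℝ} [hp : Fact (1 < p)] [hT : Fact (0 < T)] {t : ℝ}
    (ht : t ∈ Icc 0 T) : W2D p T →L[ℝ] ℝ :=
  LinearMap.mkContinuousOfExistsBound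
    { toFun := fun u => -green T (W2D.d2 p T u) t
      map_add' := fun u v => by
        have ii := fun u => LSeg.intervalIntegrable hp.out hT.out (W2D.d2 p T u)
        rw [map_add, green_congr_ae hT.out (Lp.coeFn_add _ _) ht]
        have := green_add hT.out (ii u) (ii v) ht
        simp only [Pi.add_def]
        rw [this]; ring
      map_smul' := fun a u => by
        rw [map_smul, green_congr_ae hT.out (Lp.coeFn_smul _ _) ht]
        have := green_const_mul T a (W2D.d2 p T u) t
        simp only [Pi.smul_def, smul_eq_mul, RingHom.id_apply]
        rw [this]; ring }
    (by
      have hpp := Real.HolderConjugate.conjExponent hp.out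
      refine ⟨2 * T * T ^ (1 / p.conjExponent), fun u => ?_⟩
      have ii := LSeg.intervalIntegrable hp.out hT.out (W2D.d2 p T u)
      have h1 := abs_green_le hT.out ii ht
      have h2 := integral_abs_le_norm hpp hT.out (W2D.d2 p T u)
      have T0 := hT.out
      simp only [LinearMap.coe_mk, AddHom.coe_mk, norm_neg, Real.norm_eq_abs, W2D.norm_eq]
      refine h1.trans ?_
      rw [mul_assoc (2 * T)]
      exact mul_le_mul_of_nonneg_left h2 (by positivity))

theorem pointEval_apply {t : ℝ} (ht : t ∈ Icc 0 T) (u : W2D p T) :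
    pointEval p ht u = -green T (W2D.d2 p T u) t := rfl

end PointEval

/-! ### Piecewise linear interpolation -/

/-- Taylor's formula at a: value, slope times s, and the double primitive of the shifted function as
remainder. -/
theorem dblInt_shift {g : ℝ → ℝ} {T a s : ℝ} (hT : 0 < T) (hg : IntervalIntegrable g volume 0 T)
    (ha : 0 ≤ a) (hs : 0 ≤ s) (has : a + s ≤ T) :
    dblInt g (a + s) = dblInt g a + s * (∫ r in (0 : ℝ)..a, g r) +
      dblInt (fun r => g (a + r)) s := by
  have hI := continuousOn_intervalIntegrable hT (continuousOn_integral_Icc hT hg)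
  have ma : a ∈ Icc 0 T := ⟨ha, by linarith⟩
  have mas : a + s ∈ Icc 0 T := ⟨by linarith, has⟩
  have e1 : dblInt g (a + s) - dblInt g a = ∫ r in a..a + s, ∫ x in (0 : ℝ)..r, g x :=
    intervalIntegral.integral_interval_sub_left (intervalIntegrable_left hI mas)
      (intervalIntegrable_left hI ma)
  have e2 : ∫ r in a..a + s, ∫ x in (0 : ℝ)..r, g x =
      ∫ r in (0 : ℝ)..s, ∫ x in (0 : ℝ)..a + r, g x := by
    rw [intervalIntegral.integral_comp_add_left (fun r => ∫ x in (0 : ℝ)..r, g x), add_zero]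
  have e3 : ∀ r ∈ Icc 0 s, ∫ x in (0 : ℝ)..a + r, g x =
      (∫ x in (0 : ℝ)..a, g x) + ∫ x in (0 : ℝ)..r, g (a + x) := by
    intro r hr
    have mar : a + r ∈ Icc 0 T := ⟨by linarith [hr.1], by linarith [hr.2]⟩
    rw [intervalIntegral.integral_comp_add_left g, add_zero,
      intervalIntegral.integral_add_adjacent_intervals (intervalIntegrable_left hg ma)]
    exact (intervalIntegrable_left hg ma).symm.trans (intervalIntegrable_left hg mar)
  have e4 : ∫ r in (0 : ℝ)..s, ∫ x in (0 : ℝ)..a + r, g x =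
      ∫ r in (0 : ℝ)..s, ((∫ x in (0 : ℝ)..a, g x) + ∫ x in (0 : ℝ)..r, g (a + x)) := by
    apply intervalIntegral.integral_congr
    intro r hr
    rw [uIcc_of_le hs] at hr
    exact e3 r hr
  have hgs : IntervalIntegrable (fun x => g (a + x)) volume 0 s := by
    have h := ((intervalIntegrable_left hg ma).symm.trans
      (intervalIntegrable_left hg mas)).comp_add_left a
    simpa using h
  have hI2 : IntervalIntegrable (fun r => ∫ x in (0 : ℝ)..r, g (a + x)) volume 0 s := by
    have := (hgs.absolutelyContinuousOnInterval_intervalIntegral (c := 0) (by simp)).continuousOn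
    exact this.intervalIntegrable
  rw [intervalIntegral.integral_add intervalIntegrable_const hI2, intervalIntegral.integral_const,
    smul_eq_mul, sub_zero] at e4
  have e5 : dblInt (fun r => g (a + r)) s = ∫ r in (0 : ℝ)..s, ∫ x in (0 : ℝ)..r, g (a + x) := rfl
  linarith

/-- Subtracting the chord over a cell leaves the second derivative unchanged and makes the boundary
values zero, so the interpolation error is given by the Green operator of the cell. -/
theorem green_sub_interpolation {g : ℝ → ℝ} {T a s L : ℝ} (hT : 0 < T) (hL : 0 < L)
    (hg : IntervalIntegrable g volume 0 T) (ha : 0 ≤ a) (hs : s ∈ Icc 0 L) (haL : a + L ≤ T) :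
    green T g (a + s) - ((1 - s / L) * green T g a + s / L * green T g (a + L)) =
      green L (fun r => g (a + r)) s := by
  simp only [green]
  rw [dblInt_shift hT hg ha hs.1 (by linarith [hs.2]), dblInt_shift hT hg ha hL.le haL]
  field_simp
  ring

theorem memLp_shift {p T a L : ℝ} {g : ℝ → ℝ} (hg : MemLp g (ENNReal.ofReal p) (segMeasure T))
    (ha : 0 ≤ a) (haL : a + L ≤ T) :
    MemLp (fun r => g (a + r)) (ENNReal.ofReal p) (segMeasure L) := by
  have h1 : MemLp g (ENNReal.ofReal p) (volume.restrict (Icc a (a + L))) :=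
    hg.mono_measure (Measure.restrict_mono (Icc_subset_Icc ha haL) le_rfl)
  have h2 := (measurePreserving_add_left volume a).restrict_preimage
    (s := Icc a (a + L)) measurableSet_Icc
  rw [preimage_const_add_Icc, sub_self, add_sub_cancel_left] at h2
  exact h1.comp_measurePreserving h2

theorem sum_integral_shift {f : ℝ → ℝ} {L : ℝ} (hL : 0 < L) (n : ℕ)
    (hf : IntervalIntegrable f volume 0 (n * L)) :
    ∑ k ∈ Finset.range n, ∫ s in (0 : ℝ)..L, f (k * L + s) = ∫ t in (0 : ℝ)..n * L, f t := by
  have h := intervalIntegral.sum_integral_adjacent_intervals (f := f) (μ := volume)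
    (a := fun k : ℕ => (k : ℝ) * L) (n := n) (fun k hk => hf.mono_set (by
      have h1 : ((k : ℝ) + 1) ≤ n := by exact_mod_cast hk
      rw [uIcc_of_le (by push_cast; nlinarith), uIcc_of_le (by positivity)]
      refine Icc_subset_Icc (by positivity) ?_
      push_cast
      nlinarith))
  simp only [Nat.cast_zero, zero_mul] at h
  rw [← h]
  refine Finset.sum_congr rfl fun k _ => ?_
  rw [intervalIntegral.integral_comp_add_left f, add_zero]
  congr 1
  push_cast; ring

/-- The piecewise linear function on the grid of step `L`, equal to `1` at the `i`-th node. -/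
noncomputable def hat (L : ℝ) (i : ℕ) (t : ℝ) : ℝ := max 0 (1 - |t / L - i|)

theorem continuous_hat (L : ℝ) (i : ℕ) : Continuous (hat L i) := by
  unfold hat
  fun_prop

/-- On a cell only the hat functions of its two end nodes are nonzero. -/
theorem sum_hat {L s : ℝ} (hL : 0 < L) (hs : s ∈ Icc 0 L) (a : ℕ → ℝ) {k n : ℕ} (hk : k < n) :
    ∑ i ∈ Finset.range (n + 1), a i * hat L i (k * L + s) =
      (1 - s / L) * a k + s / L * a (k + 1) := by
  have hx0 : 0 ≤ s / L := div_nonneg hs.1 hL.le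
  have hx1 : s / L ≤ 1 := (div_le_one hL).2 hs.2
  have e : ∀ i : ℕ, (k * L + s) / L - i = (k : ℝ) - i + s / L := fun i => by
    field_simp
    ring
  have h1 : hat L k (k * L + s) = 1 - s / L := by
    rw [hat, e, sub_self, zero_add, abs_of_nonneg hx0, max_eq_right (by linarith)]
  have h2 : hat L (k + 1) (k * L + s) = s / L := by
    rw [hat, e]
    push_cast
    rw [abs_of_nonpos (by linarith), max_eq_right (by linarith)]
    ring
  have h3 : ∀ i, i ≠ k → i ≠ k + 1 → hat L i (k * L + s) = 0 := by
    intro i hi1 hi2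
    rw [hat, e, max_eq_left]
    rcases lt_or_ge i k with h | h
    · have : (i : ℝ) + 1 ≤ k := by exact_mod_cast h
      rw [abs_of_nonneg (by linarith)]
      linarith
    · have h' : k + 2 ≤ i := by omega
      have : (k : ℝ) + 2 ≤ i := by exact_mod_cast h'
      rw [abs_of_nonpos (by linarith)]
      linarith
  rw [← Finset.sum_subset (s₁ := {k, k + 1})]
  · rw [Finset.sum_pair (by omega), h1, h2]
    ring
  · intro i hi
    simp only [Finset.mem_insert, Finset.mem_singleton] at hi
    rw [Finset.mem_range]
    omega
  · intro i _ hi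
    simp only [Finset.mem_insert, Finset.mem_singleton, not_or] at hi
    rw [h3 i hi.1 hi.2, mul_zero]

/-- The power mean inequality with exponent p/q ≥ 1. The upper bound uses it with q ≤ p, the lower
bound with the roles of p and q exchanged. -/
theorem sum_rpow_le {p q : ℝ} (hq : 0 < q) (hqp : q ≤ p) (n : ℕ) (x : ℕ → ℝ) (hx : ∀ k, 0 ≤ x k) :
    ∑ k ∈ Finset.range n, x k ^ (q / p) ≤
      (n : ℝ) ^ (1 - q / p) * (∑ k ∈ Finset.range n, x k) ^ (q / p) := by
  have hp : 0 < p := hq.trans_le hqp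
  have h := Real.rpow_sum_le_const_mul_sum_rpow (Finset.range n) (fun k => x k ^ (q / p))
    ((one_le_div hq).2 hqp)
  have e1 : ∀ k, |x k ^ (q / p)| = x k ^ (q / p) := fun k =>
    abs_of_nonneg (Real.rpow_nonneg (hx k) _)
  have e2 : ∀ k, (x k ^ (q / p)) ^ (p / q) = x k := fun k => by
    rw [← Real.rpow_mul (hx k), div_mul_div_cancel₀ hp.ne', div_self hq.ne', Real.rpow_one]
  simp only [e1, e2, Finset.card_range] at h
  have hS : 0 ≤ ∑ k ∈ Finset.range n, x k ^ (q / p) :=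
    Finset.sum_nonneg fun k _ => Real.rpow_nonneg (hx k) _
  have h2 := Real.rpow_le_rpow (Real.rpow_nonneg hS _) h (by positivity : 0 ≤ q / p)
  rw [← Real.rpow_mul hS, div_mul_div_cancel₀ hq.ne', div_self hp.ne', Real.rpow_one,
    Real.mul_rpow (by positivity) (Finset.sum_nonneg fun k _ => hx k), ← Real.rpow_mul
    (by positivity)] at h2
  refine h2.trans (le_of_eq ?_)
  congr 2
  field_simp

theorem LSeg.coeFn_sum_smul {q T : ℝ} {ι : Type*} (s : Finset ι) (a : ι → ℝ) (f : ι → LSeg q T)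
    (g : ι → ℝ → ℝ) (h : ∀ i ∈ s, f i =ᵐ[segMeasure T] g i) :
    (∑ i ∈ s, a i • f i : LSeg q T) =ᵐ[segMeasure T] fun t => ∑ i ∈ s, a i * g i t := by
  classical
  induction s using Finset.induction_on with
  | empty =>
    simp only [Finset.sum_empty]
    exact Lp.coeFn_zero _ _ _
  | insert i s hi ih =>
    have ih' := ih fun j hj => h j (Finset.mem_insert_of_mem hj)
    simp only [Finset.sum_insert hi]
    filter_upwards [ih', h i (Finset.mem_insert_self _ _), Lp.coeFn_add (a i • f i)
      (∑ i ∈ s, a i • f i), Lp.coeFn_smul (a i) (f i)] with t h1 h2 h3 h4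
    rw [h3, Pi.add_apply, h1, h4, Pi.smul_apply, h2, smul_eq_mul]

/-- The hat function, as an element of `L^q`. -/
noncomputable def hatLp (q T L : ℝ) (i : ℕ) : LSeg q T :=
  (continuousOn_memLp q (continuous_hat L i).continuousOn).toLp

theorem hatLp_coeFn (q T L : ℝ) (i : ℕ) : hatLp q T L i =ᵐ[segMeasure T] hat L i :=
  MemLp.coeFn_toLp _

section Interpolation

variable (p q T : ℝ) [hp : Fact (1 < p)] [hq : Fact (1 < q)] [hT : Fact (0 < T)]

/-- Piecewise linear interpolation at the interior nodes `i T / n`, `0 < i < n`. -/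
noncomputable def interp (n : ℕ) : W2D p T →L[ℝ] LSeg q T :=
  ∑ i ∈ Finset.Ioo 0 n,
    (pointEval p (projIcc 0 T hT.out.le (i * (T / n))).2).smulRight (hatLp q T (T / n) i)

/-- Functions vanishing at the ends need no end nodes; n - 1 hat functions span the range. -/
theorem rank_interp_lt {n : ℕ} (hn : 1 ≤ n) :
    LinearMap.rank (interp p q T n : W2D p T →ₗ[ℝ] LSeg q T) < n := by
  classical
  set s : Finset (LSeg q T) := (Finset.Ioo 0 n).image (hatLp q T (T / n)) with hs
  have h1 : LinearMap.range (interp p q T n : W2D p T →ₗ[ℝ] LSeg q T) ≤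
      Submodule.span ℝ (s : Set (LSeg q T)) := by
    rintro x ⟨u, rfl⟩
    simp only [interp, ContinuousLinearMap.coe_coe, sum_apply,
      ContinuousLinearMap.smulRight_apply]
    refine Submodule.sum_mem _ fun i hi => Submodule.smul_mem _ _ (Submodule.subset_span ?_)
    rw [hs, Finset.coe_image]
    exact ⟨i, hi, rfl⟩
  calc LinearMap.rank (interp p q T n : W2D p T →ₗ[ℝ] LSeg q T)
      ≤ Module.rank ℝ (Submodule.span ℝ (s : Set (LSeg q T))) := Submodule.rank_mono h1
    _ ≤ s.card := rank_span_finset_le s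
    _ ≤ ((Finset.Ioo 0 n).card : ℕ) := by exact_mod_cast Finset.card_image_le
    _ < n := by
      rw [Nat.card_Ioo]
      exact_mod_cast (by omega : n - 0 - 1 < n)

/-- The end nodes are restored with zero coefficients, so that all cells obey the same formula. -/
theorem interp_coeFn {n : ℕ} (hn : 1 ≤ n) (u : W2D p T) :
    interp p q T n u =ᵐ[segMeasure T] fun t => ∑ i ∈ Finset.range (n + 1),
      -green T (W2D.d2 p T u) (i * (T / n)) * hat (T / n) i t := by
  have hn0 : (0 : ℝ) < n := by exact_mod_cast hn
  have T0 : 0 < T := hT.out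
  have e : interp p q T n u = ∑ i ∈ Finset.Ioo 0 n,
      (-green T (W2D.d2 p T u) (i * (T / n))) • hatLp q T (T / n) i := by
    simp only [interp, sum_apply, ContinuousLinearMap.smulRight_apply]
    refine Finset.sum_congr rfl fun i hi => ?_
    rw [pointEval_apply, projIcc_of_mem]
    have hin : (i : ℝ) ≤ n := by exact_mod_cast (Finset.mem_Ioo.1 hi).2.le
    refine ⟨by positivity, ?_⟩
    calc (i : ℝ) * (T / n) ≤ n * (T / n) := mul_le_mul_of_nonneg_right hin (by positivity)
      _ = T := by field_simp
  rw [e]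
  filter_upwards [LSeg.coeFn_sum_smul (Finset.Ioo 0 n)
    (fun i : ℕ => -green T (W2D.d2 p T u) (i * (T / n))) (hatLp q T (T / n)) (hat (T / n))
    (fun i _ => hatLp_coeFn q T _ i)] with t ht
  rw [ht]
  refine Finset.sum_subset (fun i hi => ?_) fun i hi hi' => ?_
  · rw [Finset.mem_range]
    have := (Finset.mem_Ioo.1 hi).2
    omega
  · rw [Finset.mem_range] at hi
    rw [Finset.mem_Ioo] at hi'
    have : i = 0 ∨ i = n := by omega
    rcases this with rfl | rfl
    · simp [green_zero]
    · rw [show (i : ℝ) * (T / i) = T by field_simp, green_right T0]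
      simp

/-- The inequality on one cell applies to the error on each cell; the cell norms of the second
derivative are then summed with the power mean inequality, which costs n^{1-q/p}. -/
theorem interp_error {n : ℕ} (hn : 1 ≤ n) (u : W2D p T) {C : ℝ} (hC0 : 0 ≤ C)
    (hqp : q ≤ p) (hC : ∀ g, MemLp g (ENNReal.ofReal p) (segMeasure (T / n)) →
      ∫ t in (0 : ℝ)..T / n, |green (T / n) g t| ^ q ≤
        C * (∫ t in (0 : ℝ)..T / n, |g t| ^ p) ^ (q / p)) :
    ‖E2 p T q u - interp p q T n u‖ ^ q ≤ C * (n : ℝ) ^ (1 - q / p) * ‖u‖ ^ q := by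
  have hn0 : (0 : ℝ) < n := by exact_mod_cast hn
  have T0 : 0 < T := hT.out
  have p1 := hp.out
  have q1 := hq.out
  have hp0 : 0 < p := by linarith
  have hq0 : 0 < q := by linarith
  set L : ℝ := T / n with hL
  have L0 : 0 < L := by positivity
  have hnL : n * L = T := by rw [hL]; field_simp
  set g : ℝ → ℝ := ⇑(W2D.d2 p T u) with hg
  have hgm : MemLp g (ENNReal.ofReal p) (segMeasure T) := Lp.memLp _
  have hgi := MemLp.intervalIntegrable_seg p1 T0 hgm
  have hgp := MemLp.intervalIntegrable_rpow p1 T0 hgm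
  set f : ℝ → ℝ := fun t => -green T g t -
    ∑ i ∈ Finset.range (n + 1), -green T g (i * L) * hat L i t with hf
  have hfae : (E2 p T q u - interp p q T n u : LSeg q T) =ᵐ[segMeasure T] f := by
    filter_upwards [Lp.coeFn_sub (E2 p T q u) (interp p q T n u), E2_coeFn p T q u,
      W2D.fn_ae_eq u, interp_coeFn p q T hn u] with t h1 h2 h3 h4
    rw [h1, Pi.sub_apply, h2, h3, h4]
  have hfc : ContinuousOn f (Icc 0 T) :=
    (continuousOn_green T0 hgi).neg.sub (continuousOn_finsetSum _ fun i _ =>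
      continuousOn_const.mul (continuous_hat L i).continuousOn)
  have hk1 : ∀ k < n, (k : ℝ) * L + L ≤ T := fun k hk => by
    have : (k : ℝ) + 1 ≤ n := by exact_mod_cast hk
    rw [← hnL]
    nlinarith
  have hpiece : ∀ k < n, ∀ s ∈ Icc 0 L, |f (k * L + s)| = |green L (fun r => g (k * L + r)) s| := by
    intro k hk s hs
    rw [hf]
    simp only
    rw [sum_hat L0 hs (fun i : ℕ => -green T g (i * L)) hk, ← green_sub_interpolation T0 L0 hgi
      (by positivity) hs (hk1 k hk), ← abs_neg]
    congr 1
    push_cast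
    ring_nf
  rw [LSeg.norm_rpow_eq_of_ae q1 T0 _ hfae]
  have s1 := sum_integral_shift (f := fun t => |f t| ^ q) L0 n (by
    rw [hnL]
    exact continuousOn_intervalIntegrable T0 (continuousOn_abs_rpow hq0.le hfc))
  have s2 := sum_integral_shift (f := fun t => |g t| ^ p) L0 n (by rw [hnL]; exact hgp)
  rw [hnL] at s1 s2
  rw [← s1]
  have hx : ∀ k : ℕ, 0 ≤ ∫ s in (0 : ℝ)..L, |g (k * L + s)| ^ p := fun k =>
    intervalIntegral.integral_nonneg L0.le fun t _ => Real.rpow_nonneg (abs_nonneg _) _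
  calc ∑ k ∈ Finset.range n, ∫ s in (0 : ℝ)..L, |f (k * L + s)| ^ q
      ≤ ∑ k ∈ Finset.range n, C * (∫ s in (0 : ℝ)..L, |g (k * L + s)| ^ p) ^ (q / p) := by
        refine Finset.sum_le_sum fun k hk => ?_
        rw [Finset.mem_range] at hk
        have e : ∫ s in (0 : ℝ)..L, |f (k * L + s)| ^ q =
            ∫ s in (0 : ℝ)..L, |green L (fun r => g (k * L + r)) s| ^ q := by
          apply intervalIntegral.integral_congr
          intro s hs
          rw [uIcc_of_le L0.le] at hs
          simp only
          rw [hpiece k hk s hs]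
        rw [e]
        exact hC _ (memLp_shift hgm (by positivity) (hk1 k hk))
    _ ≤ C * ((n : ℝ) ^ (1 - q / p) *
          (∑ k ∈ Finset.range n, ∫ s in (0 : ℝ)..L, |g (k * L + s)| ^ p) ^ (q / p)) := by
        rw [← Finset.mul_sum]
        exact mul_le_mul_of_nonneg_left (sum_rpow_le hq0 hqp n _ hx) hC0
    _ = C * (n : ℝ) ^ (1 - q / p) * ‖u‖ ^ q := by
        rw [s2, hg, ← LSeg.norm_rpow_eq p1 T0, ← W2D.norm_eq, ← Real.rpow_mul (norm_nonneg _),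
          mul_div_cancel₀ _ hp0.ne', mul_assoc]

variable {p q T}

/-- The upper bound for the approximation numbers. -/
theorem approxNumber_E2_le {p' lam₁ : ℝ} (hpp : p.HolderConjugate p') (hqp : q ≤ p)
    (hlam₁ : 0 < lam₁) {w w' z z' : ℝ → ℝ} (h : IsAntiSol p' q lam₁ 1 w w' z z')
    (hz : ∫ t in (0 : ℝ)..1, |spow (z t) p'| ^ p = 1) {n : ℕ} (hn : 1 ≤ n) :
    approxNumber n (E2 p T q) ≤
      (lam₁ * ((T / n) ^ (-2 * q) * T ^ (-(p - q) / p))) ^ (-1 / q) := by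
  have hn0 : (0 : ℝ) < n := by exact_mod_cast hn
  have T0 : 0 < T := hT.out
  have p1 := hp.out
  have q1 := hq.out
  have hp0 : 0 < p := by linarith
  have hq0 : 0 < q := by linarith
  set C : ℝ := (lam₁ * ((T / n) ^ (-2 * q) * (T / n) ^ (-(p - q) / p)))⁻¹ with hC
  set sn : ℝ := lam₁ * ((T / n) ^ (-2 * q) * T ^ (-(p - q) / p)) with hsn
  have hsn0 : 0 < sn := by positivity
  have hC0 : 0 ≤ C := by positivity
  -- The cost of summation turns the factor (T/n)^{-(p-q)/p} of a cell into T^{-(p-q)/p}, so the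
  -- bound is exactly the n-th spectral number.
  have e : C * (n : ℝ) ^ (1 - q / p) = sn⁻¹ := by
    rw [hC, hsn, Real.div_rpow T0.le hn0.le (-(p - q) / p),
      show -(p - q) / p = -(1 - q / p) by field_simp, Real.rpow_neg hn0.le]
    field_simp
  refine (csInf_le (s := {r : ℝ | ∃ F : W2D p T →L[ℝ] LSeg q T,
    LinearMap.rank (F : W2D p T →ₗ[ℝ] LSeg q T) < n ∧ r = ‖E2 p T q - F‖})
    ⟨0, by rintro x ⟨F, -, rfl⟩; exact norm_nonneg _⟩
    ⟨interp p q T n, rank_interp_lt p q T hn, rfl⟩).trans ?_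
  refine ContinuousLinearMap.opNorm_le_bound _ (by positivity) fun u => ?_
  have h1 := interp_error p q T hn u hC0 hqp fun g hg =>
    integral_green_rpow_le_sharp hpp q1 hlam₁ h hz (by positivity) hg
  rw [e] at h1
  have h2 : (sn ^ (-1 / q) * ‖u‖) ^ q = sn⁻¹ * ‖u‖ ^ q := by
    rw [Real.mul_rpow (by positivity) (norm_nonneg _), ← Real.rpow_mul hsn0.le,
      div_mul_cancel₀ _ hq0.ne', Real.rpow_neg_one]
  rw [← h2] at h1
  exact (Real.rpow_le_rpow_iff (norm_nonneg _) (by positivity) hq0).1 h1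

end Interpolation

/-! ### The second derivative as an isometry of `W^{2,p}_D` onto `L^p` -/

theorem isWeakDeriv_primitive {T : ℝ} {g : ℝ → ℝ}
    (hg : IntervalIntegrable g volume 0 T) (a : ℝ) :
    IsWeakDeriv T (fun t => a + ∫ s in (0 : ℝ)..t, g s) g := by
  intro φ φs φc φt
  have hφac : AbsolutelyContinuousOnInterval φ 0 T :=
    (φs.contDiffOn.of_le (by simp)).absolutelyContinuousOnInterval
  have hac : AbsolutelyContinuousOnInterval (fun t => a + ∫ s in (0 : ℝ)..t, g s) 0 T :=
    (contDiffOn_const (c := a)).absolutelyContinuousOnInterval.fun_add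
      (hg.absolutelyContinuousOnInterval_intervalIntegral (c := 0) (by simp))
  rw [hac.integral_mul_deriv_eq_deriv_mul hφac]
  have z : ∀ x, x ∉ Ioo 0 T → φ x = 0 := by
    intro x hx
    by_contra hne
    exact hx (φt (subset_tsupport φ hne))
  rw [z 0 (by simp), z T (by simp)]
  have : ∫ x in (0 : ℝ)..T, deriv (fun t => a + ∫ s in (0 : ℝ)..t, g s) x * φ x =
      ∫ x in (0 : ℝ)..T, g x * φ x := by
    apply intervalIntegral.integral_congr_ae
    filter_upwards [hg.ae_hasDerivAt_integral] with x hx h2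
    rw [((hx (uIoc_subset_uIcc h2) 0 (by simp)).const_add a).deriv]
  rw [this]
  ring

theorem W2D.d2_surjective {p T : ℝ} [hp : Fact (1 < p)] [hT : Fact (0 < T)] :
    Function.Surjective (W2D.d2 p T) := by
  intro g
  have T0 := hT.out
  have hg := LSeg.intervalIntegrable hp.out T0 g
  -- The initial slope for which the second primitive of g vanishes at T.
  set a : ℝ := -(dblInt g T / T) with ha
  have hI := continuousOn_integral_Icc T0 hg
  have hI1 := continuousOn_intervalIntegrable T0 hI
  have hd : ContinuousOn (fun t => a + ∫ s in (0 : ℝ)..t, g s) (Icc 0 T) := continuousOn_const.add hI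
  have hd1 := continuousOn_intervalIntegrable T0 hd
  have hf : ContinuousOn (fun t => 0 + ∫ s in (0 : ℝ)..t, (a + ∫ r in (0 : ℝ)..s, g r)) (Icc 0 T) :=
    continuousOn_const.add (continuousOn_integral_Icc T0 hd1)
  have e1 := (continuousOn_memLp p hd).coeFn_toLp
  have e2 := (continuousOn_memLp p hf).coeFn_toLp
  refine ⟨⟨((continuousOn_memLp p hf).toLp, (continuousOn_memLp p hd).toLp, g),
    (isWeakDeriv_primitive hd1 0).congr T0 e2.symm e1.symm,
    (isWeakDeriv_primitive hg a).congr T0 e1.symm (ae_eq_refl _),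
    _, hf, e2, by simp, ?_⟩, rfl⟩
  rw [zero_add, intervalIntegral.integral_add intervalIntegrable_const hI1,
    intervalIntegral.integral_const, smul_eq_mul, sub_zero]
  change T * a + dblInt g T = 0
  rw [ha]
  field_simp
  ring

/-- The inverse of `u ↦ u''`. -/
noncomputable def W2D.ofSecond (p T : ℝ) [Fact (1 < p)] [Fact (0 < T)] : LSeg p T ≃ₗ[ℝ] W2D p T :=
  (LinearEquiv.ofBijective (W2D.d2 p T) ⟨W2D.d2_injective, W2D.d2_surjective⟩).symm

theorem W2D.d2_ofSecond {p T : ℝ} [Fact (1 < p)] [Fact (0 < T)] (g : LSeg p T) :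
    W2D.d2 p T (W2D.ofSecond p T g) = g :=
  LinearEquiv.apply_symm_apply (LinearEquiv.ofBijective (W2D.d2 p T) _) g

/-! ### Piecewise multiples of a function -/

/-- The function equal to `c k * η` on `[k L, (k + 1) L)`. -/
noncomputable def pieceMul (L : ℝ) (η : ℝ → ℝ) (c : ℕ → ℝ) (t : ℝ) : ℝ := c ⌊t / L⌋₊ * η t

/-- At s = L the floor jumps to the next cell, but η vanishes at the nodes, so the formula holds on
the closed cell. -/
theorem pieceMul_shift {L : ℝ} (hL : 0 < L) {η : ℝ → ℝ} (hη : Function.Antiperiodic η L)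
    (h0 : η 0 = 0) (c : ℕ → ℝ) (k : ℕ) {s : ℝ} (hs : s ∈ Icc 0 L) :
    pieceMul L η c (k * L + s) = c k * (-1) ^ k * η s := by
  have e : η (k * L + s) = (-1) ^ k * η s := by
    have := antiperiodic_add_int_mul hη s k
    rw [add_comm]
    simpa using this
  rw [pieceMul, e]
  rcases hs.2.eq_or_lt with h | h
  · have : η s = 0 := by
      rw [h, ← zero_add L, hη 0, h0, neg_zero]
    rw [this]; ring
  · have : ⌊((k : ℝ) * L + s) / L⌋₊ = k := by
      rw [add_div, mul_div_cancel_right₀ _ hL.ne', Nat.floor_eq_iff (by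
        have := div_nonneg hs.1 hL.le
        positivity)]
      exact ⟨by linarith [div_nonneg hs.1 hL.le], by linarith [(div_lt_one hL).2 h]⟩
    rw [this]; ring

theorem memLp_pieceMul {L T : ℝ} {η : ℝ → ℝ} (p : ℝ) (hL : 0 < L) (hη : Continuous η) (c : ℕ → ℝ) :
    MemLp (pieceMul L η c) (ENNReal.ofReal p) (segMeasure T) := by
  obtain ⟨K, hK⟩ := (isCompact_Icc (a := 0) (b := T)).exists_bound_of_continuousOn hη.continuousOn
  refine MemLp.of_bound (Measurable.aestronglyMeasurable ?_)
    ((∑ i ∈ Finset.range (⌊T / L⌋₊ + 1), |c i|) * K) ?_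
  · exact ((measurable_from_nat (f := c)).comp
      (Nat.measurable_floor.comp (measurable_id.div_const L))).mul hη.measurable
  · filter_upwards [ae_restrict_mem measurableSet_Icc] with t ht
    rw [pieceMul, norm_mul]
    refine mul_le_mul ?_ (hK t ht) (norm_nonneg _) (Finset.sum_nonneg fun _ _ => abs_nonneg _)
    refine Finset.single_le_sum (f := fun i => |c i|) (fun _ _ => abs_nonneg _) ?_
    rw [Finset.mem_range, Nat.lt_succ_iff]
    exact Nat.floor_le_floor (div_le_div_of_nonneg_right ht.2 hL.le)

theorem ae_eq_shift {T a L : ℝ} {f g : ℝ → ℝ} (h : f =ᵐ[segMeasure T] g)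
    (ha : 0 ≤ a) (haL : a + L ≤ T) :
    (fun r => f (a + r)) =ᵐ[segMeasure L] fun r => g (a + r) := by
  have h1 : f =ᵐ[volume.restrict (Icc a (a + L))] g :=
    ae_mono (Measure.restrict_mono (Icc_subset_Icc ha haL) le_rfl) h
  have h2 := (measurePreserving_add_left volume a).restrict_preimage
    (s := Icc a (a + L)) measurableSet_Icc
  rw [preimage_const_add_Icc, sub_self, add_sub_cancel_left] at h2
  exact h2.quasiMeasurePreserving.ae_eq_comp h1

/-! ### Reflected sequences -/

/-- The space `ℝⁿ` with the `ℓ^q` norm. -/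
abbrev SeqLp (q : ℝ) (n : ℕ) : Type := PiLp (ENNReal.ofReal q) fun _ : Fin n => ℝ

theorem SeqLp.norm_rpow_eq {q : ℝ} {n : ℕ} (hq : 1 < q) (x : SeqLp q n) :
    ‖x‖ ^ q = ∑ k, |x k| ^ q := by
  have hq0 : 0 < q := by linarith
  rw [PiLp.norm_eq_sum (by rw [ENNReal.toReal_ofReal hq0.le]; exact hq0),
    ENNReal.toReal_ofReal hq0.le, ← Real.rpow_mul (Finset.sum_nonneg fun _ _ =>
      Real.rpow_nonneg (norm_nonneg _) _), one_div_mul_cancel hq0.ne', Real.rpow_one]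
  rfl

/-- The sequence `x₀, x₀, x₁, …, x_{n-1}, x_{n-1}, …`. -/
def padded {n : ℕ} (hn : 1 ≤ n) (x : Fin n → ℝ) (j : ℕ) : ℝ := x ⟨min (j - 1) (n - 1), by omega⟩

theorem padded_zero {n : ℕ} (hn : 1 ≤ n) (x : Fin n → ℝ) : padded hn x 0 = padded hn x 1 := by
  simp [padded]

theorem padded_last {n : ℕ} (hn : 1 ≤ n) (x : Fin n → ℝ) :
    padded hn x (n + 1) = padded hn x n := by
  simp [padded]

theorem padded_succ {n : ℕ} (hn : 1 ≤ n) (x : Fin n → ℝ) (k : Fin n) :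
    padded hn x (k + 1) = x k := by
  rw [padded]
  congr 1
  ext
  simp only
  omega

theorem add_rpow_le_two {x y q : ℝ} (hq : 1 < q) :
    |x + y| ^ q ≤ 2 ^ (q - 1) * (|x| ^ q + |y| ^ q) := by
  have h : (|x| + |y|) ^ q ≤ 2 ^ (q - 1) * (|x| ^ q + |y| ^ q) := by
    exact_mod_cast NNReal.rpow_add_le_mul_rpow_add_rpow ‖x‖₊ ‖y‖₊ hq.le
  exact (Real.rpow_le_rpow (abs_nonneg _) (abs_add_le x y) (by linarith)).trans h

/-- By convexity it suffices to add the two shifted sums. Each differs from the central one by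
boundary terms, and these cancel because y is reflected at both ends. -/
theorem sum_abs_add_rpow_le {q : ℝ} (hq : 1 < q) {n : ℕ} {y : ℕ → ℝ} (h0 : y 0 = y 1)
    (hn : y (n + 1) = y n) :
    ∑ k ∈ Finset.range n, |y k + y (k + 2)| ^ q ≤
      2 ^ q * ∑ k ∈ Finset.range n, |y (k + 1)| ^ q := by
  have e1 : ∑ k ∈ Finset.range n, |y k| ^ q + |y n| ^ q =
      ∑ k ∈ Finset.range n, |y (k + 1)| ^ q + |y 0| ^ q := by
    rw [← Finset.sum_range_succ, Finset.sum_range_succ']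
  have e2 : ∑ k ∈ Finset.range n, |y (k + 1)| ^ q + |y (n + 1)| ^ q =
      ∑ k ∈ Finset.range n, |y (k + 2)| ^ q + |y 1| ^ q := by
    have := Finset.sum_range_succ' (fun k => |y (k + 1)| ^ q) n
    rw [Finset.sum_range_succ] at this
    exact this
  rw [hn] at e2
  rw [h0] at e1
  calc ∑ k ∈ Finset.range n, |y k + y (k + 2)| ^ q
      ≤ ∑ k ∈ Finset.range n, 2 ^ (q - 1) * (|y k| ^ q + |y (k + 2)| ^ q) :=
        Finset.sum_le_sum fun k _ => add_rpow_le_two hq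
    _ = 2 ^ (q - 1) * (2 * ∑ k ∈ Finset.range n, |y (k + 1)| ^ q) := by
        rw [← Finset.mul_sum, Finset.sum_add_distrib]
        congr 1
        linarith
    _ = 2 ^ q * ∑ k ∈ Finset.range n, |y (k + 1)| ^ q := by
        rw [← mul_assoc, Real.rpow_sub_one (by norm_num), div_mul_cancel₀ _ (by norm_num)]

section SeqMaps

variable {q : ℝ} {n : ℕ} (hn : 1 ≤ n)

/-- The sum of the two neighbours, for the reflected sequence. -/
noncomputable def neighbourSum (q : ℝ) : SeqLp q n →ₗ[ℝ] SeqLp q n where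
  toFun x := WithLp.toLp _ fun k => padded hn x k + padded hn x (k + 2)
  map_add' x y := by
    ext k
    simp only [padded, PiLp.add_apply]
    ring
  map_smul' a x := by
    ext k
    simp only [padded, PiLp.smul_apply, smul_eq_mul, RingHom.id_apply]
    ring

theorem neighbourSum_apply (x : SeqLp q n) (k : Fin n) :
    neighbourSum hn q x k = padded hn x k + padded hn x (k + 2) := rfl

theorem norm_neighbourSum_le [hq : Fact (1 < q)] (x : SeqLp q n) : ‖neighbourSum hn q x‖ ≤ 2 * ‖x‖ := by
  have q1 := hq.out
  have hq0 : 0 < q := by linarith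
  refine (Real.rpow_le_rpow_iff (norm_nonneg _) (by positivity) hq0).1 ?_
  rw [Real.mul_rpow (by norm_num) (norm_nonneg _), SeqLp.norm_rpow_eq q1, SeqLp.norm_rpow_eq q1]
  have h := sum_abs_add_rpow_le q1 (padded_zero hn x) (padded_last hn x)
  rw [Finset.sum_range, Finset.sum_range] at h
  simp only [padded_succ] at h
  exact h

/-- The map `x ↦ (y_{k-1} + 2 y_k + y_{k+1})` for the reflected sequence `y` of `x`. -/
noncomputable def weights (q : ℝ) : SeqLp q n →ₗ[ℝ] SeqLp q n :=
  neighbourSum hn q + (2 : ℝ) • LinearMap.id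

theorem weights_apply (x : SeqLp q n) (k : Fin n) :
    weights hn q x k = padded hn x k + 2 * padded hn x (k + 1) + padded hn x (k + 2) := by
  simp only [weights, LinearMap.add_apply, LinearMap.smul_apply, LinearMap.id_apply,
    PiLp.add_apply, PiLp.smul_apply, smul_eq_mul, neighbourSum_apply, padded_succ]
  ring

theorem norm_weights_le [hq : Fact (1 < q)] (x : SeqLp q n) : ‖weights hn q x‖ ≤ 4 * ‖x‖ := by
  simp only [weights, LinearMap.add_apply, LinearMap.smul_apply, LinearMap.id_apply]
  refine (norm_add_le _ _).trans ?_
  rw [norm_smul, Real.norm_of_nonneg zero_le_two]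
  linarith [norm_neighbourSum_le hn x]

/-- A diagonally dominant map. -/
noncomputable def dominantMap (q m D : ℝ) : SeqLp q n →ₗ[ℝ] SeqLp q n :=
  (4 * m + 2 * D) • LinearMap.id - D • neighbourSum hn q

theorem dominantMap_apply (m D : ℝ) (x : SeqLp q n) (k : Fin n) :
    dominantMap hn q m D x k = (4 * m + 2 * D) * padded hn x (k + 1) -
      D * (padded hn x k + padded hn x (k + 2)) := by
  simp only [dominantMap, LinearMap.sub_apply, LinearMap.smul_apply, LinearMap.id_apply,
    PiLp.sub_apply, PiLp.smul_apply, smul_eq_mul, neighbourSum_apply, padded_succ]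

/-- The neighbour sum has norm at most 2, so it can remove at most 2D from the diagonal 4m + 2D; the
remaining bound 4m does not depend on D. -/
theorem le_norm_dominantMap [hq : Fact (1 < q)] {m D : ℝ} (hm : 0 ≤ m) (hD : 0 ≤ D) (x : SeqLp q n) :
    4 * m * ‖x‖ ≤ ‖dominantMap hn q m D x‖ := by
  simp only [dominantMap, LinearMap.sub_apply, LinearMap.smul_apply, LinearMap.id_apply]
  have h := norm_sub_norm_le ((4 * m + 2 * D) • x) (D • neighbourSum hn q x)
  rw [norm_smul, norm_smul, Real.norm_of_nonneg hD, Real.norm_of_nonneg (by positivity)] at h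
  nlinarith [mul_le_mul_of_nonneg_left (norm_neighbourSum_le hn x) hD]

theorem dominantMap_injective [hq : Fact (1 < q)] {m D : ℝ} (hm : 0 < m) (hD : 0 ≤ D) :
    Function.Injective (dominantMap hn q m D) := by
  rw [injective_iff_map_eq_zero]
  intro x hx
  have h := le_norm_dominantMap hn hm.le hD x
  rw [hx, norm_zero] at h
  have : ‖x‖ ≤ 0 := by
    by_contra hlt
    push Not at hlt
    have : 0 < 4 * m * ‖x‖ := by positivity
    linarith
  exact norm_le_zero_iff.1 this

end SeqMaps

/-! ### Integrals of the reference solution over one period -/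

section Period

variable {p p' q lam L : ℝ} {w w' z z' : ℝ → ℝ}

theorem IsAntiSol.hasDerivAt (h : IsAntiSol p' q lam L w w' z z') (t : ℝ) :
    HasDerivAt w (w' t) t ∧ HasDerivAt w' (-spow (z t) p') t ∧ HasDerivAt z (z' t) t ∧
      HasDerivAt z' (-(lam * spow (w t) q)) t :=
  ⟨by simpa using h.du t (mem_univ _), by simpa using h.du' t (mem_univ _),
    by simpa using h.dv t (mem_univ _), by simpa using h.dv' t (mem_univ _)⟩

theorem IsAntiSol.w_right (h : IsAntiSol p' q lam L w w' z z') : w L = 0 := by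
  rw [← zero_add L, h.anti_w 0, h.w_zero, neg_zero]

theorem IsAntiSol.z_right (h : IsAntiSol p' q lam L w w' z z') : z L = 0 := by
  rw [← zero_add L, h.anti_z 0, h.z_zero, neg_zero]

/-- The function w'z - wz' vanishes at both ends, and its derivative is λ|w|^q - |[z]^{p'}|^p. -/
theorem IsAntiSol.energy (hpp : p.HolderConjugate p') (hq : 1 < q)
    (h : IsAntiSol p' q lam L w w' z z') :
    lam * ∫ t in (0 : ℝ)..L, |w t| ^ q = ∫ t in (0 : ℝ)..L, |spow (z t) p'| ^ p := by
  have c1 : Continuous fun t => |w t| ^ q :=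
    (Real.continuous_rpow_const (by linarith)).comp h.continuous_w.abs
  have c2 := h.continuous_abs_spow hpp.symm.lt hpp.pos.le
  have e : ∀ t, |spow (z t) p'| ^ p = z t * spow (z t) p' := by
    intro t
    rw [mul_spow hpp.symm.lt, abs_spow hpp.symm.lt, ← Real.rpow_mul (abs_nonneg _)]
    congr 1
    linarith [hpp.mul_eq_add]
  have d : ∀ t, HasDerivAt (fun t => w' t * z t - w t * z' t)
      (lam * |w t| ^ q - |spow (z t) p'| ^ p) t := by
    intro t
    obtain ⟨h1, h2, h3, h4⟩ := h.hasDerivAt t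
    refine ((h2.mul h3).sub (h1.mul h4)).congr_deriv ?_
    rw [e, ← mul_spow hq]
    ring
  have i1 : IntervalIntegrable (fun t => lam * |w t| ^ q) volume 0 L :=
    (continuous_const.mul c1).intervalIntegrable _ _
  have i2 := c2.intervalIntegrable (μ := volume) 0 L
  have key := intervalIntegral.integral_eq_sub_of_hasDerivAt (fun t _ => d t) (i1.sub i2)
  rw [intervalIntegral.integral_sub i1 i2, intervalIntegral.integral_const_mul, h.w_right,
    h.z_right, h.w_zero, h.z_zero] at key
  linarith

theorem IsAntiSol.w_nonneg (h : IsAntiSol p' q lam L w w' z z') {t : ℝ} (ht : t ∈ Icc 0 L) :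
    0 ≤ w t := by
  rcases ht.1.eq_or_lt with h1 | h1
  · rw [← h1, h.w_zero]
  · rcases ht.2.eq_or_lt with h2 | h2
    · rw [h2, h.w_right]
    · exact (h.w_pos t ⟨h1, h2⟩).le

theorem IsAntiSol.z_nonneg (h : IsAntiSol p' q lam L w w' z z') {t : ℝ} (ht : t ∈ Icc 0 L) :
    0 ≤ z t := by
  rcases ht.1.eq_or_lt with h1 | h1
  · rw [← h1, h.z_zero]
  · rcases ht.2.eq_or_lt with h2 | h2
    · rw [h2, h.z_right]
    · exact (h.z_pos t ⟨h1, h2⟩).le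

theorem spow_nonneg {x r : ℝ} (hx : 0 ≤ x) : 0 ≤ spow x r :=
  mul_nonneg (Real.rpow_nonneg (abs_nonneg _) _) hx

theorem IsAntiSol.integral_second (hp' : 1 < p') (h : IsAntiSol p' q lam L w w' z z') (s : ℝ) :
    ∫ t in (0 : ℝ)..s, -spow (z t) p' = w' s - w' 0 :=
  intervalIntegral.integral_eq_sub_of_hasDerivAt (fun t _ => (h.hasDerivAt t).2.1)
    ((((continuous_spow hp').comp h.continuous_z).neg).intervalIntegrable _ _)

theorem IsAntiSol.dblInt_second (hp' : 1 < p') (h : IsAntiSol p' q lam L w w' z z') (s : ℝ) :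
    dblInt (fun t => -spow (z t) p') s = w s - w' 0 * s := by
  have d : ∀ t, HasDerivAt (fun t => w t - w' 0 * t) (w' t - w' 0) t := fun t => by
    simpa using (h.hasDerivAt t).1.fun_sub ((hasDerivAt_id t).const_mul (w' 0))
  have c : Continuous w' := continuous_iff_continuousAt.2 fun t => (h.hasDerivAt t).2.1.continuousAt
  simp only [dblInt, h.integral_second hp']
  rw [intervalIntegral.integral_eq_sub_of_hasDerivAt (fun t _ => d t)
    ((c.sub continuous_const).intervalIntegrable _ _), h.w_zero]
  ring

/-- Concavity gives w(t) ≤ w'(0) t, symmetry gives w(t) ≤ w'(0)(L - t), and the average of the two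
is the bound. -/
theorem IsAntiSol.w_le (hp' : 1 < p') (h : IsAntiSol p' q lam L w w' z z') {t : ℝ}
    (ht : t ∈ Icc 0 L) : w t ≤ L * w' 0 / 2 := by
  have key : ∀ s ∈ Icc 0 L, w s ≤ w' 0 * s := by
    intro s hs
    have h1 : dblInt (fun t => -spow (z t) p') s ≤ 0 := by
      have : 0 ≤ -dblInt (fun t => -spow (z t) p') s := by
        rw [dblInt, ← intervalIntegral.integral_neg]
        refine intervalIntegral.integral_nonneg hs.1 fun r hr => ?_
        rw [← intervalIntegral.integral_neg]
        refine intervalIntegral.integral_nonneg hr.1 fun x hx => ?_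
        rw [neg_neg]
        exact spow_nonneg (h.z_nonneg ⟨hx.1, hx.2.trans (hr.2.trans hs.2)⟩)
      linarith
    rw [h.dblInt_second hp'] at h1
    linarith
  have h1 := key t ht
  have h2 := key (L - t) ⟨by linarith [ht.2], by linarith [ht.1]⟩
  rw [h.symm t ht] at h2
  linarith

/-- By symmetry about L/2 the weights t/L and 1 - t/L have equal moments, and they sum to 1. -/
theorem IsAntiSol.integral_moment (hq : 1 < q) (hL : 0 < L)
    (h : IsAntiSol p' q lam L w w' z z') :
    ∫ t in (0 : ℝ)..L, spow (w t) q * (t / L) = (∫ t in (0 : ℝ)..L, spow (w t) q) / 2 ∧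
      ∫ t in (0 : ℝ)..L, spow (w t) q * (1 - t / L) = (∫ t in (0 : ℝ)..L, spow (w t) q) / 2 := by
  have c : Continuous fun t => spow (w t) q := (continuous_spow hq).comp h.continuous_w
  have e1 := intervalIntegral.integral_comp_sub_left (a := 0) (b := L)
    (fun t => spow (w t) q * (t / L)) L
  rw [sub_self, sub_zero] at e1
  have e2 : ∫ t in (0 : ℝ)..L, spow (w (L - t)) q * ((L - t) / L) =
      ∫ t in (0 : ℝ)..L, spow (w t) q * (1 - t / L) := by
    apply intervalIntegral.integral_congr
    intro t ht
    rw [uIcc_of_le hL.le] at ht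
    simp only
    rw [h.symm t ht, sub_div, div_self hL.ne']
  have e3 : (∫ t in (0 : ℝ)..L, spow (w t) q * (t / L)) +
      ∫ t in (0 : ℝ)..L, spow (w t) q * (1 - t / L) = ∫ t in (0 : ℝ)..L, spow (w t) q := by
    rw [← intervalIntegral.integral_add]
    · congr 1; ext t; ring
    · exact (c.mul (by fun_prop)).intervalIntegrable _ _
    · exact (c.mul (by fun_prop)).intervalIntegrable _ _
  constructor <;> linarith

/-- This inequality is the nonnegativity of D in the diagonally dominant map, that is, the
favourable sign of its off-diagonal part. -/
theorem IsAntiSol.integral_rpow_le (hp' : 1 < p') (hq : 1 < q) (hL : 0 < L)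
    (h : IsAntiSol p' q lam L w w' z z') :
    ∫ t in (0 : ℝ)..L, |w t| ^ q ≤ (∫ t in (0 : ℝ)..L, spow (w t) q) / 2 * (L * w' 0) := by
  have c : Continuous fun t => spow (w t) q := (continuous_spow hq).comp h.continuous_w
  have c1 : Continuous fun t => |w t| ^ q :=
    (Real.continuous_rpow_const (by linarith)).comp h.continuous_w.abs
  calc ∫ t in (0 : ℝ)..L, |w t| ^ q ≤ ∫ t in (0 : ℝ)..L, L * w' 0 / 2 * spow (w t) q := by
        refine intervalIntegral.integral_mono_on hL.le (c1.intervalIntegrable _ _)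
          ((continuous_const.mul c).intervalIntegrable _ _) fun t ht => ?_
        rw [← mul_spow hq]
        exact mul_le_mul_of_nonneg_right (h.w_le hp' ht) (spow_nonneg (h.w_nonneg ht))
    _ = _ := by rw [intervalIntegral.integral_const_mul]; ring

theorem IsAntiSol.integral_rpow_pos (hq : 1 < q) (hL : 0 < L)
    (h : IsAntiSol p' q lam L w w' z z') : 0 < ∫ t in (0 : ℝ)..L, |w t| ^ q := by
  have c1 : Continuous fun t => |w t| ^ q :=
    (Real.continuous_rpow_const (by linarith)).comp h.continuous_w.abs
  refine intervalIntegral.intervalIntegral_pos_of_pos_on (c1.intervalIntegrable _ _)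
    (fun t ht => Real.rpow_pos_of_pos (abs_pos.2 (h.w_pos t ht).ne') _) hL

end Period

/-! ### A lower bound for isomorphism numbers -/

/-- The real supremum is meaningful only for a bounded set. Since n ≥ 1, the space G is nontrivial,
so 1 = ‖A S B‖ ≤ ‖A‖ ‖S‖ ‖B‖; this bounds every candidate by ‖S‖ and keeps both norms positive. -/
theorem inv_le_isoNumber {X Y G : Type} [NormedAddCommGroup X] [NormedSpace ℝ X]
    [NormedAddCommGroup Y] [NormedSpace ℝ Y] [NormedAddCommGroup G] [NormedSpace ℝ G]
    [CompleteSpace G] {S : X →L[ℝ] Y} {n : ℕ} (hn : 1 ≤ n) (A : Y →L[ℝ] G) (B : G →L[ℝ] X)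
    (hG : (n : Cardinal) ≤ Module.rank ℝ G)
    (h : (A.comp S).comp B = ContinuousLinearMap.id ℝ G) {r : ℝ} (hr : ‖A‖ * ‖B‖ ≤ r) :
    r⁻¹ ≤ isoNumber n S := by
  have key : ∀ (G : Type) (_ : NormedAddCommGroup G) (_ : NormedSpace ℝ G) (A : Y →L[ℝ] G)
      (B : G →L[ℝ] X), (n : Cardinal) ≤ Module.rank ℝ G →
      (A.comp S).comp B = ContinuousLinearMap.id ℝ G → 1 ≤ ‖A‖ * ‖S‖ * ‖B‖ := by
    intro G _ _ A B hG h
    have : Nontrivial G := by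
      rw [← rank_pos_iff_nontrivial (R := ℝ)]
      exact lt_of_lt_of_le (by exact_mod_cast hn) hG
    calc (1 : ℝ) = ‖(A.comp S).comp B‖ := by rw [h, ContinuousLinearMap.norm_id]
      _ ≤ ‖A.comp S‖ * ‖B‖ := ContinuousLinearMap.opNorm_comp_le _ _
      _ ≤ ‖A‖ * ‖S‖ * ‖B‖ := mul_le_mul_of_nonneg_right (ContinuousLinearMap.opNorm_comp_le _ _)
          (norm_nonneg _)
  have pos : 0 < ‖A‖ * ‖B‖ := by
    have h1 := key G _ _ A B hG h
    refine lt_of_le_of_ne (by positivity) fun h0 => ?_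
    rw [mul_right_comm, ← h0, zero_mul] at h1
    linarith
  refine (inv_anti₀ pos hr).trans ?_
  rw [mul_inv]
  refine le_csSup ⟨‖S‖, ?_⟩ ⟨G, _, _, ‹_›, A, B, hG, h, rfl⟩
  rintro x ⟨G, _, _, _, A, B, hG, h, rfl⟩
  have h1 := key G _ _ A B hG h
  have hA : 0 < ‖A‖ := lt_of_le_of_ne (norm_nonneg _) fun h0 => by
    rw [← h0] at h1; norm_num at h1
  have hB : 0 < ‖B‖ := lt_of_le_of_ne (norm_nonneg _) fun h0 => by
    rw [← h0] at h1; norm_num at h1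
  rw [← mul_inv, inv_le_iff_one_le_mul₀ (by positivity)]
  linarith

/-! ### Gluing multiples of the reference solution -/

theorem dblInt_congr {f g : ℝ → ℝ} {s : ℝ} (hs : 0 ≤ s) (h : EqOn f g (Icc 0 s)) :
    dblInt f s = dblInt g s := by
  apply intervalIntegral.integral_congr
  intro r hr
  rw [uIcc_of_le hs] at hr
  apply intervalIntegral.integral_congr
  intro x hx
  rw [uIcc_of_le hr.1] at hx
  exact h ⟨hx.1, hx.2.trans hr.2⟩

section Glue

variable {p p' q lam L : ℝ} {w w' z z' : ℝ → ℝ}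

theorem IsAntiSol.anti_second (h : IsAntiSol p' q lam L w w' z z') :
    Function.Antiperiodic (fun t => -spow (z t) p') L := fun t => by
  simp only
  rw [h.anti_z t, spow_neg]

theorem IsAntiSol.second_zero (h : IsAntiSol p' q lam L w w' z z') : -spow (z 0) p' = 0 := by
  rw [h.z_zero, spow_zero, neg_zero]

theorem IsAntiSol.continuous_second (hp' : 1 < p') (h : IsAntiSol p' q lam L w w' z z') :
    Continuous fun t => -spow (z t) p' :=
  ((continuous_spow hp').comp h.continuous_z).neg

/-- The weights `y k + 2 y (k + 1) + y (k + 2)`. -/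
def binomSum (y : ℕ → ℝ) (k : ℕ) : ℝ := y k + 2 * y (k + 1) + y (k + 2)

/-- The second derivative of the glued function. -/
noncomputable def gluedSecond (p' L : ℝ) (z : ℝ → ℝ) (y : ℕ → ℝ) : ℝ → ℝ :=
  pieceMul L (fun t => -spow (z t) p') (binomSum y)

/-- The values of the glued function at the nodes, for `κ = L w'(0)`. -/
def nodeValue (κ : ℝ) (y : ℕ → ℝ) (k : ℕ) : ℝ := (-1) ^ k * κ * (y (k + 1) - y k)

theorem IsAntiSol.integral_glued_shift (hp' : 1 < p') (hL : 0 < L)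
    (h : IsAntiSol p' q lam L w w' z z') (y : ℕ → ℝ) (k : ℕ) {s : ℝ} (hs : s ∈ Icc 0 L) :
    ∫ r in (0 : ℝ)..s, gluedSecond p' L z y (k * L + r) =
        binomSum y k * (-1) ^ k * (w' s - w' 0) ∧
      dblInt (fun r => gluedSecond p' L z y (k * L + r)) s =
        binomSum y k * (-1) ^ k * (w s - w' 0 * s) := by
  have e : EqOn (fun r => gluedSecond p' L z y (k * L + r))
      (fun r => binomSum y k * (-1) ^ k * -spow (z r) p') (Icc 0 s) := fun r hr =>
    pieceMul_shift hL h.anti_second h.second_zero _ k ⟨hr.1, hr.2.trans hs.2⟩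
  constructor
  · rw [← h.integral_second hp', ← intervalIntegral.integral_const_mul]
    apply intervalIntegral.integral_congr
    rwa [uIcc_of_le hs.1]
  · rw [dblInt_congr hs.1 e, dblInt_const_mul, h.dblInt_second hp']

/-- Write f for `nodeValue` and c for `binomSum`, with κ = L w'(0). Continuity of the slope across a
node requires f_{k+2} - 2f_{k+1} + f_k = (-1)^k κ (c_{k+1} - c_k), an identity for these choices.
The two formulas, value and slope at the k-th node, are therefore proved by a joint induction; the
subtracted term is L times the initial slope of the glued function. -/
theorem IsAntiSol.glued_nodes (hp' : 1 < p') (hL : 0 < L) (h : IsAntiSol p' q lam L w w' z z')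
    {n : ℕ} {T : ℝ} (hT : n * L = T) {y : ℕ → ℝ} (hy : y 0 = y 1)
    (hg : IntervalIntegrable (gluedSecond p' L z y) volume 0 T) {k : ℕ} (hk : k ≤ n) :
    dblInt (gluedSecond p' L z y) (k * L) = nodeValue (L * w' 0) y k -
        k * (nodeValue (L * w' 0) y 1 + L * w' 0 * binomSum y 0) ∧
      L * ∫ r in (0 : ℝ)..k * L, gluedSecond p' L z y r =
        nodeValue (L * w' 0) y (k + 1) - nodeValue (L * w' 0) y k +
          L * (-1) ^ k * w' 0 * binomSum y k -
          (nodeValue (L * w' 0) y 1 + L * w' 0 * binomSum y 0) := by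
  induction k with
  | zero => simp [dblInt, nodeValue, hy]
  | succ k ih =>
    obtain ⟨h1, h2⟩ := ih (by omega)
    have hkT : (k : ℝ) * L + L ≤ T := by
      have : (k : ℝ) + 1 ≤ n := by exact_mod_cast hk
      rw [← hT]
      nlinarith
    have T0 : 0 < T := lt_of_lt_of_le (by positivity) hkT
    have hLm : L ∈ Icc 0 L := ⟨hL.le, le_rfl⟩
    obtain ⟨s1, s2⟩ := h.integral_glued_shift hp' hL y k hLm
    have e : ((k + 1 : ℕ) : ℝ) * L = k * L + L := by push_cast; ring
    have hw : w' L = -w' 0 := by rw [← h.anti_w' 0, zero_add]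
    have hi : (∫ r in (0 : ℝ)..k * L, gluedSecond p' L z y r) +
        ∫ r in (0 : ℝ)..L, gluedSecond p' L z y (k * L + r) =
        ∫ r in (0 : ℝ)..k * L + L, gluedSecond p' L z y r := by
      have ma : (k : ℝ) * L ∈ Icc 0 T := ⟨by positivity, by linarith⟩
      have mb : (k : ℝ) * L + L ∈ Icc 0 T := ⟨by positivity, hkT⟩
      rw [intervalIntegral.integral_comp_add_left (gluedSecond p' L z y), add_zero]
      exact intervalIntegral.integral_add_adjacent_intervals (intervalIntegrable_left hg ma)
        ((intervalIntegrable_left hg ma).symm.trans (intervalIntegrable_left hg mb))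
    rw [e, ← hi, dblInt_shift T0 hg (by positivity) hL.le hkT, s1, s2, h1, hw, h.w_right]
    constructor
    · push_cast
      linear_combination h2
    · simp only [nodeValue, binomSum] at h2 ⊢
      linear_combination h2

/-- The reflection at both ends makes the first and last node values zero, which matches the
boundary values of the Green operator. -/
theorem IsAntiSol.green_glued (hp' : 1 < p') (hL : 0 < L) (h : IsAntiSol p' q lam L w w' z z')
    {n : ℕ} {T : ℝ} (hT : n * L = T) {y : ℕ → ℝ} (hy : y 0 = y 1) (hyn : y (n + 1) = y n)
    (hg : IntervalIntegrable (gluedSecond p' L z y) volume 0 T) {k : ℕ} (hk : k < n) {s : ℝ}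
    (hs : s ∈ Icc 0 L) :
    -green T (gluedSecond p' L z y) (k * L + s) = binomSum y k * (-1) ^ k * w s +
      ((1 - s / L) * nodeValue (L * w' 0) y k + s / L * nodeValue (L * w' 0) y (k + 1)) := by
  obtain ⟨h1, h2⟩ := h.glued_nodes hp' hL hT hy hg hk.le
  have h3 := (h.glued_nodes hp' hL hT hy hg le_rfl).1
  have hn : nodeValue (L * w' 0) y n = 0 := by rw [nodeValue, hyn, sub_self, mul_zero]
  have hkT : (k : ℝ) * L + L ≤ T := by
    have : (k : ℝ) + 1 ≤ n := by exact_mod_cast hk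
    rw [← hT]
    nlinarith
  have T0 : 0 < T := lt_of_lt_of_le (by positivity) hkT
  have n0 : (0 : ℝ) < n := by exact_mod_cast (by omega : 0 < n)
  rw [hT, hn] at h3
  have s2 := (h.integral_glued_shift hp' hL y k hs).2
  rw [green, dblInt_shift T0 hg (by positivity) hs.1 (by linarith [hs.2]), s2, h3, h1]
  have h4 := eq_div_of_mul_eq hL.ne' ((mul_comm _ _).trans h2)
  rw [h4, ← hT]
  field_simp
  ring

/-- The bump contributes m (y_k + 2y_{k+1} + y_{k+2}). By symmetry the linear part contributes half
the integral of [w]^q times the sum of the two node values, up to the sign (-1)^k; this is (m +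
D)(2y_{k+1} - y_k - y_{k+2}). -/
theorem IsAntiSol.moment_glued (hp' : 1 < p') (hq : 1 < q) (hL : 0 < L)
    (h : IsAntiSol p' q lam L w w' z z') {n : ℕ} {T : ℝ} (hT : n * L = T) {y : ℕ → ℝ}
    (hy : y 0 = y 1) (hyn : y (n + 1) = y n)
    (hg : IntervalIntegrable (gluedSecond p' L z y) volume 0 T) {k : ℕ} (hk : k < n)
    {m D : ℝ} (hm : ∫ t in (0 : ℝ)..L, |w t| ^ q = m)
    (hD : (∫ t in (0 : ℝ)..L, spow (w t) q) / 2 * (L * w' 0) = m + D) :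
    ∫ s in (0 : ℝ)..L, spow (w (k * L + s)) q * -green T (gluedSecond p' L z y) (k * L + s) =
      (4 * m + 2 * D) * y (k + 1) - D * (y k + y (k + 2)) := by
  have c : Continuous fun t => spow (w t) q := (continuous_spow hq).comp h.continuous_w
  have c1 : Continuous fun t => |w t| ^ q :=
    (Real.continuous_rpow_const (by linarith)).comp h.continuous_w.abs
  obtain ⟨m1, m2⟩ := h.integral_moment hq hL
  set f := nodeValue (L * w' 0) y with hf
  have hsq : ((-1 : ℝ) ^ k) * (-1) ^ k = 1 := by
    rw [← mul_pow]; norm_num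
  have e : ∫ s in (0 : ℝ)..L, spow (w (k * L + s)) q *
      -green T (gluedSecond p' L z y) (k * L + s) =
      ∫ s in (0 : ℝ)..L, (binomSum y k * |w s| ^ q +
        ((-1) ^ k * f k * (spow (w s) q * (1 - s / L)) +
          (-1) ^ k * f (k + 1) * (spow (w s) q * (s / L)))) := by
    apply intervalIntegral.integral_congr
    intro s hs
    rw [uIcc_of_le hL.le] at hs
    have ew : spow (w (k * L + s)) q = (-1) ^ k * spow (w s) q := by
      have h1 := antiperiodic_add_int_mul h.anti_w s k
      rw [add_comm] at h1
      rcases Nat.even_or_odd k with hk | hk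
      · rw [hk.neg_one_pow, one_mul]
        simp only [Int.cast_natCast, zpow_natCast, hk.neg_one_pow, one_mul] at h1
        rw [h1]
      · rw [hk.neg_one_pow]
        simp only [Int.cast_natCast, zpow_natCast, hk.neg_one_pow, neg_one_mul] at h1
        rw [h1, spow_neg, neg_one_mul]
    simp only
    rw [h.green_glued hp' hL hT hy hyn hg hk hs, ew, ← mul_spow hq]
    linear_combination (binomSum y k * w s * spow (w s) q) * hsq
  rw [e, intervalIntegral.integral_add, intervalIntegral.integral_add,
    intervalIntegral.integral_const_mul, intervalIntegral.integral_const_mul,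
    intervalIntegral.integral_const_mul, m1, m2, hm]
  · simp only [hf, nodeValue, binomSum, pow_succ]
    linear_combination ((2 * y (k + 1) - y k - y (k + 2)) *
      ((∫ t in (0 : ℝ)..L, spow (w t) q) / 2 * (L * w' 0))) * hsq +
      (2 * y (k + 1) - y k - y (k + 2)) * hD
  all_goals exact Continuous.intervalIntegrable (by fun_prop) _ _

end Glue

/-! ### Local moments -/

section Moments

variable {q T L : ℝ} {n : ℕ}

theorem node_add_le (hL : 0 < L) (hT : n * L = T) (k : Fin n) : (k : ℝ) * L + L ≤ T := by
  have : (k : ℝ) + 1 ≤ n := by exact_mod_cast k.2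
  rw [← hT]
  nlinarith

theorem intervalIntegrable_shift [hq : Fact (1 < q)] (hL : 0 < L) (hT : n * L = T)
    {ψ : ℝ → ℝ} (hψ : Continuous ψ) (f : LSeg q T) (k : Fin n) :
    IntervalIntegrable (fun s => ψ (k * L + s) * f (k * L + s)) volume 0 L := by
  have h := MemLp.intervalIntegrable_seg hq.out hL
    (memLp_shift (Lp.memLp f) (by positivity) (node_add_le hL hT k))
  refine h.continuousOn_mul (Continuous.continuousOn ?_)
  fun_prop

theorem integral_mul_shift_congr (hL : 0 < L) (hT : n * L = T) (ψ : ℝ → ℝ) {f g : ℝ → ℝ}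
    (h : f =ᵐ[segMeasure T] g) (k : Fin n) :
    ∫ s in (0 : ℝ)..L, ψ (k * L + s) * f (k * L + s) =
      ∫ s in (0 : ℝ)..L, ψ (k * L + s) * g (k * L + s) := by
  apply intervalIntegral.integral_congr_ae
  refine ae_interval_of_ae_seg hL ?_
  filter_upwards [ae_eq_shift h (by positivity : (0 : ℝ) ≤ k * L) (node_add_le hL hT k)] with s hs
  rw [hs]

/-- The moments of a function against `ψ` over the pieces `[k L, (k + 1) L]`. -/
noncomputable def moments [hq : Fact (1 < q)] (hL : 0 < L) (hT : n * L = T) {ψ : ℝ → ℝ}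
    (hψ : Continuous ψ) : LSeg q T →ₗ[ℝ] SeqLp q n where
  toFun f := WithLp.toLp _ fun k => ∫ s in (0 : ℝ)..L, ψ (k * L + s) * f (k * L + s)
  map_add' f g := by
    ext k
    simp only [PiLp.add_apply]
    rw [integral_mul_shift_congr hL hT ψ (Lp.coeFn_add f g) k, ← intervalIntegral.integral_add
      (intervalIntegrable_shift hL hT hψ f k) (intervalIntegrable_shift hL hT hψ g k)]
    simp only [Pi.add_apply, mul_add]
  map_smul' a f := by
    ext k
    simp only [PiLp.smul_apply, smul_eq_mul, RingHom.id_apply]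
    rw [integral_mul_shift_congr hL hT ψ (Lp.coeFn_smul a f) k,
      ← intervalIntegral.integral_const_mul]
    simp only [Pi.smul_apply, smul_eq_mul, mul_left_comm]

/-- Hölder on each cell, with a test function whose norm is the same on all cells; the q-th powers
then add up. -/
theorem norm_moments_le {q' : ℝ} [hq : Fact (1 < q)] (hqq : q.HolderConjugate q') (hL : 0 < L)
    (hT : n * L = T) {ψ : ℝ → ℝ} (hψ : Continuous ψ) {m : ℝ}
    (hm : ∀ k : Fin n, ∫ s in (0 : ℝ)..L, |ψ (k * L + s)| ^ q' = m) (hm0 : 0 ≤ m) (hn : 1 ≤ n)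
    (f : LSeg q T) : ‖moments hL hT hψ f‖ ≤ m ^ (1 / q') * ‖f‖ := by
  have q1 := hq.out
  have hq0 : 0 < q := by linarith
  have n0 : (0 : ℝ) < n := by exact_mod_cast hn
  have T0 : 0 < T := by rw [← hT]; positivity
  refine (Real.rpow_le_rpow_iff (norm_nonneg _) (by positivity) hq0).1 ?_
  have hfp := MemLp.intervalIntegrable_rpow q1 T0 (Lp.memLp f)
  have hs := sum_integral_shift (f := fun t => |f t| ^ q) hL n (by rw [hT]; exact hfp)
  rw [hT, ← LSeg.norm_rpow_eq q1 T0, Finset.sum_range] at hs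
  rw [SeqLp.norm_rpow_eq q1, Real.mul_rpow (by positivity) (norm_nonneg _), ← hs, Finset.mul_sum]
  refine Finset.sum_le_sum fun k _ => ?_
  have hmem := memLp_shift (Lp.memLp f) (by positivity : (0 : ℝ) ≤ k * L) (node_add_le hL hT k)
  have hψm : MemLp (fun s => |ψ (k * L + s)|) (ENNReal.ofReal q') (segMeasure L) :=
    continuousOn_memLp q' (Continuous.continuousOn (by fun_prop))
  have h1 : |moments hL hT hψ f k| ≤ m ^ (1 / q') *
      (∫ s in (0 : ℝ)..L, |f (k * L + s)| ^ q) ^ (1 / q) := by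
    refine (intervalIntegral.abs_integral_le_integral_abs hL.le).trans ?_
    simp only [abs_mul]
    have := integral_mul_le_of_nonneg hqq.symm hL (fun t _ => abs_nonneg _)
      (fun t _ => abs_nonneg _) hψm hmem.abs
    rwa [hm k] at this
  have h0 : 0 ≤ ∫ s in (0 : ℝ)..L, |f (k * L + s)| ^ q :=
    intervalIntegral.integral_nonneg hL.le fun _ _ => Real.rpow_nonneg (abs_nonneg _) _
  refine (Real.rpow_le_rpow (abs_nonneg _) h1 hq0.le).trans (le_of_eq ?_)
  rw [Real.mul_rpow (by positivity) (by positivity), ← Real.rpow_mul h0,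
    one_div_mul_cancel hq0.ne', Real.rpow_one]

end Moments

/-! ### The factorization through `ℓ^q` -/

section Factor

variable {p p' q lam L T : ℝ} {w w' z z' : ℝ → ℝ} [hp : Fact (1 < p)] [hT : Fact (0 < T)] {n : ℕ}

/-- The linear map sending `x` to the function glued along the reflected sequence of `x`. -/
noncomputable def glue (p T : ℝ) [hp : Fact (1 < p)] [hT : Fact (0 < T)] (hp' : 1 < p')
    (hL : 0 < L) (h : IsAntiSol p' q lam L w w' z z') (hn : 1 ≤ n) : SeqLp q n →ₗ[ℝ] W2D p T :=
  (W2D.ofSecond p T).toLinearMap ∘ₗ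
  { toFun := fun x =>
      (memLp_pieceMul (T := T) p hL (h.continuous_second hp') (binomSum (padded hn x))).toLp
    map_add' := fun x y => by
      rw [← MemLp.toLp_add]
      congr 1
      ext t
      simp only [pieceMul, binomSum, padded, PiLp.add_apply, Pi.add_apply]
      ring
    map_smul' := fun a x => by
      rw [RingHom.id_apply, ← MemLp.toLp_const_smul]
      congr 1
      ext t
      simp only [pieceMul, binomSum, padded, PiLp.smul_apply, Pi.smul_apply, smul_eq_mul]
      ring }

theorem d2_glue (hp' : 1 < p') (hL : 0 < L) (h : IsAntiSol p' q lam L w w' z z') (hn : 1 ≤ n)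
    (x : SeqLp q n) :
    W2D.d2 p T (glue p T hp' hL h hn x) =ᵐ[segMeasure T] gluedSecond p' L z (padded hn x) := by
  rw [glue, LinearMap.comp_apply, LinearEquiv.coe_coe, W2D.d2_ofSecond]
  exact (memLp_pieceMul p hL (h.continuous_second hp') (binomSum (padded hn x))).coeFn_toLp

/-- Each cell carries |c_k|^p / n. Passing from ℓ^p to ℓ^q costs n^{1-p/q}, as p ≤ q, and the
amplitude map has norm at most 4 on ℓ^q. -/
theorem norm_glue_le [hq : Fact (1 < q)] (hpp : p.HolderConjugate p') (hpq : p ≤ q) (hL : 0 < L)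
    (hnL : n * L = T) (h : IsAntiSol p' q lam L w w' z z') (hn : 1 ≤ n)
    (hz : n * ∫ t in (0 : ℝ)..L, |spow (z t) p'| ^ p = 1) (x : SeqLp q n) :
    ‖glue p T hpp.symm.lt hL h hn x‖ ≤ 4 * (n : ℝ) ^ (-1 / q) * ‖x‖ := by
  have p1 := hp.out
  have q1 := hq.out
  have hp0 : 0 < p := by linarith
  have hq0 : 0 < q := by linarith
  have n0 : (0 : ℝ) < n := by exact_mod_cast hn
  have T0 := hT.out
  set c := binomSum (padded hn x) with hc
  have hgi := MemLp.intervalIntegrable_rpow p1 T0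
    (memLp_pieceMul (T := T) p hL (h.continuous_second hpp.symm.lt) c)
  have hs := sum_integral_shift hL n (by rw [hnL]; exact hgi)
  rw [hnL] at hs
  have e : ∀ k ∈ Finset.range n, ∫ s in (0 : ℝ)..L,
      |pieceMul L (fun t => -spow (z t) p') c (k * L + s)| ^ p = |c k| ^ p * (n : ℝ)⁻¹ := by
    intro k _
    have e1 : ∫ t in (0 : ℝ)..L, |spow (z t) p'| ^ p = (n : ℝ)⁻¹ := eq_inv_of_mul_eq_one_right hz
    rw [← e1, ← intervalIntegral.integral_const_mul]
    apply intervalIntegral.integral_congr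
    intro s hs
    rw [uIcc_of_le hL.le] at hs
    simp only
    rw [pieceMul_shift hL h.anti_second h.second_zero c k hs, abs_mul, abs_mul, abs_neg, abs_pow,
      abs_neg, abs_one, one_pow, mul_one, Real.mul_rpow (abs_nonneg _) (abs_nonneg _)]
  rw [Finset.sum_congr rfl e, ← Finset.sum_mul] at hs
  -- Here p and q exchange their roles, and the summands are |c_k|^q.
  have hsum := sum_rpow_le hp0 hpq n (fun k => |c k| ^ q)
    fun k => Real.rpow_nonneg (abs_nonneg _) _
  have e2 : ∀ k, (|c k| ^ q) ^ (p / q) = |c k| ^ p := fun k => by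
    rw [← Real.rpow_mul (abs_nonneg _), mul_div_cancel₀ _ hq0.ne']
  have e3 : ∑ k ∈ Finset.range n, |c k| ^ q = ‖weights hn q x‖ ^ q := by
    rw [SeqLp.norm_rpow_eq q1, Finset.sum_range]
    refine Finset.sum_congr rfl fun k _ => ?_
    rw [weights_apply, hc, binomSum]
  simp only [e2] at hsum
  rw [e3, ← Real.rpow_mul (norm_nonneg _), mul_div_cancel₀ _ hq0.ne'] at hsum
  refine (Real.rpow_le_rpow_iff (norm_nonneg _) (by positivity) hp0).1 ?_
  rw [W2D.norm_eq, LSeg.norm_rpow_eq_of_ae p1 T0 _ (d2_glue hpp.symm.lt hL h hn x), gluedSecond,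
    ← hc, ← hs]
  calc (∑ k ∈ Finset.range n, |c k| ^ p) * (n : ℝ)⁻¹
      ≤ (n : ℝ) ^ (1 - p / q) * (4 * ‖x‖) ^ p * (n : ℝ)⁻¹ := by
        refine mul_le_mul_of_nonneg_right (hsum.trans ?_) (by positivity)
        refine mul_le_mul_of_nonneg_left ?_ (by positivity)
        exact Real.rpow_le_rpow (norm_nonneg _) (norm_weights_le hn x) hp0.le
    _ = (4 * (n : ℝ) ^ (-1 / q) * ‖x‖) ^ p := by
        rw [Real.mul_rpow (by positivity) (norm_nonneg _), Real.mul_rpow (by positivity)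
          (norm_nonneg _), Real.mul_rpow (by positivity) (by positivity), ← Real.rpow_mul n0.le,
          show -1 / q * p = (1 - p / q) + (-1) by ring, Real.rpow_add n0, Real.rpow_neg_one]
        ring

theorem moments_glue [hq : Fact (1 < q)] (hp' : 1 < p') (hL : 0 < L) (hnL : n * L = T)
    (h : IsAntiSol p' q lam L w w' z z') (hn : 1 ≤ n)
    (hψ : Continuous fun t => spow (w t) q) {m D : ℝ} (hm : ∫ t in (0 : ℝ)..L, |w t| ^ q = m)
    (hD : (∫ t in (0 : ℝ)..L, spow (w t) q) / 2 * (L * w' 0) = m + D) (x : SeqLp q n) :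
    moments hL hnL hψ (E2 p T q (glue p T hp' hL h hn x)) = dominantMap hn q m D x := by
  have T0 := hT.out
  set y := padded hn x with hy
  have hg : IntervalIntegrable (gluedSecond p' L z y) volume 0 T :=
    MemLp.intervalIntegrable_seg hp.out T0 (memLp_pieceMul p hL (h.continuous_second hp') _)
  have hae : E2 p T q (glue p T hp' hL h hn x) =ᵐ[segMeasure T]
      fun t => -green T (gluedSecond p' L z y) t := by
    filter_upwards [E2_coeFn p T q (glue p T hp' hL h hn x),
      W2D.fn_ae_eq (glue p T hp' hL h hn x), ae_restrict_mem measurableSet_Icc] with t h1 h2 h3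
    rw [h1, h2, green_congr_ae T0 (d2_glue hp' hL h hn x) h3]
  ext k
  rw [dominantMap_apply, ← h.moment_glued hp' hq.out hL hnL (padded_zero hn x) (padded_last hn x)
    hg k.2 hm hD]
  exact integral_mul_shift_congr hL hnL (fun t => spow (w t) q) hae k

theorem SeqLp.rank_eq (q : ℝ) (n : ℕ) : Module.rank ℝ (SeqLp q n) = n := by
  rw [(WithLp.linearEquiv (ENNReal.ofReal q) ℝ (Fin n → ℝ)).rank_eq, rank_fun', Fintype.card_fin]

/-- The lower bound for the isomorphism numbers. -/
theorem IsAntiSol.le_isoNumber_E2 [hq : Fact (1 < q)] (hpp : p.HolderConjugate p') (hpq : p ≤ q)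
    (hlam : 0 < lam) (hL : 0 < L) (hnL : n * L = T) (h : IsAntiSol p' q lam L w w' z z')
    (hn : 1 ≤ n) (hz : n * ∫ t in (0 : ℝ)..L, |spow (z t) p'| ^ p = 1) :
    lam ^ (-1 / q) ≤ isoNumber n (E2 p T q) := by
  have q1 := hq.out
  have hq0 : 0 < q := by linarith
  have n0 : (0 : ℝ) < n := by exact_mod_cast hn
  have hqq := Real.HolderConjugate.conjExponent q1
  set q' := q.conjExponent with hq'
  have hψ : Continuous fun t => spow (w t) q := (continuous_spow q1).comp h.continuous_w
  set m : ℝ := ∫ t in (0 : ℝ)..L, |w t| ^ q with hm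
  have m0 : 0 < m := h.integral_rpow_pos q1 hL
  -- The energy identity turns the normalization of the second derivative into the value of ∫ |w|^q
  -- over a cell.
  have hmlam : n * m = lam⁻¹ := by
    have := h.energy hpp q1
    rw [← this] at hz
    exact eq_inv_of_mul_eq_one_right (by linarith)
  set D : ℝ := (∫ t in (0 : ℝ)..L, spow (w t) q) / 2 * (L * w' 0) - m with hDdef
  have hD0 : 0 ≤ D := sub_nonneg.2 (h.integral_rpow_le hpp.symm.lt q1 hL)
  have hD : (∫ t in (0 : ℝ)..L, spow (w t) q) / 2 * (L * w' 0) = m + D := by rw [hDdef]; ring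
  have hmk : ∀ k : Fin n, ∫ s in (0 : ℝ)..L, |spow (w (k * L + s)) q| ^ q' = m := by
    intro k
    rw [hm]
    congr 1
    ext s
    have e := antiperiodic_add_int_mul h.anti_w s k
    rw [add_comm (k * L : ℝ), show w (s + k * L) = (-1) ^ (k : ℕ) * w s by simpa using e,
      abs_spow q1, ← Real.rpow_mul (abs_nonneg _), abs_mul, abs_pow, abs_neg, abs_one, one_pow,
      one_mul]
    congr 1
    linarith [hqq.mul_eq_add]
  let R : SeqLp q n ≃ₗ[ℝ] SeqLp q n :=
    LinearEquiv.ofInjectiveEndo (dominantMap hn q m D) (dominantMap_injective hn m0 hD0)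
  have hR : ∀ x, R x = dominantMap hn q m D x := fun x => rfl
  -- The moments, followed by the inverse of the diagonally dominant map; the lower bound 4m of that
  -- map gives the denominator.
  let A : LSeg q T →L[ℝ] SeqLp q n :=
    (R.symm.toLinearMap ∘ₗ moments hL hnL hψ).mkContinuous (m ^ (1 / q') / (4 * m)) fun f => by
      have h1 := norm_moments_le hqq hL hnL hψ hmk m0.le hn f
      have h2 := le_norm_dominantMap hn m0.le hD0 (R.symm (moments hL hnL hψ f))
      rw [← hR, LinearEquiv.apply_symm_apply] at h2
      rw [LinearMap.comp_apply, LinearEquiv.coe_coe, div_mul_eq_mul_div, le_div_iff₀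
        (by positivity)]
      linarith
  let B : SeqLp q n →L[ℝ] W2D p T :=
    (glue p T hpp.symm.lt hL h hn).mkContinuous (4 * (n : ℝ) ^ (-1 / q))
      (norm_glue_le hpp hpq hL hnL h hn hz)
  have hA : ‖A‖ ≤ m ^ (1 / q') / (4 * m) := LinearMap.mkContinuous_norm_le _ (by positivity) _
  have hB : ‖B‖ ≤ 4 * (n : ℝ) ^ (-1 / q) := LinearMap.mkContinuous_norm_le _ (by positivity) _
  have hAB : (A.comp (E2 p T q)).comp B = ContinuousLinearMap.id ℝ (SeqLp q n) := by
    ext1 x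
    change R.symm (moments hL hnL hψ (E2 p T q (glue p T hpp.symm.lt hL h hn x))) = x
    rw [moments_glue hpp.symm.lt hL hnL h hn hψ hm.symm hD x, ← hR, LinearEquiv.symm_apply_apply]
  -- The factors 4 cancel, and m^{1/q'}/m · n^{-1/q} = (nm)^{-1/q} = λ^{1/q}.
  have hr : ‖A‖ * ‖B‖ ≤ lam ^ (1 / q) := by
    refine (mul_le_mul hA hB (norm_nonneg _) (by positivity)).trans (le_of_eq ?_)
    have e1 : lam = (n * m)⁻¹ := by rw [hmlam, inv_inv]
    have e2 : m ^ (1 / q') = m * m ^ (-(1 / q)) := by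
      rw [show 1 / q' = 1 + -(1 / q) by linarith [hqq.one_div_add_one_div],
        Real.rpow_add m0, Real.rpow_one]
    rw [e1, Real.inv_rpow (by positivity), ← Real.rpow_neg (by positivity),
      Real.mul_rpow n0.le m0.le, e2, neg_div]
    field_simp
  have := inv_le_isoNumber hn A B (SeqLp.rank_eq q n).ge hAB hr
  rwa [← Real.rpow_neg hlam.le, ← neg_div] at this

end Factor

/-- The lower bound for the isomorphism numbers in terms of the first spectral number. -/
theorem le_isoNumber_E2 {p p' q T lam₁ : ℝ} [Fact (1 < p)] [Fact (1 < q)] [hT : Fact (0 < T)]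
    (hpp : p.HolderConjugate p') (hpq : p ≤ q) (hlam₁ : 0 < lam₁) {w w' z z' : ℝ → ℝ}
    (h : IsAntiSol p' q lam₁ 1 w w' z z') (hz : ∫ t in (0 : ℝ)..1, |spow (z t) p'| ^ p = 1)
    {n : ℕ} (hn : 1 ≤ n) :
    (lam₁ * ((T / n) ^ (-2 * q) * T ^ (-(p - q) / p))) ^ (-1 / q) ≤ isoNumber n (E2 p T q) := by
  have T0 := hT.out
  have n0 : (0 : ℝ) < n := by exact_mod_cast hn
  have hc : 0 < T / n := by positivity
  set a : ℝ := (T / n) ^ 2 * T ^ (-1 / p) with ha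
  have ha0 : 0 < a := by positivity
  have hs := h.scale hpp (Fact.out) ha0 hc
  rw [mul_assoc, ha, spectral_factor T0 hc, mul_one, ← ha] at hs
  -- The rescaled reference solution has antiperiod T/n; each cell carries the share 1/n of the p-th
  -- power of the norm.
  refine hs.le_isoNumber_E2 hpp hpq (by positivity) hc (by field_simp) hn ?_
  have h1 := h.integral_scaled hpp ha0 hc hz 1
  rw [Nat.cast_one, one_mul] at h1
  have h2 : a / (T / n) ^ 2 = T ^ (-1 / p) := by rw [ha]; field_simp
  rw [h1, h2, ← Real.rpow_mul T0.le, div_mul_cancel₀ _ hpp.pos.ne', Real.rpow_neg_one]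
  field_simp

theorem spectralNumber_rpow {p q T lam₁ : ℝ} (hp : 0 < p) (hq : 0 < q) (hT : 0 < T)
    (hlam₁ : 0 < lam₁) {n : ℕ} (hn : 1 ≤ n) :
    (lam₁ * ((T / n) ^ (-2 * q) * T ^ (-(p - q) / p))) ^ (-1 / q) =
      T ^ (1 / q + 2 - 1 / p) / ((n : ℝ) ^ 2 * lam₁ ^ (1 / q)) := by
  have n0 : (0 : ℝ) < n := by exact_mod_cast hn
  have hTn : 0 < T / n := by positivity
  rw [Real.mul_rpow hlam₁.le (by positivity), Real.mul_rpow (by positivity) (by positivity),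
    ← Real.rpow_mul hTn.le, ← Real.rpow_mul hT.le, neg_div, Real.rpow_neg hlam₁.le,
    show -2 * q * -(1 / q) = (2 : ℕ) by field_simp; norm_num, Real.rpow_natCast,
    show -(p - q) / p * -(1 / q) = 1 / q - 1 / p by field_simp,
    show 1 / q + 2 - 1 / p = (2 : ℕ) + (1 / q - 1 / p) by push_cast; ring, Real.rpow_add hT,
    Real.rpow_natCast]
  field_simp

end Biharmonic

theorem mainTheorem8 (p q T : ℝ) [Fact (1 < p)] [Fact (1 < q)] [Fact (0 < T)] :
    ∃ (lam1 : ℝ) (sn : ℕ → ℝ),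
      (∀ lam : ℝ, Biharmonic.IsSpectralNumber p q 1 1 lam ↔ lam = lam1) ∧
      (∀ n : ℕ, 1 ≤ n → ∀ lam : ℝ, Biharmonic.IsSpectralNumber p q T n lam ↔ lam = sn n) ∧
      (p < q → ∀ n : ℕ, 1 ≤ n →
        sn n ^ (-1 / q) ≤ Biharmonic.isoNumber n (Biharmonic.E2 p T q) ∧
        sn n ^ (-1 / q) = T ^ (1 / q + 2 - 1 / p) / ((n : ℝ) ^ 2 * lam1 ^ (1 / q))) ∧
      (q ≤ p → ∀ n : ℕ, 1 ≤ n →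
        Biharmonic.approxNumber n (Biharmonic.E2 p T q) ≤ sn n ^ (-1 / q) ∧
        sn n ^ (-1 / q) = T ^ (1 / q + 2 - 1 / p) / ((n : ℝ) ^ 2 * lam1 ^ (1 / q))) := by
  have hp : 1 < p := Fact.out
  have hq : 1 < q := Fact.out
  have hT : 0 < T := Fact.out
  have hpp := Real.HolderConjugate.conjExponent hp
  -- The extremal on [0, 1], extended antiperiodically, is the reference solution behind all
  -- spectral numbers and both bounds; hence λ₁ = 1/Q.
  obtain ⟨Q, u, u', v, v', hQ, hpos, -, hv, -⟩ :=
    Biharmonic.exists_extremal (L := 1) hpp hq one_pos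
  have hlam : 0 < 1 / Q := by positivity
  obtain ⟨w, w', z, z', h, -, ez⟩ := hpos.exists_isAntiSol hpp hq hlam
  have hz : ∫ t in (0 : ℝ)..1, |Biharmonic.spow (z t) p.conjExponent| ^ p = 1 := by
    refine Eq.trans (intervalIntegral.integral_congr fun t ht => ?_) hv
    rw [uIcc_of_le zero_le_one] at ht
    rw [ez ht]
  refine ⟨1 / Q, fun n => 1 / Q * ((T / n) ^ (-2 * q) * T ^ (-(p - q) / p)), fun lam => ?_,
    fun n hn lam => Biharmonic.isSpectralNumber_iff hpp hq hlam h hz hT hn lam,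
    fun hpq n hn => ⟨Biharmonic.le_isoNumber_E2 hpp hpq.le hlam h hz hn,
      Biharmonic.spectralNumber_rpow hpp.pos (by linarith) hT hlam hn⟩,
    fun hqp n hn => ⟨Biharmonic.approxNumber_E2_le hpp hqp hlam h hz hn,
      Biharmonic.spectralNumber_rpow hpp.pos (by linarith) hT hlam hn⟩⟩
  rw [Biharmonic.isSpectralNumber_iff hpp hq hlam h hz one_pos le_rfl lam]
  simp
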